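/- **Conventions.** Let $A$ be a principal ideal domain, $S$ a set, $F_S$ the free group on $S$, and $R\subseteq F_S$ a set of relations. All spaces are pointed simplicial sets, and $\overline{C^*}(X;A)$ denotes the augmentation ideal (cochains vanishing at the basepoint) of the normalized simplicial cochain algebra of $X$ with the cup product. Let $Bar(X;A)=\bigoplus_{p\ge 0}(\mathbf s^{-1}\overline{C^*}(X;A))^{\otimes p}$, where $c_1|\dots|c_p$ has weight $p$ and degree $\sum_i(|c_i|-1)$, with differential $$d_{Bar}(c_1|\dots|c_p)=-\sum_{i=1}^p(-1)^{(i-1)+|c_1|+\dots+|c_{i-1}|}\,c_1|\dots|dc_i|\dots|c_p-\sum_{i=1}^{p-1}(-1)^{i+|c_1|+\dots+|c_i|}\,c_1|\dots|c_i\smile c_{i+1}|\dots|c_p .$$ Write $H^*_{Bar}(X;A)$ for its cohomology. For an inclusion $X\hookrightarrow Y$ let $Bar(Y,X;A)=\ker(Bar(Y;A)\to Bar(X;A))$, with cohomology $H^*_{Bar}(Y,X;A)$. The relative Massey product is the connecting homomorphism $$\mu\colon H^0_{Bar}(X;A)\to H^1_{Bar}(Y,X;A),\qquad \mu(T)=[d_{Bar}\tilde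 T],$$ where $\tilde T\in Bar^0(Y;A)$ is any lift of $T$. The weight one part of $Bar(Y,X;A)$ is the shifted complex $\mathbf s^{-1}C^*(Y,X;A)$ with differential $\mathbf s^{-1}c\mapsto-\mathbf s^{-1}dc$. It gives the homomorphism $$\omega\colon H^2(Y,X;A)\to H^1_{Bar}(Y,X;A),\qquad[\kappa]\mapsto[-\mathbf s^{-1}\kappa],$$ normalized so that $\mu(\alpha)=\omega([d\tilde\alpha])$ for a $1$-cocycle $\alpha$ of $X$ extended to a cochain $\tilde\alpha$ of $Y$. A class in the image of $\omega$ is said to have weight $1$. **Spaces.** Let $X_S$ be the wedge of circles with one vertex and one edge for every $s\in S$. An element of $T(A^S)=\bigoplus_p(A^S)^{\otimes p}$ is regarded as a class in $H^0_{Bar}(X_S;A)$, with $A^S$ the $1$-cochains of $X_S$. For a word $w=s_1^{\varepsilon_1}\cdots s_n^{\varepsilon_n}$ (not necessarily reduced) let $S^1(w)$ be the circle subdivided into $n+1$ segments: a standard segment starting at the basepoint, followed by segments $1,\dots,n$, the $i$-th being oriented by $\varepsilon_i$. Let $\tilde w\colon S^1(w)\to X_S$ collapse the standard segment and send the $i$-th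 segment to the edge $s_i$. For every $r\in R$ choose a word representing $r$, and let $X_{S|R}$ be the presentation complex obtained as the reduced mapping cone of $\bigvee_{r\in R}S^1(r)\to X_S$. The relation disc $D^2(r)$ is the reduced cone on $S^1(r)$, and $[D^2(r)]\in H_2(X_{S|R},X_S;A)$ is its relative fundamental class, oriented so that its boundary is the loop $r$. **Letter-braiding numbers.** Let $S^1=\Delta[1]/\partial\Delta[1]$, so that $H^0_{Bar}(S^1;A)\cong A[t]$, where $t^n$ is represented by $\tau|\dots|\tau$ and $\tau$ is the $1$-cochain with value $1$ on the edge. Collapsing all segments but the standard one is a homotopy equivalence $S^1(w)\to S^1$, and it induces $A[t]\cong H^0_{Bar}(S^1(w);A)$. For $T\in T(A^S)$ let $L_T(w)\in A[t]$ correspond to $\tilde w^*T$, and let $\ell_T(w)\in A$ be the coefficient of $t$ in $L_T(w)$. **Proposition.** Evaluation on the classes $[D^2(r)]$ is an isomorphism $H^2(X_{S|R},X_S;A)\cong A^R$, and $\omega\colon H^2(X_{S|R},X_S;A)\to H^1_{Bar}(X_{S|R},X_S;A)$ is injective. Let $T\in T(A^S)$ be such that its relative Massey product $\mu(T)\in H^1_{Bar}(X_{S|R},X_S;A)$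 has weight $1$, so that $\mu(T)$ is (via $\omega$) a class in $H^2(X_{S|R},X_S;A)$. Then for every relation $r\in R$ and every word $w$ representing $r$ in $F_S$, $$\ell_T(w)=\langle\mu(T),[D^2(r)]\rangle .$$ In particular $\ell_T(w)$ depends only on $r$, and this common value is $\ell_T(r)$. -/

import Mathlib

open CategoryTheory Simplicial Opposite

namespace LetterBraiding

universe u v

noncomputable section

section Coh

variable {A : Type v} [CommRing A] {M N : Type*} [AddCommGroup M] [Module A M]
  [AddCommGroup N] [Module A N]

/-- Cohomology in one degree: cocycles in `P`, modulo the coboundaries `d Q`.  Here `P` is the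
piece of the degree considered and `Q` the piece one degree below. -/
abbrev Coh (d : M →ₗ[A] M) (P Q : Submodule A M) : Type _ :=
  ↥(P ⊓ LinearMap.ker d) ⧸ (Q.map d).submoduleOf (P ⊓ LinearMap.ker d)

/-- The class of a cocycle. -/
abbrev Coh.mk {d : M →ₗ[A] M} {P Q : Submodule A M} :
    ↥(P ⊓ LinearMap.ker d) →ₗ[A] Coh d P Q :=
  Submodule.mkQ _

/-- The map on cohomology induced by a cochain map. -/
def Coh.map {d : M →ₗ[A] M} {P Q : Submodule A M} {d' : N →ₗ[A] N} {P' Q' : Submodule A N}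
    (f : M →ₗ[A] N) (hd : ∀ x, f (d x) = d' (f x)) (hP : P ≤ P'.comap f)
    (hQ : Q ≤ Q'.comap f) : Coh d P Q →ₗ[A] Coh d' P' Q' :=
  Submodule.mapQ _ _
    (f.restrict (p := P ⊓ LinearMap.ker d) (q := P' ⊓ LinearMap.ker d')
      (fun x hx => ⟨hP hx.1, by
        have h : d x = 0 := hx.2
        change d' (f x) = 0
        rw [← hd, h, map_zero]⟩))
    (by
      rintro ⟨x, hx⟩ hx'
      obtain ⟨y, hy, rfl⟩ := hx'
      exact ⟨f y, hQ hy, (hd y).symm⟩)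

end Coh

/-! ### The bar construction -/

section Bar

variable {A : Type v} [CommRing A] {M N : Type*} [AddCommGroup M] [Module A M]
  [AddCommGroup N] [Module A N]

open TensorAlgebra

/-- One step of the recursion that defines the bar differential. The three components of the
state are a tensor `x`, its differential, and the map `a ↦ merge a x` that multiplies `a` into the
first tensor factor of `x`; the step prepends a letter `c` to `x`. -/
def barStep (d s : M →ₗ[A] M) (m : M →ₗ[A] M →ₗ[A] M) :
    M →ₗ[A] Module.End A (TensorAlgebra A M × TensorAlgebra A M × (M →ₗ[A] TensorAlgebra A M)) :=
  LinearMap.mk₂ A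
    (fun c x => (ι A c * x.1,
      -(ι A (d c) * x.1) + ι A (s c) * x.2.1 - x.2.2 (s c),
      LinearMap.mulRight A x.1 ∘ₗ ι A ∘ₗ m.flip c))
    (by intro c c' x
        refine Prod.ext (by simp [add_mul]) (Prod.ext ?_ (LinearMap.ext fun a => by simp [add_mul]))
        simp only [map_add, add_mul, Prod.snd_add, Prod.fst_add]; abel)
    (by intro r c x
        refine Prod.ext (by simp) (Prod.ext ?_ (LinearMap.ext fun a => by simp))
        simp [smul_sub])
    (by intro c x x'
        refine Prod.ext (by simp [mul_add])
          (Prod.ext ?_ (LinearMap.ext fun a => by simp [mul_add]))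
        simp only [Prod.snd_add, Prod.fst_add, mul_add, LinearMap.add_apply]; abel)
    (by intro r c x
        refine Prod.ext (by simp) (Prod.ext ?_ (LinearMap.ext fun a => by simp))
        simp [smul_sub])

/-- The state of a tensor. -/
def barState (d s : M →ₗ[A] M) (m : M →ₗ[A] M →ₗ[A] M) :
    TensorAlgebra A M →ₗ[A]
      TensorAlgebra A M × TensorAlgebra A M × (M →ₗ[A] TensorAlgebra A M) :=
  LinearMap.applyₗ ((1 : TensorAlgebra A M), (0 : TensorAlgebra A M),
    (0 : M →ₗ[A] TensorAlgebra A M)) ∘ₗ (lift A (barStep d s m)).toLinearMap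

/-- The bar differential on the tensor module `T(M)`. -/
def barD (d s : M →ₗ[A] M) (m : M →ₗ[A] M →ₗ[A] M) : TensorAlgebra A M →ₗ[A] TensorAlgebra A M :=
  LinearMap.fst A _ _ ∘ₗ LinearMap.snd A _ _ ∘ₗ barState d s m

/-- `barMerge` sends `c₁|c₂|…|cₚ` to the map `a ↦ (a c₁)|c₂|…|cₚ`, and `1` to `0`. -/
def barMerge (d s : M →ₗ[A] M) (m : M →ₗ[A] M →ₗ[A] M) :
    TensorAlgebra A M →ₗ[A] M →ₗ[A] TensorAlgebra A M :=
  LinearMap.snd A _ _ ∘ₗ LinearMap.snd A _ _ ∘ₗ barState d s m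

/-- Induction on tensors by prepending letters. -/
theorem cons_induction {P : Submodule A (TensorAlgebra A M)} (h1 : 1 ∈ P)
    (hc : ∀ c, ∀ x ∈ P, ι A c * x ∈ P) (x : TensorAlgebra A M) : x ∈ P := by
  suffices h : ∀ y ∈ P, x * y ∈ P by simpa using h 1 h1
  induction x using TensorAlgebra.induction with
  | algebraMap r =>
    intro y hy
    rw [← Algebra.smul_def]; exact P.smul_mem r hy
  | ι c => exact hc c
  | mul a b ha hb => intro y hy; rw [mul_assoc]; exact ha _ (hb _ hy)
  | add a b ha hb => intro y hy; rw [add_mul]; exact P.add_mem (ha y hy) (hb y hy)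

variable (d s : M →ₗ[A] M) (m : M →ₗ[A] M →ₗ[A] M)

theorem barState_cons (c : M) (x : TensorAlgebra A M) :
    barState d s m (ι A c * x) = barStep d s m c (barState d s m x) := by
  simp [barState]

theorem barState_one : barState d s m 1 = (1, 0, 0) := by simp [barState]

theorem barState_fst (x : TensorAlgebra A M) : (barState d s m x).1 = x := by
  have := cons_induction (P := LinearMap.eqLocus
    (LinearMap.fst A _ _ ∘ₗ barState d s m) LinearMap.id) (by simp [barState_one])
    (fun c x hx => by
      simp only [LinearMap.mem_eqLocus, LinearMap.comp_apply, LinearMap.fst_apply,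
        LinearMap.id_apply] at hx ⊢
      rw [barState_cons]
      simp [barStep, hx]) x
  simpa using this

@[simp]
theorem barD_one : barD d s m 1 = 0 := by simp [barD, barState_one]

@[simp]
theorem barMerge_one : barMerge d s m 1 = 0 := by simp [barMerge, barState_one]

/-- `d(c|x) = -dc|x + sc|dx - merge (sc) x`. -/
theorem barD_cons (c : M) (x : TensorAlgebra A M) :
    barD d s m (ι A c * x) =
      -(ι A (d c) * x) + ι A (s c) * barD d s m x - barMerge d s m x (s c) := by
  simp [barD, barMerge, barState_cons, barStep, barState_fst]

theorem barMerge_cons (a c : M) (x : TensorAlgebra A M) :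
    barMerge d s m (ι A c * x) a = ι A (m a c) * x := by
  simp [barMerge, barState_cons, barStep, barState_fst]

theorem barD_ι (c : M) : barD d s m (ι A c) = -ι A (d c) := by
  have := barD_cons d s m c 1
  simpa using this

/-- `merge` is associative when the product is. -/
theorem barMerge_merge (hassoc : ∀ a b c, m (m a b) c = m a (m b c)) (x : TensorAlgebra A M) :
    ∀ a b, barMerge d s m (barMerge d s m x b) a = barMerge d s m x (m a b) := by
  intro a b
  have := cons_induction (P := LinearMap.eqLocus
    ((barMerge d s m).flip a ∘ₗ (barMerge d s m).flip b)
    ((barMerge d s m).flip (m a b))) (by simp)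
    (fun c x _ => by simp [barMerge_cons, hassoc]) x
  simpa using this

/-- The operations satisfy the identities of the augmentation ideal of a differential graded
algebra, where `s` is the sign `a ↦ (-1) ^ (|a| + 1) a`. -/
structure IsDGA (d s : M →ₗ[A] M) (m : M →ₗ[A] M →ₗ[A] M) : Prop where
  dd : ∀ a, d (d a) = 0
  ds : ∀ a, d (s a) = -s (d a)
  ss : ∀ a, s (s a) = a
  sm : ∀ a b, s (m a b) = -m (s a) (s b)
  assoc : ∀ a b c, m (m a b) c = m a (m b c)
  leib : ∀ a b, d (m a b) = m (d a) b - m (s a) (d b)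

variable {d s m}

theorem barD_merge (h : IsDGA d s m) (x : TensorAlgebra A M) : ∀ a,
    barD d s m (barMerge d s m x a) =
      -barMerge d s m x (d a) - barMerge d s m (barD d s m x) (s a) := by
  intro a
  have := cons_induction (P := LinearMap.eqLocus
    (barD d s m ∘ₗ (barMerge d s m).flip a)
    (-((barMerge d s m).flip (d a)) - (barMerge d s m).flip (s a) ∘ₗ barD d s m)) (by simp)
    (fun c x _ => by
      simp only [LinearMap.mem_eqLocus, LinearMap.comp_apply, LinearMap.flip_apply,
        LinearMap.sub_apply, LinearMap.neg_apply, barMerge_cons, barD_cons, map_add, map_sub,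
        map_neg, LinearMap.add_apply, barMerge_merge d s m h.assoc, h.leib,
        h.sm, sub_mul, neg_mul]
      abel) x
  simpa using this

theorem barD_barD (h : IsDGA d s m) (x : TensorAlgebra A M) : barD d s m (barD d s m x) = 0 := by
  have := cons_induction (P := LinearMap.ker (barD d s m ∘ₗ barD d s m)) (by simp)
    (fun c x hx => by
      simp only [LinearMap.mem_ker, LinearMap.comp_apply] at hx ⊢
      simp only [barD_cons, map_add, map_sub, map_neg, hx, h.dd, h.ds, h.ss,
        barD_merge h, map_zero, zero_mul, neg_mul, mul_zero]
      abel) x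
  simpa using this

/-- The map of tensor modules induced by a map of letters. -/
def tmap (f : M →ₗ[A] N) : TensorAlgebra A M →ₐ[A] TensorAlgebra A N :=
  lift A (ι A ∘ₗ f)

@[simp]
theorem tmap_ι (f : M →ₗ[A] N) (c : M) : tmap f (ι A c) = ι A (f c) := by simp [tmap]

/-- A map of letters compatible with all the structure induces a cochain map. -/
theorem barD_tmap {d' s' : N →ₗ[A] N} {m' : N →ₗ[A] N →ₗ[A] N} (f : M →ₗ[A] N)
    (hd : ∀ a, f (d a) = d' (f a)) (hs : ∀ a, f (s a) = s' (f a))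
    (hm : ∀ a b, f (m a b) = m' (f a) (f b)) (x : TensorAlgebra A M) :
    tmap f (barD d s m x) = barD d' s' m' (tmap f x) := by
  have hmer : ∀ x a, tmap f (barMerge d s m x a) = barMerge d' s' m' (tmap f x) (f a) := by
    intro x a
    have := cons_induction (P := LinearMap.eqLocus
      ((tmap f).toLinearMap ∘ₗ (barMerge d s m).flip a)
      ((barMerge d' s' m').flip (f a) ∘ₗ (tmap f).toLinearMap)) (by simp)
      (fun c x _ => by simp [barMerge_cons, hm]) x
    simpa using this
  have := cons_induction (P := LinearMap.eqLocus
    ((tmap f).toLinearMap ∘ₗ barD d s m) (barD d' s' m' ∘ₗ (tmap f).toLinearMap)) (by simp)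
    (fun c x hx => by
      simp only [LinearMap.mem_eqLocus, LinearMap.comp_apply, AlgHom.toLinearMap_apply] at hx ⊢
      simp only [barD_cons, map_add, map_sub, map_neg, map_mul, tmap_ι, hx, hmer, hd, hs]) x
  simpa using this

/-- Total degree `k` in the bar construction: the span of the tensors `c₁|…|cₚ` of homogeneous
letters with `∑ (|cᵢ| - 1) = k`. -/
def tensorDeg (deg : ℕ → Submodule A M) (k : ℤ) : Submodule A (TensorAlgebra A M) :=
  Submodule.span A {x | ∃ l : List (ℕ × M), (∀ c ∈ l, c.2 ∈ deg c.1) ∧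
    (l.map fun c => (c.1 : ℤ) - 1).sum = k ∧ x = (l.map fun c => ι A c.2).prod}

theorem cons_mem_tensorDeg {deg : ℕ → Submodule A M} {k : ℤ} {n : ℕ} {c : M} (hc : c ∈ deg n)
    {x : TensorAlgebra A M} (hx : x ∈ tensorDeg deg k) :
    ι A c * x ∈ tensorDeg deg (n - 1 + k) := by
  induction hx using Submodule.span_induction with
  | mem x hx =>
    obtain ⟨l, h1, h2, rfl⟩ := hx
    refine Submodule.subset_span ⟨(n, c) :: l, ?_, ?_, ?_⟩
    · intro c' hc'
      rcases List.mem_cons.1 hc' with rfl | h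
      · exact hc
      · exact h1 _ h
    · simp [h2]
    · simp
  | zero => simp
  | add x y _ _ hx hy => rw [mul_add]; exact Submodule.add_mem _ hx hy
  | smul r x _ hx => rw [mul_smul_comm]; exact Submodule.smul_mem _ _ hx

theorem tmap_mem_tensorDeg {deg : ℕ → Submodule A M} {deg' : ℕ → Submodule A N} (f : M →ₗ[A] N)
    (hf : ∀ n, ∀ c ∈ deg n, f c ∈ deg' n) {k : ℤ} {x : TensorAlgebra A M}
    (hx : x ∈ tensorDeg deg k) : tmap f x ∈ tensorDeg deg' k := by
  induction hx using Submodule.span_induction with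
  | mem x hx =>
    obtain ⟨l, h1, h2, rfl⟩ := hx
    refine Submodule.subset_span ⟨l.map fun c => (c.1, f c.2), ?_, ?_, ?_⟩
    · intro c hc
      obtain ⟨c', hc', rfl⟩ := List.mem_map.1 hc
      exact hf _ _ (h1 _ hc')
    · rw [← h2]; simp [Function.comp_def]
    · rw [map_list_prod]; simp [Function.comp_def]
  | zero => simp
  | add x y _ _ hx hy => rw [map_add]; exact Submodule.add_mem _ hx hy
  | smul r x _ hx => rw [map_smul]; exact Submodule.smul_mem _ _ hx

/-- The bar differential raises the degree by one. -/
theorem barD_mem_tensorDeg {deg : ℕ → Submodule A M} (hd : ∀ n, ∀ c ∈ deg n, d c ∈ deg (n + 1))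
    (hs : ∀ n, ∀ c ∈ deg n, s c ∈ deg n)
    (hm : ∀ p q, ∀ a ∈ deg p, ∀ b ∈ deg q, m a b ∈ deg (p + q)) {k : ℤ} {x : TensorAlgebra A M}
    (hx : x ∈ tensorDeg deg k) : barD d s m x ∈ tensorDeg deg (k + 1) := by
  induction hx using Submodule.span_induction with
  | zero => simp
  | add x y _ _ hx hy => rw [map_add]; exact Submodule.add_mem _ hx hy
  | smul r x _ hx => rw [map_smul]; exact Submodule.smul_mem _ _ hx
  | mem x hx =>
    obtain ⟨l, h1, h2, rfl⟩ := hx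
    induction l generalizing k with
    | nil => simp
    | cons c l ih =>
      have hl : (l.map fun c => ι A c.2).prod ∈
          tensorDeg deg (l.map fun c => (c.1 : ℤ) - 1).sum :=
        Submodule.subset_span ⟨l, fun c' h => h1 _ (List.mem_cons_of_mem _ h), rfl, rfl⟩
      have hc : c.2 ∈ deg c.1 := h1 _ List.mem_cons_self
      have ih' := ih (fun c' h => h1 _ (List.mem_cons_of_mem _ h)) rfl
      simp only [List.map_cons, List.sum_cons] at h2
      simp only [List.map_cons, List.prod_cons]
      rw [barD_cons]
      refine Submodule.sub_mem _ (Submodule.add_mem _ (Submodule.neg_mem _ ?_) ?_) ?_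
      · have := cons_mem_tensorDeg (hd _ _ hc) hl
        convert this using 2
        push_cast; rw [← h2]; ring
      · have := cons_mem_tensorDeg (hs _ _ hc) ih'
        convert this using 2
        rw [← h2]; ring
      · cases l with
        | nil => simp
        | cons c' l =>
          simp only [List.map_cons, List.prod_cons]
          rw [barMerge_cons]
          have hl' : (l.map fun c => ι A c.2).prod ∈
              tensorDeg deg (l.map fun c => (c.1 : ℤ) - 1).sum :=
            Submodule.subset_span ⟨l, fun c' h => h1 _
              (List.mem_cons_of_mem _ (List.mem_cons_of_mem _ h)), rfl, rfl⟩
          have := cons_mem_tensorDeg (hm _ _ _ (hs _ _ hc) _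
            (h1 c' (List.mem_cons_of_mem _ List.mem_cons_self))) hl'
          convert this using 2
          simp only [List.map_cons, List.sum_cons] at h2
          push_cast; rw [← h2]; ring

end Bar

/-! ### Cochains of simplicial sets -/

section Cochains

variable (X : SSet.{u}) (A : Type v) [CommRing A]

/-- The face operator `i ↦ i + a` from `[l]` to `[n]`; only used for `a + l ≤ n`, so that the
truncation by `n` plays no role. -/
def seg (a l n : ℕ) : ⦋l⦌ ⟶ ⦋n⦌ :=
  SimplexCategory.mkHom
    { toFun := fun i : Fin (l + 1) => (⟨min (i.1 + a) n, by omega⟩ : Fin (n + 1))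
      monotone' := fun i j h => by
        have : i.1 ≤ j.1 := h
        simp only [Fin.mk_le_mk]; omega }

/-- All sequences of functions on simplices. -/
abbrev Raw : Type _ := ∀ n : ℕ, X _⦋n⦌ → A

variable {X A}

/-- The coboundary `(df)(x) = ∑ (-1)^i f(dᵢ x)`. -/
def rawD (f : Raw X A) : Raw X A := fun n =>
  match n with
  | 0 => fun _ => 0
  | n + 1 => fun x => ∑ i : Fin (n + 2), (-1) ^ (i : ℕ) * f n (X.δ i x)

/-- The cup product: `(f ⌣ g)(x)` is the sum over `p + q = n` of the product of the values of `f` on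
the front `p`-face and of `g` on the back `q`-face of `x`. -/
def rawCup (f g : Raw X A) : Raw X A := fun n x =>
  ∑ pq ∈ Finset.HasAntidiagonal.antidiagonal n,
    f pq.1 (X.map (seg 0 pq.1 n).op x) * g pq.2 (X.map (seg pq.1 pq.2 n).op x)

/-- The face operator that omits the vertex `i`, total in its index. -/
def dl (i n : ℕ) : ⦋n⦌ ⟶ ⦋n + 1⦌ :=
  SimplexCategory.mkHom
    { toFun := fun k : Fin (n + 1) =>
        (⟨if k.1 < i then k.1 else k.1 + 1, by split <;> omega⟩ : Fin (n + 2))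
      monotone' := fun k j h => by
        have : k.1 ≤ j.1 := h
        simp only [Fin.mk_le_mk]; split <;> split <;> omega }

theorem hom_ext' {l n : ℕ} {f g : ⦋l⦌ ⟶ ⦋n⦌} (h : ∀ k, (f.toOrderHom k).1 = (g.toOrderHom k).1) :
    f = g := by
  apply SimplexCategory.Hom.ext
  ext k
  exact h k

theorem δ_eq (n : ℕ) (i : Fin (n + 2)) : SimplexCategory.δ i = dl i n := by
  apply hom_ext'
  intro k
  simp only [SimplexCategory.δ, dl]
  change (Fin.succAbove i k).1 = if k.1 < i.1 then k.1 else k.1 + 1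
  simp only [Fin.succAbove, Fin.lt_def]
  split <;> simp_all

theorem map_map {l m n : ℕ} (f : ⦋l⦌ ⟶ ⦋m⦌) (g : ⦋m⦌ ⟶ ⦋n⦌) (x : X _⦋n⦌) :
    X.map f.op (X.map g.op x) = X.map (f ≫ g).op x := by
  simp

theorem rawD_succ (f : Raw X A) (n : ℕ) (x : X _⦋n + 1⦌) :
    rawD f (n + 1) x = ∑ i ∈ Finset.range (n + 2), (-1) ^ i * f n (X.map (dl i n).op x) := by
  rw [← Fin.sum_univ_eq_sum_range (fun i => (-1) ^ i * f n (X.map (dl i n).op x))]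
  simp only [rawD]
  refine Finset.sum_congr rfl fun i _ => ?_
  rw [← δ_eq]; rfl

theorem rawD_rawD (f : Raw X A) : rawD (rawD f) = 0 := by
  funext n x
  match n with
  | 0 => rfl
  | 1 => simp [rawD]
  | n + 2 =>
    rw [rawD_succ]
    simp only [rawD_succ, Finset.mul_sum, map_map]
    simp only [Pi.zero_apply]
    rw [← Finset.sum_product']
    refine Finset.sum_involution
      (fun p _ => if p.2 < p.1 then (p.2, p.1 - 1) else (p.2 + 1, p.1)) ?_ ?_ ?_ ?_
    · rintro ⟨i, j⟩ h
      simp only [Finset.mem_product, Finset.mem_range] at h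
      dsimp only
      split_ifs with hij
      · have : dl j n ≫ dl i (n + 1) = dl (i - 1) n ≫ dl j (n + 1) := by
          apply hom_ext'; intro k
          change (if (if k.1 < j then k.1 else k.1 + 1) < i then (if k.1 < j then k.1 else k.1 + 1) else (if k.1 < j then k.1 else k.1 + 1) + 1) =
            (if (if k.1 < i - 1 then k.1 else k.1 + 1) < j then
              (if k.1 < i - 1 then k.1 else k.1 + 1) else
              (if k.1 < i - 1 then k.1 else k.1 + 1) + 1)
          split_ifs <;> omega
        rw [this]
        obtain ⟨i, rfl⟩ : ∃ i', i = i' + 1 := ⟨i - 1, by omega⟩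
        simp only [Nat.add_sub_cancel]
        ring
      · have : dl j n ≫ dl i (n + 1) = dl i n ≫ dl (j + 1) (n + 1) := by
          apply hom_ext'; intro k
          change (if (if k.1 < j then k.1 else k.1 + 1) < i then (if k.1 < j then k.1 else k.1 + 1) else (if k.1 < j then k.1 else k.1 + 1) + 1) =
            (if (if k.1 < i then k.1 else k.1 + 1) < j + 1 then
              (if k.1 < i then k.1 else k.1 + 1) else
              (if k.1 < i then k.1 else k.1 + 1) + 1)
          split_ifs <;> omega
        rw [this]
        ring
    · rintro ⟨i, j⟩ h _ heq
      dsimp only at heq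
      split_ifs at heq with hij <;> simp only [Prod.mk.injEq] at heq <;> omega
    · rintro ⟨i, j⟩ h
      simp only [Finset.mem_product, Finset.mem_range] at h ⊢
      split_ifs with hij <;> dsimp only <;> omega
    · rintro ⟨i, j⟩ h
      by_cases h1 : j < i
      · have h2 : ¬ i - 1 < j := by omega
        simp only [h1, h2, if_true, if_false]
        rw [Nat.sub_add_cancel (by omega)]
      · have h2 : i < j + 1 := by omega
        simp only [h1, h2, if_true, if_false, Nat.add_sub_cancel]

theorem rawCup_assoc (f g h : Raw X A) :
    rawCup (rawCup f g) h = rawCup f (rawCup g h) := by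
  funext n x
  simp only [rawCup, Finset.sum_mul, Finset.mul_sum, map_map]
  rw [Finset.sum_sigma', Finset.sum_sigma']
  refine Finset.sum_bij' (fun a _ => ⟨(a.2.1, a.2.2 + a.1.2), (a.2.2, a.1.2)⟩)
    (fun a _ => ⟨(a.1.1 + a.2.1, a.2.2), (a.1.1, a.2.1)⟩) ?_ ?_ ?_ ?_ ?_
  · rintro ⟨⟨a, b⟩, c, d⟩ h
    simp only [Finset.mem_sigma, Finset.HasAntidiagonal.mem_antidiagonal] at h ⊢
    exact ⟨by omega, trivial⟩
  · rintro ⟨⟨a, b⟩, c, d⟩ h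
    simp only [Finset.mem_sigma, Finset.HasAntidiagonal.mem_antidiagonal] at h ⊢
    exact ⟨by omega, trivial⟩
  · rintro ⟨⟨a, b⟩, c, d⟩ h
    simp only [Finset.mem_sigma, Finset.HasAntidiagonal.mem_antidiagonal] at h
    obtain ⟨h1, rfl⟩ := h
    rfl
  · rintro ⟨⟨a, b⟩, c, d⟩ h
    simp only [Finset.mem_sigma, Finset.HasAntidiagonal.mem_antidiagonal] at h
    obtain ⟨h1, rfl⟩ := h
    rfl
  · rintro ⟨⟨a, b⟩, c, d⟩ h
    simp only [Finset.mem_sigma, Finset.HasAntidiagonal.mem_antidiagonal] at h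
    obtain ⟨h1, h2⟩ := h
    dsimp only
    rw [mul_assoc]
    have e1 : seg 0 c a ≫ seg 0 a n = seg 0 c n := by
      apply hom_ext'; intro k
      have := k.2
      change min (min (k.1 + 0) a + 0) n = min (k.1 + 0) n
      simp only [SimplexCategory.len_mk] at this
      omega
    have e2 : seg c d a ≫ seg 0 a n = seg 0 d (d + b) ≫ seg c (d + b) n := by
      apply hom_ext'; intro k
      have := k.2
      change min (min (k.1 + c) a + 0) n = min (min (k.1 + 0) (d + b) + c) n
      simp only [SimplexCategory.len_mk] at this
      omega
    have e3 : seg a b n = seg d b (d + b) ≫ seg c (d + b) n := by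
      apply hom_ext'; intro k
      have := k.2
      change min (k.1 + a) n = min (min (k.1 + d) (d + b) + c) n
      simp only [SimplexCategory.len_mk] at this
      omega
    rw [e1, e2, e3]

/-- The sign `(-1) ^ (n + 1)` in degree `n`. -/
def rawSign (f : Raw X A) : Raw X A := fun n x => (-1) ^ (n + 1) * f n x

theorem rawD_rawCup (f g : Raw X A) :
    rawD (rawCup f g) = rawCup (rawD f) g - rawCup (rawSign f) (rawD g) := by
  funext n x
  match n with
  | 0 => simp [rawD, rawCup]
  | n + 1 =>
    rw [rawD_succ]
    simp only [Pi.sub_apply, rawCup]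
    rw [Finset.Nat.sum_antidiagonal_succ, Finset.Nat.sum_antidiagonal_succ']
    have z1 : ∀ y : X _⦋0⦌, rawD f 0 y = 0 := fun y => rfl
    have z2 : ∀ y : X _⦋0⦌, rawD g 0 y = 0 := fun y => rfl
    simp only [z1, z2, zero_mul, mul_zero, zero_add, add_zero, Finset.mul_sum]
    rw [Finset.sum_comm, ← Finset.sum_sub_distrib]
    refine Finset.sum_congr rfl ?_
    rintro ⟨p, q⟩ h
    simp only [Finset.HasAntidiagonal.mem_antidiagonal] at h
    subst h
    dsimp only
    rw [rawD_succ, rawD_succ]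
    rw [show p + q + 2 = (p + 1) + (q + 1) by ring, Finset.sum_range_add]
    rw [Finset.sum_range_succ (n := p + 1), Finset.sum_range_succ' (n := q + 1)]
    simp only [map_map, rawSign]
    have e1 : dl (p + 1) p ≫ seg 0 (p + 1) (p + q + 1) = seg 0 p (p + q + 1) := by
      apply hom_ext'; intro k
      have := k.2
      change min ((if k.1 < p + 1 then k.1 else k.1 + 1) + 0) (p + q + 1) = min (k.1 + 0) _
      simp only [SimplexCategory.len_mk] at this
      split_ifs <;> omega
    have e2 : dl 0 q ≫ seg p (q + 1) (p + q + 1) = seg (p + 1) q (p + q + 1) := by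
      apply hom_ext'; intro k
      have := k.2
      change min ((if k.1 < 0 then k.1 else k.1 + 1) + p) (p + q + 1) = min (k.1 + (p + 1)) _
      simp only [SimplexCategory.len_mk] at this
      split_ifs <;> omega
    have s1 : ∀ i ∈ Finset.range (p + 1),
        seg 0 p (p + q) ≫ dl i (p + q) = dl i p ≫ seg 0 (p + 1) (p + q + 1) ∧
        seg p q (p + q) ≫ dl i (p + q) = seg (p + 1) q (p + q + 1) := by
      intro i hi
      rw [Finset.mem_range] at hi
      constructor
      · apply hom_ext'; intro k
        have := k.2
        change (if min (k.1 + 0) (p + q) < i then min (k.1 + 0) (p + q)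
          else min (k.1 + 0) (p + q) + 1) =
          min ((if k.1 < i then k.1 else k.1 + 1) + 0) (p + q + 1)
        simp only [SimplexCategory.len_mk] at this
        split_ifs <;> omega
      · apply hom_ext'; intro k
        have := k.2
        change (if min (k.1 + p) (p + q) < i then min (k.1 + p) (p + q)
          else min (k.1 + p) (p + q) + 1) = min (k.1 + (p + 1)) (p + q + 1)
        simp only [SimplexCategory.len_mk] at this
        split_ifs <;> omega
    have s2 : ∀ j ∈ Finset.range (q + 1),
        seg 0 p (p + q) ≫ dl (p + 1 + j) (p + q) = seg 0 p (p + q + 1) ∧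
        seg p q (p + q) ≫ dl (p + 1 + j) (p + q) =
          dl (j + 1) q ≫ seg p (q + 1) (p + q + 1) := by
      intro i hi
      rw [Finset.mem_range] at hi
      constructor
      · apply hom_ext'; intro k
        have := k.2
        change (if min (k.1 + 0) (p + q) < p + 1 + i then min (k.1 + 0) (p + q)
          else min (k.1 + 0) (p + q) + 1) = min (k.1 + 0) (p + q + 1)
        simp only [SimplexCategory.len_mk] at this
        split_ifs <;> omega
      · apply hom_ext'; intro k
        have := k.2
        change (if min (k.1 + p) (p + q) < p + 1 + i then min (k.1 + p) (p + q)
          else min (k.1 + p) (p + q) + 1) =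
          min ((if k.1 < i + 1 then k.1 else k.1 + 1) + p) (p + q + 1)
        simp only [SimplexCategory.len_mk] at this
        split_ifs <;> omega
    rw [Finset.sum_congr rfl (fun i hi => by rw [(s1 i hi).1, (s1 i hi).2]),
      Finset.sum_congr (s₁ := Finset.range (q + 1)) rfl
        (fun i hi => by rw [(s2 i hi).1, (s2 i hi).2])]
    rw [e1, e2, add_mul, mul_add, Finset.sum_mul, Finset.mul_sum]
    rw [Finset.sum_congr (s₁ := Finset.range (p + 1)) rfl (fun i _ => (mul_assoc _ _ _).symm)]
    have key : ∀ a b : ℕ → A, ∑ i ∈ Finset.range (q + 1), (-1) ^ (p + 1 + i) * (a p * b i) =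
        -∑ i ∈ Finset.range (q + 1), (-1) ^ (p + 1) * a p * ((-1) ^ (i + 1) * b i) := by
      intro a b
      rw [← Finset.sum_neg_distrib]
      exact Finset.sum_congr rfl fun i _ => by ring
    rw [key (fun _ => f p (X.map (seg 0 p (p + q + 1)).op x))
      (fun i => g q (X.map (dl (i + 1) q ≫ seg p (q + 1) (p + q + 1)).op x))]
    ring

end Cochains

/-! ### Pointed simplicial sets and their reduced normalized cochains -/

/-- A pointed simplicial set. -/
structure PSSet where
  /-- the simplicial set -/
  X : SSet.{u}
  /-- the basepoint -/
  pt : X _⦋0⦌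

/-- A pointed simplicial map. -/
structure PHom (X Y : PSSet.{u}) where
  /-- the simplicial map -/
  f : X.X ⟶ Y.X
  pt : f.app _ X.pt = Y.pt

section Reduced

variable (X : PSSet.{u}) (A : Type v) [CommRing A]

/-- The augmentation ideal of the normalized cochain algebra of a pointed simplicial set: families
of functions on simplices that vanish on degenerate simplices, at the basepoint, and in all but
finitely many degrees. -/
def Cbar : Submodule A (Raw X.X A) where
  carrier := {f | (∀ n, ∀ x ∈ X.X.degenerate n, f n x = 0) ∧ f 0 X.pt = 0 ∧
    ∃ N, ∀ n, N ≤ n → f n = 0}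
  zero_mem' := ⟨fun _ _ _ => rfl, rfl, 0, fun _ _ => rfl⟩
  add_mem' := by
    rintro f g ⟨h1, h2, N, h3⟩ ⟨k1, k2, K, k3⟩
    refine ⟨fun n x hx => ?_, ?_, max N K, fun n hn => ?_⟩
    · simp [h1 n x hx, k1 n x hx]
    · simp [h2, k2]
    · simp [h3 n (le_trans (le_max_left _ _) hn), k3 n (le_trans (le_max_right _ _) hn)]
  smul_mem' := by
    rintro r f ⟨h1, h2, N, h3⟩
    refine ⟨fun n x hx => ?_, ?_, N, fun n hn => ?_⟩
    · simp [h1 n x hx]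
    · simp [h2]
    · simp [h3 n hn]

/-- Reduced cochains of degree `n`. -/
def Cdeg (n : ℕ) : Submodule A (Cbar X A) where
  carrier := {f | ∀ k, k ≠ n → f.1 k = 0}
  zero_mem' := fun _ _ => rfl
  add_mem' := by
    intro f g hf hg k hk
    simp [hf k hk, hg k hk]
  smul_mem' := by
    intro r f hf k hk
    simp [hf k hk]

variable {X A}

/-- Degeneracy operator, total in its index. -/
def sg (j n : ℕ) : ⦋n + 1⦌ ⟶ ⦋n⦌ :=
  SimplexCategory.mkHom
    { toFun := fun k : Fin (n + 2) =>
        (⟨min (if k.1 ≤ j then k.1 else k.1 - 1) n, by omega⟩ : Fin (n + 1))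
      monotone' := fun k l h => by
        have : k.1 ≤ l.1 := h
        simp only [Fin.mk_le_mk]; split <;> split <;> omega }

theorem sg_degenerate {X : SSet.{u}} (j n : ℕ) (y : X _⦋n⦌) :
    X.map (sg j n).op y ∈ X.degenerate (n + 1) :=
  ⟨n, Nat.lt_succ_self n, sg j n, Set.mem_range_self y⟩

theorem degenerate_exists {X : SSet.{u}} {n : ℕ} {x : X _⦋n + 1⦌} (hx : x ∈ X.degenerate (n + 1)) :
    ∃ j ≤ n, ∃ y, x = X.map (sg j n).op y := by
  rw [SSet.degenerate_eq_iUnion_range_σ] at hx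
  obtain ⟨j, y, rfl⟩ := Set.mem_iUnion.1 hx
  refine ⟨j.1, by omega, y, ?_⟩
  have : SimplexCategory.σ j = sg j.1 n := by
    apply hom_ext'
    intro k
    have hk := k.2
    have hj := j.2
    change (Fin.predAbove j k).1 = min (if k.1 ≤ j.1 then k.1 else k.1 - 1) n
    simp only [SimplexCategory.len_mk] at hk
    simp only [Fin.predAbove, Fin.lt_def, Fin.val_castSucc]
    split_ifs <;> simp <;> omega
  rw [← this]; rfl

theorem rawD_mem {f : Raw X.X A} (hf : f ∈ Cbar X A) : rawD f ∈ Cbar X A := by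
  obtain ⟨h1, h2, N, h3⟩ := hf
  refine ⟨?_, rfl, N + 1, ?_⟩
  · rintro (_ | n) x hx
    · rfl
    · obtain ⟨j, hj, y, rfl⟩ := degenerate_exists hx
      rw [rawD_succ, Finset.sum_eq_add j (j + 1) (by omega)]
      · have e1 : dl j n ≫ sg j n = 𝟙 _ := by
          apply hom_ext'; intro k
          have := k.2
          change min (if (if k.1 < j then k.1 else k.1 + 1) ≤ j then
            (if k.1 < j then k.1 else k.1 + 1) else (if k.1 < j then k.1 else k.1 + 1) - 1) n = k.1
          simp only [SimplexCategory.len_mk] at this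
          split_ifs <;> omega
        have e2 : dl (j + 1) n ≫ sg j n = 𝟙 _ := by
          apply hom_ext'; intro k
          have := k.2
          change min (if (if k.1 < j + 1 then k.1 else k.1 + 1) ≤ j then
            (if k.1 < j + 1 then k.1 else k.1 + 1) else
            (if k.1 < j + 1 then k.1 else k.1 + 1) - 1) n = k.1
          simp only [SimplexCategory.len_mk] at this
          split_ifs <;> omega
        rw [map_map, map_map, e1, e2]
        ring
      · rintro i hi ⟨hij, hij'⟩
        rw [Finset.mem_range] at hi
        obtain ⟨n, rfl⟩ : ∃ n', n = n' + 1 := ⟨n - 1, by omega⟩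
        rw [map_map]
        by_cases hlt : i < j
        · have e : dl i (n + 1) ≫ sg j (n + 1) = sg (j - 1) n ≫ dl i n := by
            apply hom_ext'; intro k
            have := k.2
            change min (if (if k.1 < i then k.1 else k.1 + 1) ≤ j then
              (if k.1 < i then k.1 else k.1 + 1) else
              (if k.1 < i then k.1 else k.1 + 1) - 1) (n + 1) =
              if min (if k.1 ≤ j - 1 then k.1 else k.1 - 1) n < i then
                min (if k.1 ≤ j - 1 then k.1 else k.1 - 1) n else
                min (if k.1 ≤ j - 1 then k.1 else k.1 - 1) n + 1
            simp only [SimplexCategory.len_mk] at this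
            split_ifs <;> omega
          rw [e, ← map_map, h1 _ _ (sg_degenerate _ _ _), mul_zero]
        · have e : dl i (n + 1) ≫ sg j (n + 1) = sg j n ≫ dl (i - 1) n := by
            apply hom_ext'; intro k
            have := k.2
            change min (if (if k.1 < i then k.1 else k.1 + 1) ≤ j then
              (if k.1 < i then k.1 else k.1 + 1) else
              (if k.1 < i then k.1 else k.1 + 1) - 1) (n + 1) =
              if min (if k.1 ≤ j then k.1 else k.1 - 1) n < i - 1 then
                min (if k.1 ≤ j then k.1 else k.1 - 1) n else
                min (if k.1 ≤ j then k.1 else k.1 - 1) n + 1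
            simp only [SimplexCategory.len_mk] at this
            split_ifs <;> omega
          rw [e, ← map_map, h1 _ _ (sg_degenerate _ _ _), mul_zero]
      · intro h; rw [Finset.mem_range] at h; omega
      · intro h; rw [Finset.mem_range] at h; omega
  · rintro (_ | n) hn
    · omega
    · funext x
      simp [rawD, h3 n (by omega)]

theorem rawCup_mem {f g : Raw X.X A} (hf : f ∈ Cbar X A) (hg : g ∈ Cbar X A) :
    rawCup f g ∈ Cbar X A := by
  obtain ⟨h1, h2, N, h3⟩ := hf
  obtain ⟨k1, k2, K, k3⟩ := hg
  refine ⟨?_, ?_, N + K, ?_⟩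
  · rintro (_ | n) x hx
    · simp at hx
    · obtain ⟨j, hj, y, rfl⟩ := degenerate_exists hx
      refine Finset.sum_eq_zero ?_
      rintro ⟨p, q⟩ hpq
      rw [Finset.HasAntidiagonal.mem_antidiagonal] at hpq
      dsimp only at hpq ⊢
      rw [map_map, map_map]
      by_cases hjp : j < p
      · obtain ⟨p, rfl⟩ : ∃ p', p = p' + 1 := ⟨p - 1, by omega⟩
        have e : seg 0 (p + 1) (n + 1) ≫ sg j n = sg j p ≫ seg 0 p n := by
          apply hom_ext'; intro k
          have := k.2
          change min (if min (k.1 + 0) (n + 1) ≤ j then min (k.1 + 0) (n + 1) else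
            min (k.1 + 0) (n + 1) - 1) n =
            min (min (if k.1 ≤ j then k.1 else k.1 - 1) p + 0) n
          simp only [SimplexCategory.len_mk] at this
          split_ifs <;> omega
        rw [e, ← map_map, h1 _ _ (sg_degenerate _ _ _), zero_mul]
      · obtain ⟨q, rfl⟩ : ∃ q', q = q' + 1 := ⟨q - 1, by omega⟩
        have e : seg p (q + 1) (n + 1) ≫ sg j n = sg (j - p) q ≫ seg p q n := by
          apply hom_ext'; intro k
          have := k.2
          change min (if min (k.1 + p) (n + 1) ≤ j then min (k.1 + p) (n + 1) else
            min (k.1 + p) (n + 1) - 1) n =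
            min (min (if k.1 ≤ j - p then k.1 else k.1 - 1) q + p) n
          simp only [SimplexCategory.len_mk] at this
          split_ifs <;> omega
        rw [e, ← map_map (sg (j - p) q), k1 _ _ (sg_degenerate _ _ _), mul_zero]
  · have e : seg 0 0 0 = 𝟙 _ := by
      apply hom_ext'; intro k
      have := k.2
      change min (k.1 + 0) 0 = k.1
      simp only [SimplexCategory.len_mk] at this
      omega
    simp [rawCup, e, h2]
  · intro n hn
    funext x
    refine Finset.sum_eq_zero ?_
    rintro ⟨p, q⟩ hpq
    rw [Finset.HasAntidiagonal.mem_antidiagonal] at hpq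
    dsimp only at hpq ⊢
    by_cases hp : N ≤ p
    · simp [h3 p hp]
    · simp [k3 q (by omega)]

variable (X A)

/-- The coboundary. -/
def cD : Cbar X A →ₗ[A] Cbar X A where
  toFun f := ⟨rawD f.1, rawD_mem f.2⟩
  map_add' f g := by
    apply Subtype.ext; funext n x
    cases n with
    | zero => simp [rawD]
    | succ n => simp [rawD, mul_add, Finset.sum_add_distrib]
  map_smul' r f := by
    apply Subtype.ext; funext n x
    cases n with
    | zero => simp [rawD]
    | succ n => simp [rawD, Finset.mul_sum, mul_left_comm]

/-- The sign operator `f ↦ (-1) ^ (|f| + 1) f`. -/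
def cS : Cbar X A →ₗ[A] Cbar X A where
  toFun f := ⟨rawSign f.1, fun n x hx => by simp [rawSign, f.2.1 n x hx],
    by simp [rawSign, f.2.2.1], by
      obtain ⟨N, hN⟩ := f.2.2.2
      exact ⟨N, fun n hn => by funext x; simp [rawSign, hN n hn]⟩⟩
  map_add' f g := by
    apply Subtype.ext; funext n x
    simp [rawSign, mul_add]
  map_smul' r f := by
    apply Subtype.ext; funext n x
    simp [rawSign, mul_left_comm]

/-- The cup product. -/
def cM : Cbar X A →ₗ[A] Cbar X A →ₗ[A] Cbar X A :=
  LinearMap.mk₂ A (fun f g => ⟨rawCup f.1 g.1, rawCup_mem f.2 g.2⟩)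
    (by intro f f' g; apply Subtype.ext; funext n x
        simp [rawCup, add_mul, Finset.sum_add_distrib])
    (by intro r f g; apply Subtype.ext; funext n x
        simp [rawCup, Finset.mul_sum, mul_assoc])
    (by intro f g g'; apply Subtype.ext; funext n x
        simp [rawCup, mul_add, Finset.sum_add_distrib])
    (by intro r f g; apply Subtype.ext; funext n x
        simp [rawCup, Finset.mul_sum, mul_left_comm])

theorem isDGA : IsDGA (cD X A) (cS X A) (cM X A) where
  dd f := Subtype.ext (rawD_rawD f.1)
  ds f := by
    apply Subtype.ext; funext n x
    cases n with
    | zero => simp [cD, cS, rawD, rawSign]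
    | succ n =>
      simp only [cD, cS, rawD, rawSign, LinearMap.coe_mk, AddHom.coe_mk, Submodule.coe_neg,
        Pi.neg_apply, Finset.mul_sum, ← Finset.sum_neg_distrib]
      exact Finset.sum_congr rfl fun i _ => by ring
  ss f := by
    apply Subtype.ext; funext n x
    simp only [cS, rawSign, LinearMap.coe_mk, AddHom.coe_mk, ← mul_assoc, ← pow_add]
    rw [Even.neg_one_pow ⟨n + 1, rfl⟩, one_mul]
  sm f g := by
    apply Subtype.ext; funext n x
    simp only [cS, cM, rawSign, rawCup, LinearMap.coe_mk, AddHom.coe_mk, LinearMap.mk₂_apply,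
      Submodule.coe_neg, Pi.neg_apply, Finset.mul_sum, ← Finset.sum_neg_distrib]
    refine Finset.sum_congr rfl ?_
    rintro ⟨p, q⟩ hpq
    rw [Finset.HasAntidiagonal.mem_antidiagonal] at hpq
    dsimp only at hpq ⊢
    subst hpq
    ring
  assoc f g h := Subtype.ext (rawCup_assoc f.1 g.1 h.1)
  leib f g := Subtype.ext (rawD_rawCup f.1 g.1)

/-- The bar construction `Bar(X;A) = T(s⁻¹ C̄)`, as a module. -/
abbrev Bar : Type _ := TensorAlgebra A (Cbar X A)

/-- The bar differential: on letters of degree `|cᵢ|`,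
`d(c₁|…|cₚ) = -∑ (-1)^(∑_{j<i} (|cⱼ| - 1)) c₁|…|dcᵢ|…|cₚ
  - ∑ (-1)^(∑_{j≤i} (|cⱼ| - 1)) c₁|…|cᵢ ⌣ cᵢ₊₁|…|cₚ`. -/
abbrev barDiff : Bar X A →ₗ[A] Bar X A := barD (cD X A) (cS X A) (cM X A)

/-- The part of total degree `k` of the bar construction. -/
abbrev BarDeg (k : ℤ) : Submodule A (Bar X A) := tensorDeg (Cdeg X A) k

/-- Bar cohomology `H^k_Bar(X;A)`. -/
abbrev HBar (k : ℤ) : Type _ := Coh (barDiff X A) (BarDeg X A k) (BarDeg X A (k - 1))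

variable {X A}

theorem cD_mem_Cdeg (n : ℕ) (f : Cbar X A) (hf : f ∈ Cdeg X A n) : cD X A f ∈ Cdeg X A (n + 1) := by
  intro k hk
  funext x
  cases k with
  | zero => rfl
  | succ k =>
    have := hf k (by omega)
    simp [cD, rawD, this]

theorem cS_mem_Cdeg (n : ℕ) (f : Cbar X A) (hf : f ∈ Cdeg X A n) : cS X A f ∈ Cdeg X A n := by
  intro k hk
  funext x
  simp [cS, rawSign, hf k hk]

theorem cM_mem_Cdeg (p q : ℕ) (f : Cbar X A) (hf : f ∈ Cdeg X A p) (g : Cbar X A)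
    (hg : g ∈ Cdeg X A q) : cM X A f g ∈ Cdeg X A (p + q) := by
  intro k hk
  funext x
  change rawCup f.1 g.1 k x = 0
  refine Finset.sum_eq_zero ?_
  rintro ⟨p', q'⟩ hpq
  rw [Finset.HasAntidiagonal.mem_antidiagonal] at hpq
  dsimp only at hpq ⊢
  by_cases hp : p' = p
  · simp [hg q' (by omega)]
  · simp [hf p' hp]

theorem barDiff_mem {k l : ℤ} (hkl : k + 1 = l) {x : Bar X A} (hx : x ∈ BarDeg X A k) :
    barDiff X A x ∈ BarDeg X A l :=
  hkl ▸ barD_mem_tensorDeg (d := cD X A) (s := cS X A) (m := cM X A) (deg := Cdeg X A) cD_mem_Cdeg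
    cS_mem_Cdeg cM_mem_Cdeg hx

theorem barDiff_barDiff (x : Bar X A) : barDiff X A (barDiff X A x) = 0 :=
  barD_barD (isDGA X A) x

variable {Y : PSSet.{u}}

/-- Restriction of cochains along a pointed simplicial map. -/
def pull (A : Type v) [CommRing A] (φ : PHom X Y) : Cbar Y A →ₗ[A] Cbar X A where
  toFun f := ⟨fun n x => f.1 n (φ.f.app _ x),
    fun n x hx => f.2.1 n _ (SSet.degenerate_app_apply hx φ.f),
    by simp only [φ.pt]; exact f.2.2.1, by
      obtain ⟨N, hN⟩ := f.2.2.2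
      exact ⟨N, fun n hn => by funext x; simp [hN n hn]⟩⟩
  map_add' f g := rfl
  map_smul' r f := rfl

theorem app_map {X Y : SSet.{u}} (φ : X ⟶ Y) {l n : ℕ} (f : ⦋l⦌ ⟶ ⦋n⦌) (x : X _⦋n⦌) :
    φ.app _ (X.map f.op x) = Y.map f.op (φ.app _ x) :=
  ConcreteCategory.congr_hom (φ.naturality f.op) x

theorem pull_cD (φ : PHom X Y) (f : Cbar Y A) : pull A φ (cD Y A f) = cD X A (pull A φ f) := by
  apply Subtype.ext; funext n x
  cases n with
  | zero => rfl
  | succ n =>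
    change rawD f.1 (n + 1) _ = rawD _ (n + 1) x
    rw [rawD_succ, rawD_succ]
    exact Finset.sum_congr rfl fun i _ => by rw [← app_map]; rfl

theorem pull_cS (φ : PHom X Y) (f : Cbar Y A) : pull A φ (cS Y A f) = cS X A (pull A φ f) := rfl

theorem pull_cM (φ : PHom X Y) (f g : Cbar Y A) :
    pull A φ (cM Y A f g) = cM X A (pull A φ f) (pull A φ g) := by
  apply Subtype.ext; funext n x
  change rawCup f.1 g.1 n _ = rawCup _ _ n x
  refine Finset.sum_congr rfl fun i _ => ?_
  rw [← app_map, ← app_map]; rfl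

theorem pull_mem_Cdeg (φ : PHom X Y) (n : ℕ) (f : Cbar Y A) (hf : f ∈ Cdeg Y A n) :
    pull A φ f ∈ Cdeg X A n := by
  intro k hk
  funext x
  simp [pull, hf k hk]

/-- The pullback on bar constructions. -/
abbrev barPull (A : Type v) [CommRing A] (φ : PHom X Y) : Bar Y A →ₗ[A] Bar X A :=
  (tmap (pull A φ)).toLinearMap

theorem barPull_barDiff (φ : PHom X Y) (x : Bar Y A) :
    barPull A φ (barDiff Y A x) = barDiff X A (barPull A φ x) :=
  barD_tmap (pull A φ) (pull_cD φ) (pull_cS φ) (pull_cM φ) x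

theorem barPull_mem (φ : PHom X Y) {k : ℤ} {x : Bar Y A} (hx : x ∈ BarDeg Y A k) :
    barPull A φ x ∈ BarDeg X A k :=
  tmap_mem_tensorDeg (pull A φ) (pull_mem_Cdeg φ) hx

/-- The pullback `φ^* : H^k_Bar(Y;A) → H^k_Bar(X;A)`. -/
def HBar.pull (A : Type v) [CommRing A] (φ : PHom X Y) (k : ℤ) : HBar Y A k →ₗ[A] HBar X A k :=
  Coh.map (barPull A φ) (barPull_barDiff φ) (fun _ hx => barPull_mem φ hx)
    (fun _ hx => barPull_mem φ hx)

/-! ### Pairs and the relative Massey product -/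

/-- The relative bar construction `Bar(Y,X;A)`: the kernel of the restriction to `X`. -/
abbrev BarRel (A : Type v) [CommRing A] (φ : PHom X Y) : Submodule A (Bar Y A) :=
  LinearMap.ker (barPull A φ)

/-- Relative bar cohomology `H^k_Bar(Y,X;A)`. -/
abbrev HBarRel (A : Type v) [CommRing A] (φ : PHom X Y) (k : ℤ) : Type _ :=
  Coh (barDiff Y A) (BarDeg Y A k ⊓ BarRel A φ) (BarDeg Y A (k - 1) ⊓ BarRel A φ)

/-- Relative cochains `C^*(Y,X;A)`: cochains of `Y` that vanish on `X`. -/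
abbrev CRel (A : Type v) [CommRing A] (φ : PHom X Y) : Submodule A (Cbar Y A) :=
  LinearMap.ker (pull A φ)

/-- Relative cohomology `H^2(Y,X;A)`. -/
abbrev H2Rel (A : Type v) [CommRing A] (φ : PHom X Y) : Type _ :=
  Coh (cD Y A) (Cdeg Y A 2 ⊓ CRel A φ) (Cdeg Y A 1 ⊓ CRel A φ)

/-- The weight one part of relative bar cohomology, `H^2(Y,X;A) → H^1_Bar(Y,X;A)`.  The weight one
part of the relative bar complex is `C^*(Y,X;A)` shifted by one, with differential `-d`; the class
of a relative cocycle `κ` goes to the class of `-κ`, so that the relative Massey product of a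
class `α ∈ H^1(X;A)` is the coboundary `dα` of the long exact sequence of the pair. -/
def weightOne (A : Type v) [CommRing A] (φ : PHom X Y) : H2Rel A φ →ₗ[A] HBarRel A φ 1 :=
  Submodule.mapQ _ _
    ((-(TensorAlgebra.ι A)).restrict (p := (Cdeg Y A 2 ⊓ CRel A φ) ⊓ LinearMap.ker (cD Y A))
      (q := (BarDeg Y A 1 ⊓ BarRel A φ) ⊓ LinearMap.ker (barDiff Y A)) (by
        rintro κ ⟨⟨h1, h2⟩, h3⟩
        have h2' : pull A φ κ = 0 := h2
        have h3' : cD Y A κ = 0 := h3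
        refine ⟨⟨?_, ?_⟩, ?_⟩
        · refine Submodule.neg_mem _ (Submodule.subset_span ⟨[(2, κ)], ?_, by simp, by simp⟩)
          simpa using h1
        · change barPull A φ (-TensorAlgebra.ι A κ) = 0
          simp [h2']
        · change barDiff Y A (-TensorAlgebra.ι A κ) = 0
          simp [barD_ι, h3']))
    (by
      rintro ⟨κ, hκ⟩ hκ'
      obtain ⟨η, ⟨h1, h2⟩, rfl⟩ := hκ'
      have h2' : pull A φ η = 0 := h2
      refine ⟨TensorAlgebra.ι A η, ⟨?_, ?_⟩, ?_⟩
      · refine Submodule.subset_span ⟨[(1, η)], ?_, by simp, by simp⟩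
        simpa using h1
      · change barPull A φ (TensorAlgebra.ι A η) = 0
        simp [h2']
      · simp [barD_ι])

open Classical in
/-- Extension of cochains by zero along an inclusion of simplicial sets. -/
def extend (A : Type v) [CommRing A] (φ : PHom X Y)
    (hφ : ∀ n : ℕ, Function.Injective fun x : X.X _⦋n⦌ => φ.f.app _ x) :
    Cbar X A →ₗ[A] Cbar Y A where
  toFun f := ⟨fun n y => if h : ∃ x, φ.f.app _ x = y then f.1 n h.choose else 0, by
      refine ⟨?_, ?_, ?_⟩
      · intro n y hy
        dsimp only
        split_ifs with h
        · cases n with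
          | zero => simp at hy
          | succ n =>
            have hx := h.choose_spec
            refine f.2.1 _ _ ?_
            generalize h.choose = x at hx
            obtain ⟨j, hj, z, rfl⟩ := degenerate_exists hy
            have e : dl j n ≫ sg j n = 𝟙 _ := by
              apply hom_ext'; intro k
              have := k.2
              change min (if (if k.1 < j then k.1 else k.1 + 1) ≤ j then
                (if k.1 < j then k.1 else k.1 + 1) else
                (if k.1 < j then k.1 else k.1 + 1) - 1) n = k.1
              simp only [SimplexCategory.len_mk] at this
              split_ifs <;> omega
            have hz : φ.f.app _ (X.X.map (dl j n).op x) = z := by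
              rw [app_map, hx, map_map, e]; simp
            have : x = X.X.map (sg j n).op (X.X.map (dl j n).op x) := by
              apply hφ (n + 1)
              dsimp only
              rw [app_map, hz, hx]
            rw [this]
            exact sg_degenerate _ _ _
        · rfl
      · dsimp only
        split_ifs with h
        · have hx := h.choose_spec
          have : h.choose = X.pt := by
            apply hφ 0
            dsimp only
            rw [hx, φ.pt]
          rw [this]
          exact f.2.2.1
        · rfl
      · obtain ⟨N, hN⟩ := f.2.2.2
        exact ⟨N, fun n hn => by funext x; simp [hN n hn]⟩⟩
  map_add' f g := by
    apply Subtype.ext; funext n y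
    simp only [Submodule.coe_add, Pi.add_apply]
    split_ifs <;> simp
  map_smul' r f := by
    apply Subtype.ext; funext n y
    simp only [Submodule.coe_smul, Pi.smul_apply, RingHom.id_apply]
    split_ifs <;> simp

theorem pull_extend (φ : PHom X Y)
    (hφ : ∀ n : ℕ, Function.Injective fun x : X.X _⦋n⦌ => φ.f.app _ x) (f : Cbar X A) :
    pull A φ (extend A φ hφ f) = f := by
  apply Subtype.ext; funext n x
  have h : ∃ x', φ.f.app _ x' = φ.f.app _ x := ⟨x, rfl⟩
  simp only [pull, extend, LinearMap.coe_mk, AddHom.coe_mk]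
  rw [dif_pos h]
  exact congrArg _ (hφ n h.choose_spec)

theorem extend_mem_Cdeg (φ : PHom X Y)
    (hφ : ∀ n : ℕ, Function.Injective fun x : X.X _⦋n⦌ => φ.f.app _ x) (n : ℕ) (f : Cbar X A)
    (hf : f ∈ Cdeg X A n) : extend A φ hφ f ∈ Cdeg Y A n := by
  intro k hk
  funext x
  simp [extend, hf k hk]

theorem barExtend_mem (φ : PHom X Y)
    (hφ : ∀ n : ℕ, Function.Injective fun x : X.X _⦋n⦌ => φ.f.app _ x) {k : ℤ} {x : Bar X A}
    (hx : x ∈ BarDeg X A k) : tmap (extend A φ hφ) x ∈ BarDeg Y A k :=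
  tmap_mem_tensorDeg (extend A φ hφ) (extend_mem_Cdeg φ hφ) hx

theorem barPull_extend (φ : PHom X Y)
    (hφ : ∀ n : ℕ, Function.Injective fun x : X.X _⦋n⦌ => φ.f.app _ x) (x : Bar X A) :
    barPull A φ (tmap (extend A φ hφ) x) = x := by
  have : (tmap (pull A φ)).comp (tmap (extend A φ hφ)) = AlgHom.id A _ := by
    ext c
    simp [pull_extend]
  exact DFunLike.congr_fun this x

/-- The relative Massey product `μ : H^0_Bar(X;A) → H^1_Bar(Y,X;A)`: the connecting map of
`0 → Bar(Y,X;A) → Bar(Y;A) → Bar(X;A) → 0`, which lifts a cocycle to `Bar(Y;A)` and applies the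
bar differential.  The lift used here extends the cochains by zero; see `relMassey_mk` for the
independence of the lift. -/
def relMassey (A : Type v) [CommRing A] (φ : PHom X Y)
    (hφ : ∀ n : ℕ, Function.Injective fun x : X.X _⦋n⦌ => φ.f.app _ x) :
    HBar X A 0 →ₗ[A] HBarRel A φ 1 :=
  Submodule.mapQ _ _
    ((barDiff Y A ∘ₗ (tmap (extend A φ hφ)).toLinearMap).restrict
      (p := BarDeg X A 0 ⊓ LinearMap.ker (barDiff X A))
      (q := (BarDeg Y A 1 ⊓ BarRel A φ) ⊓ LinearMap.ker (barDiff Y A)) (by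
        rintro x ⟨h1, h2⟩
        have h2' : barDiff X A x = 0 := h2
        refine ⟨⟨?_, ?_⟩, ?_⟩
        · exact barDiff_mem (zero_add 1) (barExtend_mem φ hφ h1)
        · change barPull A φ (barDiff Y A (tmap (extend A φ hφ) x)) = 0
          rw [barPull_barDiff, barPull_extend, h2']
        · exact barDiff_barDiff _))
    (by
      rintro ⟨x, hx⟩ hx'
      obtain ⟨y, hy, hyx⟩ := hx'
      change barDiff X A y = x at hyx
      subst hyx
      refine ⟨tmap (extend A φ hφ) (barDiff X A y) - barDiff Y A (tmap (extend A φ hφ) y),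
        ⟨Submodule.sub_mem _ ?_ ?_, ?_⟩, ?_⟩
      · exact barExtend_mem φ hφ hx.1
      · exact barDiff_mem (sub_add_cancel 0 1) (barExtend_mem φ hφ hy)
      · change barPull A φ _ = 0
        rw [map_sub, barPull_barDiff, barPull_extend, barPull_extend, sub_self]
      · rw [map_sub, barDiff_barDiff, sub_zero]
        rfl)

/-- The relative Massey product may be computed with any lift. -/
theorem relMassey_mk (φ : PHom X Y)
    (hφ : ∀ n : ℕ, Function.Injective fun x : X.X _⦋n⦌ => φ.f.app _ x)
    (x : ↥(BarDeg X A 0 ⊓ LinearMap.ker (barDiff X A))) (y : Bar Y A) (hy : y ∈ BarDeg Y A 0)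
    (hyx : barPull A φ y = x.1)
    (hdy : barDiff Y A y ∈ (BarDeg Y A 1 ⊓ BarRel A φ) ⊓ LinearMap.ker (barDiff Y A)) :
    relMassey A φ hφ (Coh.mk x) = Coh.mk ⟨barDiff Y A y, hdy⟩ := by
  refine (Submodule.Quotient.eq _).2 ?_
  refine ⟨tmap (extend A φ hφ) x.1 - y, ⟨Submodule.sub_mem _ ?_ hy, ?_⟩, ?_⟩
  · exact barExtend_mem φ hφ x.2.1
  · change barPull A φ _ = 0
    rw [map_sub, barPull_extend, hyx, sub_self]
  · rw [map_sub]; rfl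

end Reduced

/-! ### One-dimensional simplicial sets: circles and wedges of circles -/

section Graph

/-- Gluing relation for the simplicial set of a graph: the constant simplices of an edge `e` are
identified with the endpoints of `e`. -/
inductive GraphRel {V E : Type u} (ends : E → Fin 2 → V) (n : SimplexCategory) :
    V ⊕ E × (n ⟶ ⦋1⦌) → V ⊕ E × (n ⟶ ⦋1⦌) → Prop where
  | glue (e : E) (i : Fin 2) :
      GraphRel ends n (Sum.inr (e, SimplexCategory.const n ⦋1⦌ i)) (Sum.inl (ends e i))

/-- The simplicial set with vertices `V` and a copy of `Δ[1]` for every `e ∈ E`, whose initial and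
terminal vertices are glued to `ends e 0` and `ends e 1`. -/
def graph {V E : Type u} (ends : E → Fin 2 → V) : SSet.{u} where
  obj n := Quot (GraphRel ends n.unop)
  map {n m} f := TypeCat.ofHom (Quot.map
    (Sum.map id fun p => (p.1, f.unop ≫ p.2)) (by
      rintro _ _ ⟨e, i⟩
      exact GraphRel.glue (ends := ends) (n := m.unop) e i))
  map_id n := by
    ext x
    induction x using Quot.ind with
    | mk x => rcases x with v | ⟨e, φ⟩ <;> simp [Quot.map]
  map_comp f g := by
    ext x
    induction x using Quot.ind with
    | mk x => rcases x with v | ⟨e, φ⟩ <;> simp [Quot.map]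

variable {V E : Type u} (ends : E → Fin 2 → V)

/-- The simplex of the graph at a vertex. -/
def gV (n : SimplexCategoryᵒᵖ) (v : V) : (graph ends).obj n := Quot.mk _ (Sum.inl v)

/-- The simplex of the graph on an edge. -/
def gE (n : SimplexCategoryᵒᵖ) (e : E) (φ : n.unop ⟶ ⦋1⦌) : (graph ends).obj n :=
  Quot.mk _ (Sum.inr (e, φ))

/-- The `1`-simplex of an edge. -/
def edge (e : E) : (graph ends) _⦋1⦌ := gE ends _ e (𝟙 _)

/-- The graph pointed at a vertex. -/
def pgraph (v₀ : V) : PSSet.{u} := ⟨graph ends, gV ends _ v₀⟩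

theorem graph_map_gV {n m : SimplexCategoryᵒᵖ} (f : n ⟶ m) (v : V) :
    (graph ends).map f (gV ends n v) = gV ends m v := rfl

theorem graph_map_gE {n m : SimplexCategoryᵒᵖ} (f : n ⟶ m) (e : E) (φ : n.unop ⟶ ⦋1⦌) :
    (graph ends).map f (gE ends n e φ) = gE ends m e (f.unop ≫ φ) := rfl

theorem gE_const (n : SimplexCategoryᵒᵖ) (e : E) (i : Fin 2) :
    gE ends n e (SimplexCategory.const n.unop ⦋1⦌ i) = gV ends n (ends e i) :=
  Quot.sound (GraphRel.glue e i)

variable {ends}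

/-- A map out of a graph is given by vertices and edges with the right endpoints. -/
def graphLift {Y : SSet.{u}} (fV : V → Y _⦋0⦌) (fE : E → Y _⦋1⦌)
    (h : ∀ e i, Y.map (SimplexCategory.const ⦋0⦌ ⦋1⦌ i).op (fE e) = fV (ends e i)) :
    graph ends ⟶ Y where
  app n := TypeCat.ofHom (Quot.lift
    (Sum.elim (fun v => Y.map (SimplexCategory.const n.unop ⦋0⦌ 0).op (fV v))
      fun p => Y.map p.2.op (fE p.1)) (by
      rintro _ _ ⟨e, i⟩
      simp only [Sum.elim_inr, Sum.elim_inl]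
      rw [← h e i]
      rw [← CategoryTheory.comp_apply, ← Functor.map_comp]
      rfl))
  naturality n m f := by
    ext x
    induction x using Quot.ind with
    | mk x =>
      rcases x with v | ⟨e, φ⟩
      · change Y.map _ (fV v) = Y.map f (Y.map _ (fV v))
        rw [← CategoryTheory.comp_apply, ← Functor.map_comp]
        rfl
      · change Y.map _ (fE e) = Y.map f (Y.map _ (fE e))
        rw [← CategoryTheory.comp_apply, ← Functor.map_comp]
        rfl

theorem id_ne_const (i : Fin 2) : 𝟙 ⦋1⦌ ≠ SimplexCategory.const ⦋1⦌ ⦋1⦌ i := by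
  intro h
  have h0 := congrArg (fun f : ⦋1⦌ ⟶ ⦋1⦌ => f.toOrderHom 0) h
  have h1 := congrArg (fun f : ⦋1⦌ ⟶ ⦋1⦌ => f.toOrderHom 1) h
  have h0' : (0 : Fin 2) = i := h0
  have h1' : (1 : Fin 2) = i := h1
  rw [← h0'] at h1'
  exact absurd h1' (by decide)

theorem graph_degenerate {n : ℕ} (hn : 2 ≤ n) (x : (graph ends) _⦋n⦌) :
    x ∈ (graph ends).degenerate n := by
  induction x using Quot.ind with
  | mk x =>
    rcases x with v | ⟨e, φ⟩
    · exact ⟨0, by omega, SimplexCategory.const _ _ 0, gV ends _ v, rfl⟩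
    · exact ⟨1, by omega, φ, edge ends e, by
        change gE ends _ e (φ ≫ 𝟙 _) = gE ends _ e φ
        rw [Category.comp_id]⟩

variable (A : Type v) [CommRing A]

variable (ends) in
open Classical in
/-- The function on `1`-simplices of a graph with prescribed values on the edges and value `0` on
degenerate simplices. -/
def edgeVal (a : E → A) : (graph ends) _⦋1⦌ → A :=
  Quot.lift (Sum.elim (fun _ => 0) fun p => if p.2 = 𝟙 ⦋1⦌ then a p.1 else 0) (by
    rintro _ _ ⟨e, i⟩
    exact if_neg (id_ne_const i).symm)

variable (ends) in
/-- The family of functions on simplices that is `edgeVal` in degree one and zero in the other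
degrees. -/
def edgeRaw (a : E → A) : Raw (graph ends) A := fun n => match n with
  | 1 => edgeVal ends A a
  | _ => 0

variable (ends) in
theorem edgeVal_add (a b : E → A) (x : (graph ends) _⦋1⦌) :
    edgeVal ends A (a + b) x = edgeVal ends A a x + edgeVal ends A b x := by
  induction x using Quot.ind with
  | mk x =>
    rcases x with v | ⟨e, φ⟩
    · exact (add_zero _).symm
    · by_cases h : φ = 𝟙 ⦋1⦌
      · simp [edgeVal, h]
      · simp [edgeVal, h]

variable (ends) in
theorem edgeVal_smul (r : A) (a : E → A) (x : (graph ends) _⦋1⦌) :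
    edgeVal ends A (r • a) x = r * edgeVal ends A a x := by
  induction x using Quot.ind with
  | mk x =>
    rcases x with v | ⟨e, φ⟩
    · exact (mul_zero _).symm
    · by_cases h : φ = 𝟙 ⦋1⦌
      · simp [edgeVal, h]
      · simp [edgeVal, h]

/-- The `1`-cochain of a graph with prescribed values on the edges. -/
def edgeCochain (v₀ : V) : (E → A) →ₗ[A] Cbar (pgraph ends v₀) A where
  toFun a := ⟨edgeRaw ends A a, by
    refine ⟨?_, rfl, 2, ?_⟩
    · intro n x hx
      match n with
      | 0 => rfl
      | n + 2 => rfl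
      | 1 =>
        obtain ⟨m, hm, f, y, rfl⟩ := hx
        obtain rfl : m = 0 := by omega
        induction y using Quot.ind with
        | mk y =>
          rcases y with v | ⟨e, φ⟩
          · rfl
          · refine if_neg fun h => id_ne_const (φ.toOrderHom 0) ?_
            rw [← h]
            apply SimplexCategory.Hom.ext
            ext k
            change (φ.toOrderHom (f.toOrderHom k)).1 = (φ.toOrderHom 0).1
            rw [Subsingleton.elim (α := Fin 1) (f.toOrderHom k) 0]
    · intro n hn
      match n, hn with
      | n + 2, _ => rfl⟩
  map_add' a b := by
    apply Subtype.ext; funext n x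
    match n with
    | 0 => exact (add_zero _).symm
    | n + 2 => exact (add_zero _).symm
    | 1 => exact edgeVal_add ends A a b x
  map_smul' r a := by
    apply Subtype.ext; funext n x
    match n with
    | 0 => exact (mul_zero _).symm
    | n + 2 => exact (mul_zero _).symm
    | 1 => exact edgeVal_smul ends A r a x

theorem edgeCochain_edge (v₀ : V) (a : E → A) (e : E) :
    (edgeCochain A (ends := ends) v₀ a).1 1 (edge ends e) = a e := by
  change (if 𝟙 ⦋1⦌ = 𝟙 ⦋1⦌ then a e else 0) = a e
  exact if_pos rfl

variable {A}

theorem edgeCochain_mem (v₀ : V) (a : E → A) :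
    edgeCochain A (ends := ends) v₀ a ∈ Cdeg (pgraph ends v₀) A 1 := by
  intro k hk
  match k, hk with
  | 0, _ => rfl
  | k + 2, _ => rfl

theorem graph_cochain_eq_zero (v₀ : V) {n : ℕ} (hn : 2 ≤ n) (f : Cbar (pgraph ends v₀) A)
    (hf : f ∈ Cdeg (pgraph ends v₀) A n) : f = 0 := by
  apply Subtype.ext; funext k x
  by_cases hk : k = n
  · subst hk
    exact f.2.1 k x (graph_degenerate hn x)
  · rw [hf k hk]; rfl

theorem barDiff_edgeCochain (v₀ : V) (x : TensorAlgebra A (E → A)) :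
    barDiff (pgraph ends v₀) A (tmap (edgeCochain A v₀) x) = 0 := by
  have hmer : ∀ x : TensorAlgebra A (E → A), ∀ a : E → A,
      barMerge (cD (pgraph ends v₀) A) (cS _ A) (cM _ A) (tmap (edgeCochain A v₀) x)
        (cS _ A (edgeCochain A v₀ a)) = 0 := by
    intro x a
    have := cons_induction (P := LinearMap.ker
      ((barMerge (cD (pgraph ends v₀) A) (cS _ A) (cM _ A)).flip
        (cS _ A (edgeCochain A v₀ a)) ∘ₗ (tmap (edgeCochain A v₀)).toLinearMap)) (by simp)
      (fun c x _ => by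
        have h : cM (pgraph ends v₀) A (cS _ A (edgeCochain A v₀ a)) (edgeCochain A v₀ c) = 0 :=
          graph_cochain_eq_zero v₀ le_rfl _ (cM_mem_Cdeg 1 1 _
            (cS_mem_Cdeg 1 _ (edgeCochain_mem v₀ a)) _ (edgeCochain_mem v₀ c))
        simp [barMerge_cons, h]) x
    simpa using this
  have := cons_induction (P := LinearMap.ker
    (barDiff (pgraph ends v₀) A ∘ₗ (tmap (edgeCochain A v₀)).toLinearMap)) (by simp)
    (fun c x hx => by
      have h : cD (pgraph ends v₀) A (edgeCochain A v₀ c) = 0 :=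
        graph_cochain_eq_zero v₀ le_rfl _ (cD_mem_Cdeg 1 _ (edgeCochain_mem v₀ c))
      simp only [LinearMap.mem_ker, LinearMap.comp_apply, AlgHom.toLinearMap_apply] at hx ⊢
      rw [map_mul, tmap_ι, barD_cons, hx, h, hmer]
      simp) x
  simpa using this

theorem tensor_mem_deg_zero {M : Type*} [AddCommGroup M] [Module A M] {deg : ℕ → Submodule A M}
    {N : Type*} [AddCommGroup N] [Module A N] (f : N →ₗ[A] M) (hf : ∀ a, f a ∈ deg 1)
    (x : TensorAlgebra A N) : tmap f x ∈ tensorDeg deg 0 := by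
  have := cons_induction (P := (tensorDeg deg 0).comap (tmap f).toLinearMap)
    (by
      change tmap f 1 ∈ tensorDeg deg 0
      rw [map_one]
      exact Submodule.subset_span ⟨[], by simp⟩)
    (fun c x hx => by
      change tmap f (TensorAlgebra.ι A c * x) ∈ tensorDeg deg 0
      have hx' : tmap f x ∈ tensorDeg deg 0 := hx
      rw [map_mul, tmap_ι]
      simpa using cons_mem_tensorDeg (hf c) hx') x
  exact this

/-- The bar class `T(A^E) → H^0_Bar` of a tensor of functions on the edges of a graph; for a graph
with one vertex this is the identification `T(A^E) ≅ H^0_Bar`. -/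
def graphClass (A : Type v) [CommRing A] (ends : E → Fin 2 → V) (v₀ : V) :
    TensorAlgebra A (E → A) →ₗ[A] HBar (pgraph ends v₀) A 0 :=
  Coh.mk ∘ₗ LinearMap.codRestrict _ (tmap (edgeCochain A v₀)).toLinearMap
    (fun x => ⟨tensor_mem_deg_zero (edgeCochain A v₀) (edgeCochain_mem v₀) x,
      barDiff_edgeCochain v₀ x⟩)

end Graph

section Circles

/-- The endpoint map of a wedge of circles. -/
def wedgeEnds (S : Type u) : S → Fin 2 → PUnit.{u + 1} := fun _ _ => PUnit.unit

/-- The wedge of circles `X_S`, with one loop for every `s ∈ S`. -/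
def wedge (S : Type u) : PSSet.{u} := pgraph (wedgeEnds S) PUnit.unit

/-- The standard circle `Δ[1]/∂Δ[1]`. -/
def stdCircle : PSSet.{u} := wedge PUnit

/-- The orientation of the segments of the circle of a word: the `0`-th segment is the standard
segment, and the `i`-th one carries the `i`-th letter. -/
def segSign {S : Type u} (w : List (S × Bool)) : Fin (w.length + 1) → Bool :=
  Fin.cons true fun i => (w.get i).2

/-- The `i`-th segment joins the vertices `i` and `i + 1` (cyclically), and it points from `i` to
`i + 1` exactly when its sign is positive. -/
def circleEnds {S : Type u} (w : List (S × Bool)) :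
    ULift.{u} (Fin (w.length + 1)) → Fin 2 → ULift.{u} (Fin (w.length + 1)) :=
  fun e k => if segSign w e.down = (k == 0) then e else ⟨e.down + 1⟩

/-- The subdivided simplicial circle `S¹(w)` of a word. -/
def circle {S : Type u} (w : List (S × Bool)) : PSSet.{u} := pgraph (circleEnds w) ⟨0⟩

/-- The edge of `X_S` over which the `i`-th segment of `S¹(w)` lies; the standard segment is
collapsed to the basepoint. -/
def wordEdge {S : Type u} (w : List (S × Bool)) : Fin (w.length + 1) → (wedge S).X _⦋1⦌ :=
  Fin.cons (gV _ _ PUnit.unit) fun i => edge _ (w.get i).1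

theorem wedge_vertex {S : Type u} (x : (wedge S).X _⦋0⦌) : x = (wedge S).pt := by
  change x = gV (wedgeEnds S) _ PUnit.unit
  induction x using Quot.ind with
  | mk x =>
    rcases x with v | ⟨e, φ⟩
    · rfl
    · have : φ = SimplexCategory.const ⦋0⦌ ⦋1⦌ (φ.toOrderHom 0) := by
        apply SimplexCategory.Hom.ext
        ext k
        change (φ.toOrderHom k).1 = (φ.toOrderHom 0).1
        rw [Subsingleton.elim (α := Fin 1) k 0]
      change gE (wedgeEnds S) _ e φ = _
      rw [this]
      exact gE_const _ _ _ _

/-- The simplicial map `S¹(w) → X_S` that spells out the word `w`. -/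
def wordMap {S : Type u} (w : List (S × Bool)) : PHom (circle w) (wedge S) where
  f := graphLift (fun _ => (wedge S).pt) (fun e => wordEdge w e.down)
    (fun _ _ => wedge_vertex _)
  pt := wedge_vertex _

/-- The standard collapse `S¹(w) → S¹`: the standard segment goes to the edge of the standard
circle, and all other segments are collapsed. -/
def stdMap {S : Type u} (w : List (S × Bool)) : PHom (circle w) stdCircle.{u} where
  f := graphLift (fun _ => stdCircle.pt)
    (fun e => if e.down = 0 then edge _ PUnit.unit else gV _ _ PUnit.unit)
    (fun _ _ => wedge_vertex _)
  pt := wedge_vertex _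

variable (A : Type v) [CommRing A] {S : Type u}

/-- The identification `T(A^S) ≅ H^0_Bar(X_S;A)`. -/
def wedgeClass (S : Type u) : TensorAlgebra A (S → A) →ₗ[A] HBar (wedge S) A 0 :=
  graphClass A (wedgeEnds S) PUnit.unit

/-- The identification `A[t] ≅ H^0_Bar(S¹;A)`: the monomial `t^n` corresponds to `τ|…|τ`, where
`τ` is the cochain with value `1` on the edge. -/
def circleClass : Polynomial A →ₗ[A] HBar stdCircle.{u} A 0 :=
  wedgeClass A PUnit.{u + 1} ∘ₗ
    (Polynomial.aeval (TensorAlgebra.ι A (fun _ : PUnit.{u + 1} => (1 : A)))).toLinearMap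

/-- The map `A[t] ≅ H^0_Bar(S¹;A) → H^0_Bar(S¹(w);A)` induced by the standard collapse.  It is an
isomorphism, because the collapse is a homotopy equivalence. -/
def collapseClass (w : List (S × Bool)) : Polynomial A →ₗ[A] HBar (circle w) A 0 :=
  HBar.pull A (stdMap w) 0 ∘ₗ circleClass.{u} A

/-- The letter-braiding polynomial `L_T(w)` of a word: the image of `T` under
`w^* : H^0_Bar(X_S;A) → H^0_Bar(S¹(w);A)` followed by the inverse of `collapseClass`. -/
def braidingPoly (T : TensorAlgebra A (S → A)) (w : List (S × Bool)) : Polynomial A :=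
  Function.invFun (collapseClass A w) (HBar.pull A (wordMap w) 0 (wedgeClass A S T))

/-- The letter-braiding number `ℓ_T(w)`: the linear coefficient of the letter-braiding
polynomial. -/
def braidingNumber (T : TensorAlgebra A (S → A)) (w : List (S × Bool)) : A :=
  (braidingPoly A T w).coeff 1

end Circles

/-! ### Mapping cones and presentation complexes -/

section Cone

/-- The basepoint in degree `n`. -/
def PSSet.base (X : PSSet.{u}) (n : SimplexCategoryᵒᵖ) : X.X.obj n :=
  X.X.map (SimplexCategory.const n.unop ⦋0⦌ 0).op X.pt

theorem PSSet.map_base (X : PSSet.{u}) {n m : SimplexCategoryᵒᵖ} (f : n ⟶ m) :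
    X.X.map f (X.base n) = X.base m := by
  unfold PSSet.base
  rw [← CategoryTheory.comp_apply, ← Functor.map_comp]
  rfl

theorem PHom.map_base {X Y : PSSet.{u}} (φ : PHom X Y) (n : SimplexCategoryᵒᵖ) :
    φ.f.app n (X.base n) = Y.base n := by
  unfold PSSet.base
  rw [← φ.pt]
  exact ConcreteCategory.congr_hom (φ.f.naturality _) X.pt

variable {ρ : Type u} {Z : ρ → PSSet.{u}} {Y : PSSet.{u}} (φ : ∀ r, PHom (Z r) Y)

/-- Gluing relation for the reduced mapping cone of `φ : ⋁ Z r → Y`: in `Z r × Δ[1]`, the end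
`0` is glued to `Y` by `φ r`, and the end `1` and the basepoint times `Δ[1]` are collapsed to the
basepoint. -/
def ConeRel (n : SimplexCategoryᵒᵖ)
    (a b : Y.X.obj n ⊕ (Σ r, (Z r).X.obj n × (n.unop ⟶ ⦋1⦌))) : Prop :=
  (∃ (r : ρ) (x : (Z r).X.obj n), a = Sum.inr ⟨r, x, SimplexCategory.const n.unop ⦋1⦌ 0⟩ ∧
    b = Sum.inl ((φ r).f.app n x)) ∨
  (∃ (r : ρ) (x : (Z r).X.obj n), a = Sum.inr ⟨r, x, SimplexCategory.const n.unop ⦋1⦌ 1⟩ ∧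
    b = Sum.inl (Y.base n)) ∨
  (∃ (r : ρ) (t : n.unop ⟶ ⦋1⦌), a = Sum.inr ⟨r, (Z r).base n, t⟩ ∧ b = Sum.inl (Y.base n))

/-- The reduced mapping cone of `φ : ⋁ Z r → Y`. -/
def cone : PSSet.{u} where
  X :=
    { obj := fun n => Quot (ConeRel φ n)
      map := fun {n m} f => TypeCat.ofHom (Quot.map
        (Sum.map (Y.X.map f) (Sigma.map id fun r p => ((Z r).X.map f p.1, f.unop ≫ p.2))) (by
          rintro _ _ (⟨r, x, rfl, rfl⟩ | ⟨r, x, rfl, rfl⟩ | ⟨r, t, rfl, rfl⟩)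
          · exact Or.inl ⟨r, (Z r).X.map f x, rfl, congrArg Sum.inl
              (ConcreteCategory.congr_hom ((φ r).f.naturality f) x).symm⟩
          · exact Or.inr (Or.inl ⟨r, (Z r).X.map f x, rfl, congrArg Sum.inl (Y.map_base f)⟩)
          · refine Or.inr (Or.inr ⟨r, f.unop ≫ t, ?_, congrArg Sum.inl (Y.map_base f)⟩)
            change Sum.inr _ = _
            rw [← (Z r).map_base f]
            rfl))
      map_id := fun n => by
        ext x
        induction x using Quot.ind with
        | mk x =>
          refine congrArg (Quot.mk (ConeRel φ n)) ?_
          rcases x with y | ⟨r, x, t⟩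
          · simp
          · simp [Sigma.map]
      map_comp := fun {n m k} f g => by
        ext x
        induction x using Quot.ind with
        | mk x =>
          refine congrArg (Quot.mk (ConeRel φ k)) ?_
          rcases x with y | ⟨r, x, t⟩
          · simp
          · simp [Sigma.map] }
  pt := Quot.mk _ (Sum.inl Y.pt)

/-- The inclusion of `Y` into the mapping cone. -/
def coneIncl : PHom Y (cone φ) where
  f :=
    { app := fun _ => TypeCat.ofHom fun y => Quot.mk _ (Sum.inl y)
      naturality := fun _ _ _ => rfl }
  pt := rfl

theorem const_zero_ne_one (n : SimplexCategory) :
    SimplexCategory.const n ⦋1⦌ 1 ≠ SimplexCategory.const n ⦋1⦌ 0 := by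
  intro h
  have h0 : (1 : Fin 2) = 0 := congrArg (fun f : n ⟶ ⦋1⦌ => f.toOrderHom 0) h
  exact absurd h0 (by decide)

open Classical in
theorem coneIncl_injective (n : ℕ) :
    Function.Injective fun y : Y.X _⦋n⦌ => (coneIncl φ).f.app (op ⦋n⦌) y := by
  let q : Y.X _⦋n⦌ ⊕ (Σ r, (Z r).X _⦋n⦌ × (⦋n⦌ ⟶ ⦋1⦌)) → Option (Y.X _⦋n⦌) :=
    Sum.elim some fun p =>
      if p.2.2 = SimplexCategory.const ⦋n⦌ ⦋1⦌ 0 then some ((φ p.1).f.app _ p.2.1)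
      else if p.2.2 = SimplexCategory.const ⦋n⦌ ⦋1⦌ 1 ∨ p.2.1 = (Z p.1).base _ then
        some (Y.base _) else none
  have hq : ∀ a b, ConeRel φ (op ⦋n⦌) a b → q a = q b := by
    rintro _ _ (⟨r, x, rfl, rfl⟩ | ⟨r, x, rfl, rfl⟩ | ⟨r, t, rfl, rfl⟩)
    · exact if_pos rfl
    · simp [q, const_zero_ne_one]
    · simp only [q, Sum.elim_inr, Sum.elim_inl, or_true, if_true, (φ r).map_base, ite_self]
  intro y y' h
  have h' : Quot.lift q hq (Quot.mk _ (Sum.inl y)) = Quot.lift q hq (Quot.mk _ (Sum.inl y')) :=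
    congrArg (Quot.lift q hq) h
  exact Option.some_injective _ h'

/-- The simplex of the mapping cone on a simplex of `Z r × Δ[1]`. -/
def coneSimplex {n : SimplexCategoryᵒᵖ} (r : ρ) (x : (Z r).X.obj n) (t : n.unop ⟶ ⦋1⦌) :
    (cone φ).X.obj n := Quot.mk _ (Sum.inr ⟨r, x, t⟩)

theorem map_coneSimplex {n m : SimplexCategoryᵒᵖ} (f : n ⟶ m) (r : ρ) (x : (Z r).X.obj n)
    (t : n.unop ⟶ ⦋1⦌) : (cone φ).X.map f (coneSimplex φ r x t) =
      coneSimplex φ r ((Z r).X.map f x) (f.unop ≫ t) := rfl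

end Cone

section Presentation

variable {S : Type u} {ρ : Type u} (word : ρ → List (S × Bool))

/-- The presentation complex `X_{S|R}` with attaching words `word r`: the reduced mapping cone of
`⋁ S¹(word r) → X_S`, that is `X_S` with the reduced cones `D²(r)` on `S¹(word r)` attached. -/
def presentation : PSSet.{u} := cone fun r => wordMap (word r)

/-- The inclusion `X_S → X_{S|R}`. -/
def presIncl : PHom (wedge S) (presentation word) := coneIncl _

theorem presIncl_injective (n : ℕ) :
    Function.Injective fun y : (wedge S).X _⦋n⦌ => (presIncl word).f.app (op ⦋n⦌) y :=
  coneIncl_injective _ n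

/-- The sign of a segment, as an element of `A`. -/
def sgn (A : Type v) [CommRing A] (b : Bool) : A := if b then 1 else -1

variable (A : Type v) [CommRing A]

/-- The `e`-th segment of the circle of a word. -/
def circleEdge (w : List (S × Bool)) (e : Fin (w.length + 1)) : (circle w).X _⦋1⦌ :=
  edge (circleEnds w) ⟨e⟩

/-- The triangle `(e₀,0), (e₁,0), (e₁,1)` of the prism over the `e`-th segment of the disc. -/
def discLower (r : ρ) (e : Fin ((word r).length + 1)) : (presentation word).X _⦋2⦌ :=
  coneSimplex (fun r => wordMap (word r)) r ((circle (word r)).X.σ 1 (circleEdge (word r) e))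
    (SimplexCategory.σ 0)

/-- The triangle `(e₀,0), (e₀,1), (e₁,1)` of the prism over the `e`-th segment of the disc. -/
def discUpper (r : ρ) (e : Fin ((word r).length + 1)) : (presentation word).X _⦋2⦌ :=
  coneSimplex (fun r => wordMap (word r)) r ((circle (word r)).X.σ 0 (circleEdge (word r) e))
    (SimplexCategory.σ 1)

/-- The fundamental chain of the relation disc `D²(r)`: the sum over the segments `e` of
`S¹(word r)`, with their signs, of the two triangles of the prism `e × Δ[1]`.  Its boundary is the
loop `word r` in `X_S`, see `disc_stokes`. -/
def discChain (r : ρ) : (presentation word).X _⦋2⦌ →₀ A :=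
  ∑ e : Fin ((word r).length + 1),
    (Finsupp.single (discLower word r e) (sgn A (segSign (word r) e)) -
      Finsupp.single (discUpper word r e) (sgn A (segSign (word r) e)))

/-- The evaluation of cochains on a `2`-chain. -/
def evalChain {X : PSSet.{u}} {A : Type v} [CommRing A] (c : X.X _⦋2⦌ →₀ A) :
    Cbar X A →ₗ[A] A where
  toFun f := c.sum fun x a => a * f.1 2 x
  map_add' f g := by simp [mul_add]
  map_smul' r f := by simp [Finsupp.mul_sum, mul_left_comm]

theorem evalChain_discChain (r : ρ) (f : Cbar (presentation word) A) :
    evalChain (discChain word A r) f = ∑ e : Fin ((word r).length + 1),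
      sgn A (segSign (word r) e) * (f.1 2 (discLower word r e) - f.1 2 (discUpper word r e)) := by
  have h : ∀ c : (presentation word).X _⦋2⦌ →₀ A,
      evalChain c f = Finsupp.linearCombination A (f.1 2) c := fun c => rfl
  rw [h, discChain, map_sum]
  refine Finset.sum_congr rfl fun e _ => ?_
  rw [map_sub, Finsupp.linearCombination_single, Finsupp.linearCombination_single, mul_sub]
  rfl

/-- The `1`-simplex of the disc on a `1`-simplex of the prism over the `e`-th segment. -/
def discOne (r : ρ) (e : Fin ((word r).length + 1)) (φ t : ⦋1⦌ ⟶ ⦋1⦌) :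
    (presentation word).X _⦋1⦌ :=
  coneSimplex (fun r => wordMap (word r)) r (gE (circleEnds (word r)) (op ⦋1⦌) ⟨e⟩ φ) t

/-- The radial `1`-simplex of the disc at a vertex of the circle. -/
def discRadial (r : ρ) (v : Fin ((word r).length + 1)) : (presentation word).X _⦋1⦌ :=
  coneSimplex (fun r => wordMap (word r)) r (gV (circleEnds (word r)) (op ⦋1⦌) ⟨v⟩) (𝟙 ⦋1⦌)

theorem discOne_zero (r : ρ) (e : Fin ((word r).length + 1)) :
    discOne word r e (𝟙 _) (SimplexCategory.const ⦋1⦌ ⦋1⦌ 0) =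
      (presIncl word).f.app (op ⦋1⦌) (wordEdge (word r) e) := by
  have h : (wordMap (word r)).f.app (op ⦋1⦌) (gE (circleEnds (word r)) (op ⦋1⦌) ⟨e⟩ (𝟙 _)) =
      wordEdge (word r) e := by
    change (wedge S).X.map (𝟙 _) (wordEdge (word r) e) = _
    simp
  rw [← h]
  exact Quot.sound (Or.inl ⟨r, _, rfl, rfl⟩)

theorem discOne_one (r : ρ) (e : Fin ((word r).length + 1)) (f : Cbar (presentation word) A) :
    f.1 1 (discOne word r e (𝟙 _) (SimplexCategory.const ⦋1⦌ ⦋1⦌ 1)) = 0 := by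
  have h : discOne word r e (𝟙 _) (SimplexCategory.const ⦋1⦌ ⦋1⦌ 1) =
      (presentation word).X.map (SimplexCategory.const ⦋1⦌ ⦋0⦌ 0).op (presentation word).pt :=
    Quot.sound (Or.inr (Or.inl ⟨r, _, rfl, rfl⟩))
  rw [h]
  exact f.2.1 1 _ ⟨0, Nat.zero_lt_one, SimplexCategory.const ⦋1⦌ ⦋0⦌ 0, Set.mem_range_self _⟩

theorem discOne_const (r : ρ) (e : Fin ((word r).length + 1)) (k : Fin 2) :
    discOne word r e (SimplexCategory.const ⦋1⦌ ⦋1⦌ k) (𝟙 _) =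
      discRadial word r (circleEnds (word r) ⟨e⟩ k).down := by
  unfold discOne
  have h := gE_const (circleEnds (word r)) (op ⦋1⦌) ⟨e⟩ k
  exact congrArg (fun y => coneSimplex (fun r => wordMap (word r)) r y (𝟙 ⦋1⦌)) h

theorem disc_face (r : ρ) (e : Fin ((word r).length + 1)) (f : Cbar (presentation word) A) :
    (cD (presentation word) A f).1 2 (discLower word r e) -
      (cD (presentation word) A f).1 2 (discUpper word r e) =
    f.1 1 ((presIncl word).f.app (op ⦋1⦌) (wordEdge (word r) e)) +
      f.1 1 (discRadial word r (circleEnds (word r) ⟨e⟩ 1).down) -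
      f.1 1 (discRadial word r (circleEnds (word r) ⟨e⟩ 0).down) := by
  have hl : ∀ i, (presentation word).X.map (dl i 1).op (discLower word r e) =
      discOne word r e (dl i 1 ≫ SimplexCategory.σ 1 ≫ 𝟙 _) (dl i 1 ≫ SimplexCategory.σ 0) :=
    fun i => rfl
  have hu : ∀ i, (presentation word).X.map (dl i 1).op (discUpper word r e) =
      discOne word r e (dl i 1 ≫ SimplexCategory.σ 0 ≫ 𝟙 _) (dl i 1 ≫ SimplexCategory.σ 1) :=
    fun i => rfl
  have e00 : dl 0 1 ≫ SimplexCategory.σ (0 : Fin 2) = 𝟙 _ := by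
    apply hom_ext'; intro k; fin_cases k <;> rfl
  have e10 : dl 1 1 ≫ SimplexCategory.σ (0 : Fin 2) = 𝟙 _ := by
    apply hom_ext'; intro k; fin_cases k <;> rfl
  have e20 : dl 2 1 ≫ SimplexCategory.σ (0 : Fin 2) = SimplexCategory.const ⦋1⦌ ⦋1⦌ 0 := by
    apply hom_ext'; intro k; fin_cases k <;> rfl
  have e01 : dl 0 1 ≫ SimplexCategory.σ (1 : Fin 2) = SimplexCategory.const ⦋1⦌ ⦋1⦌ 1 := by
    apply hom_ext'; intro k; fin_cases k <;> rfl
  have e11 : dl 1 1 ≫ SimplexCategory.σ (1 : Fin 2) = 𝟙 _ := by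
    apply hom_ext'; intro k; fin_cases k <;> rfl
  have e21 : dl 2 1 ≫ SimplexCategory.σ (1 : Fin 2) = 𝟙 _ := by
    apply hom_ext'; intro k; fin_cases k <;> rfl
  change rawD f.1 2 _ - rawD f.1 2 _ = _
  rw [rawD_succ, rawD_succ]
  simp only [Finset.sum_range_succ, Finset.sum_range_zero, hl, hu, Category.comp_id, e00, e10, e20,
    e01, e11, e21, discOne_zero, discOne_one, discOne_const]
  ring

/-- Stokes' theorem for the disc: the boundary of the fundamental chain is the loop `word r`. -/
theorem disc_stokes (r : ρ) (f : Cbar (presentation word) A) :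
    evalChain (discChain word A r) (cD (presentation word) A f) =
      ∑ e : Fin ((word r).length + 1), sgn A (segSign (word r) e) *
        f.1 1 ((presIncl word).f.app (op ⦋1⦌) (wordEdge (word r) e)) := by
  rw [evalChain_discChain]
  let g : Fin ((word r).length + 1) → A := fun v => f.1 1 (discRadial word r v)
  have h : ∀ e : Fin ((word r).length + 1), sgn A (segSign (word r) e) *
      ((cD (presentation word) A f).1 2 (discLower word r e) -
        (cD (presentation word) A f).1 2 (discUpper word r e)) =
      sgn A (segSign (word r) e) *
        f.1 1 ((presIncl word).f.app (op ⦋1⦌) (wordEdge (word r) e)) + (g (e + 1) - g e) := by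
    intro e
    rw [disc_face]
    cases hs : segSign (word r) e
    · have h0 : (circleEnds (word r) ⟨e⟩ 0).down = e + 1 := by simp [circleEnds, hs]
      have h1 : (circleEnds (word r) ⟨e⟩ 1).down = e := by simp [circleEnds, hs]
      simp only [h0, h1, sgn, g]
      simp
      ring
    · have h0 : (circleEnds (word r) ⟨e⟩ 0).down = e := by simp [circleEnds, hs]
      have h1 : (circleEnds (word r) ⟨e⟩ 1).down = e + 1 := by simp [circleEnds, hs]
      simp only [h0, h1, sgn, g]
      simp
      ring
  rw [Finset.sum_congr rfl fun e _ => h e, Finset.sum_add_distrib, Finset.sum_sub_distrib]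
  have : ∑ e, g (e + 1) = ∑ e, g e := Equiv.sum_comp (Equiv.addRight 1) g
  rw [this, sub_self, add_zero]

/-- The evaluation of a class in `H^2(X_{S|R},X_S;A)` on the relative class of the disc `D²(r)`. -/
def discEval (r : ρ) : H2Rel A (presIncl word) →ₗ[A] A :=
  Submodule.liftQ _ (evalChain (discChain word A r) ∘ₗ Submodule.subtype _) (by
    rintro ⟨x, hx⟩ hx'
    obtain ⟨f, ⟨_, hf⟩, hfx⟩ := hx'
    change cD (presentation word) A f = x at hfx
    subst hfx
    have hf' : pull A (presIncl word) f = 0 := hf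
    change evalChain (discChain word A r) (cD (presentation word) A f) = 0
    rw [disc_stokes]
    refine Finset.sum_eq_zero fun e _ => ?_
    have : f.1 1 ((presIncl word).f.app (op ⦋1⦌) (wordEdge (word r) e)) = 0 :=
      congrFun (congrFun (congrArg Subtype.val hf') 1) (wordEdge (word r) e)
    rw [this, mul_zero])

end Presentation

end

end LetterBraiding

open LetterBraiding

universe u v

/-! The letter-braiding number and the value of the Massey product on a disc are both identified
with the same coefficient of the Magnus expansion, by means of parallel transport on the bar
construction.

A 1-simplex `x` acts on tensors by `transport`, that is 1 plus the contraction of the first letter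
with the value on `x`. This is invertible because contraction shortens words. It carries the bar
differential augmented at the initial vertex of `x` to the one augmented at the terminal vertex
(`transport_barD`). A 2-simplex gives a homotopy, again a contraction, between the transport along
its long edge and the composite along the two short edges (`triangle_barD`). Both facts restate the
formulas for coboundaries and cup products on simplices of dimension 1 and 2. Since the bar
differential has no component of weight zero, the weight zero part of the holonomy around a based
loop vanishes on coboundaries.

On the circle of a word `w`, consider the weight zero part of the holonomy minus the weight zero
part of the tensor itself. On polynomials in the generator only the standard segment acts
nontrivially, and the functional reads off the coefficient of `t`. On a tensor `T` pulled back from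
the wedge the standard segment acts trivially, and the other transports multiply to the image of `w`
under the Magnus representation of the free group. Hence the letter-braiding number is `magnusCoeff`
of the group element of `w` (`braidingNumber_eq_magnusCoeff`). That the pullback of `T` is
represented by a polynomial at all is `exists_collapseClass_eq`.

In the presentation complex let `y` lift `T` with bar differential minus a single 2-cochain `κ`.
Sweeping around the disc sector by sector, each triangle homotopy contributes a value of `κ`, and
the sum says that the boundary holonomy of `y` computes the evaluation of `κ` on the disc
(`algebraMapInv_disc_holonomy`). By naturality this holonomy only sees `T` on the boundary word, so
the evaluation is the Magnus coefficient of the relation.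

The case `T = 0` of the disc computation gives the injectivity of the weight one map, once a
relative class is known to be determined by its values on discs. The latter is a hands-on cellular
computation with the two triangles over each segment (`exists_cD_eq`, `exists_evalChain_eq`). -/

namespace LetterBraiding

noncomputable section

/-! ### Contraction, transport and holonomy on tensors. -/

section Holonomy

open TensorAlgebra

variable {A : Type v} [CommRing A] {M N : Type*} [AddCommGroup M] [Module A M]
  [AddCommGroup N] [Module A N]

/-- One step of the recursion for operators `f` on tensors with
`f (c|y) = α c|y + x c • (β y + γ f y)`. -/
def contractStep (x : M →ₗ[A] A) (α β γ : A) :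
    M →ₗ[A] Module.End A (TensorAlgebra A M × TensorAlgebra A M) :=
  LinearMap.mk₂ A
    (fun c p => (ι A c * p.1, α • (ι A c * p.1) + x c • (β • p.1 + γ • p.2)))
    (by intro c c' p
        refine Prod.ext (by simp [add_mul]) ?_
        simp only [map_add, add_mul, Prod.snd_add, smul_add, add_smul]; abel)
    (by intro r c p
        refine Prod.ext (by simp) ?_
        simp only [map_smul, smul_mul_assoc, Prod.smul_snd, smul_add, smul_smul, smul_eq_mul,
          mul_comm α r, mul_assoc])
    (by intro c p p'
        refine Prod.ext (by simp [mul_add]) ?_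
        simp only [Prod.snd_add, Prod.fst_add, mul_add, smul_add]; abel)
    (by intro r c p
        refine Prod.ext (by simp) ?_
        simp only [Prod.smul_fst, Prod.smul_snd, mul_smul_comm]
        module)

theorem contractStep_apply (x : M →ₗ[A] A) (α β γ : A) (c : M)
    (p : TensorAlgebra A M × TensorAlgebra A M) : contractStep x α β γ c p =
      (ι A c * p.1, α • (ι A c * p.1) + x c • (β • p.1 + γ • p.2)) := rfl

/-- The operator `f` with `f 1 = δ` and `f (c|y) = α c|y + x c • (β y + γ f y)`. -/
def contractRec (x : M →ₗ[A] A) (α β γ δ : A) : Module.End A (TensorAlgebra A M) :=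
  LinearMap.snd A _ _ ∘ₗ LinearMap.applyₗ ((1 : TensorAlgebra A M), algebraMap A _ δ) ∘ₗ
    (lift A (contractStep x α β γ)).toLinearMap

theorem contractRec_one (x : M →ₗ[A] A) (α β γ δ : A) :
    contractRec x α β γ δ 1 = algebraMap A _ δ := by
  simp [contractRec]

theorem contractRec_cons (x : M →ₗ[A] A) (α β γ δ : A) (c : M) (y : TensorAlgebra A M) :
    contractRec x α β γ δ (ι A c * y) =
      α • (ι A c * y) + x c • (β • y + γ • contractRec x α β γ δ y) := by
  -- The first component of the state always carries the tensor itself. This is what makes the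
  -- undifferentiated tail `y` available at each step of the recursion.
  have h1 : ∀ y, ((lift A (contractStep x α β γ)) y (1, algebraMap A _ δ)).1 = y := fun y => by
    have := cons_induction (P := LinearMap.eqLocus
      (LinearMap.fst A _ _ ∘ₗ LinearMap.applyₗ ((1 : TensorAlgebra A M), algebraMap A _ δ) ∘ₗ
        (lift A (contractStep x α β γ)).toLinearMap) LinearMap.id) (by simp)
      (fun c x hx => by
        simp only [LinearMap.mem_eqLocus, LinearMap.comp_apply, LinearMap.fst_apply,
          LinearMap.id_apply, AlgHom.toLinearMap_apply, LinearMap.applyₗ_apply_apply] at hx ⊢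
        simp [contractStep_apply, hx]) y
    simpa using this
  simp [contractRec, contractStep_apply, h1]

/-- Contraction of the first letter with a functional: `c|y ↦ x c • y` and `1 ↦ 0`. -/
def contract (x : M →ₗ[A] A) : Module.End A (TensorAlgebra A M) := contractRec x 0 1 0 0

@[simp]
theorem contract_one (x : M →ₗ[A] A) : contract x 1 = 0 := by simp [contract, contractRec_one]

@[simp]
theorem contract_cons (x : M →ₗ[A] A) (c : M) (y : TensorAlgebra A M) :
    contract x (ι A c * y) = x c • y := by simp [contract, contractRec_cons]

@[simp]
theorem contract_ι (x : M →ₗ[A] A) (c : M) : contract x (ι A c) = algebraMap A _ (x c) := by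
  have := contract_cons x c 1
  rwa [mul_one, ← Algebra.algebraMap_eq_smul_one] at this

/-- Operators on tensors agree if they agree on `1` and on tensors with a first letter. -/
theorem end_ext {P : Type*} [AddCommGroup P] [Module A P] {f g : TensorAlgebra A M →ₗ[A] P}
    (h1 : f 1 = g 1) (hc : ∀ c y, f y = g y → f (ι A c * y) = g (ι A c * y)) : f = g :=
  LinearMap.ext fun y => cons_induction (P := LinearMap.eqLocus f g) h1 hc y

@[simp]
theorem contract_zero : contract (0 : M →ₗ[A] A) = 0 := end_ext (by simp) fun c y _ => by simp

theorem contract_tmap (f : M →ₗ[A] N) (x : N →ₗ[A] A) (y : TensorAlgebra A M) :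
    contract x (tmap f y) = tmap f (contract (x ∘ₗ f) y) := by
  have : contract x ∘ₗ (tmap f).toLinearMap = (tmap f).toLinearMap ∘ₗ contract (x ∘ₗ f) :=
    end_ext (by simp) fun c y _ => by simp
  exact LinearMap.congr_fun this y

/-- The parallel transport `1 + contract x` along an edge on which cochains take the value `x`. -/
def transport (x : M →ₗ[A] A) : (Module.End A (TensorAlgebra A M))ˣ where
  val := 1 + contract x
  -- The geometric series of `-contract x`, which is finite on each word. With these parameters the
  -- recursion is `f 1 = 1` and `f (c|y) = c|y - x c • f y`.
  inv := contractRec x 1 0 (-1) 1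
  val_inv := end_ext (by simp [contractRec_one]) fun c y h => by
    simp only [Module.End.mul_apply, Module.End.one_apply, LinearMap.add_apply] at h ⊢
    simp only [contractRec_cons, map_add, map_smul, contract_cons, zero_smul, zero_add, one_smul,
      neg_one_smul, map_neg, smul_neg]
    have h' := congrArg (x c • ·) h
    simp only [smul_add] at h'
    rw [← h']
    abel
  inv_val := end_ext (by simp [contractRec_one]) fun c y h => by
    simp only [Module.End.mul_apply, Module.End.one_apply, LinearMap.add_apply] at h ⊢
    simp [contractRec_cons]

theorem transport_val (x : M →ₗ[A] A) :
    (transport x : Module.End A (TensorAlgebra A M)) = 1 + contract x := rfl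

@[simp]
theorem transport_zero : transport (0 : M →ₗ[A] A) = 1 := Units.ext (by simp [transport_val])

theorem transport_tmap (f : M →ₗ[A] N) (x : N →ₗ[A] A) (y : TensorAlgebra A M) :
    (transport x).1 (tmap f y) = tmap f ((transport (x ∘ₗ f)).1 y) := by
  simp [transport_val, contract_tmap]

/-- Obtained from `transport_tmap` by cancelling the transports on both sides. -/
theorem transport_inv_tmap (f : M →ₗ[A] N) (x : N →ₗ[A] A) (y : TensorAlgebra A M) :
    (transport x)⁻¹.1 (tmap f y) = tmap f ((transport (x ∘ₗ f))⁻¹.1 y) := by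
  have h : ∀ z, (transport x)⁻¹.1 ((transport x).1 z) = z := fun z =>
    LinearMap.congr_fun (transport x).inv_mul z
  have h' : ∀ z, (transport (x ∘ₗ f)).1 ((transport (x ∘ₗ f))⁻¹.1 z) = z := fun z =>
    LinearMap.congr_fun (transport (x ∘ₗ f)).mul_inv z
  rw [← h (tmap f ((transport (x ∘ₗ f))⁻¹.1 y)), transport_tmap, h']

/-- The transport along an edge that is traversed forwards or backwards. -/
def signedTransport (b : Bool) (x : M →ₗ[A] A) : (Module.End A (TensorAlgebra A M))ˣ :=
  cond b (transport x) (transport x)⁻¹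

theorem signedTransport_tmap (b : Bool) (f : M →ₗ[A] N) (x : N →ₗ[A] A) (y : TensorAlgebra A M) :
    (signedTransport b x).1 (tmap f y) = tmap f ((signedTransport b (x ∘ₗ f)).1 y) := by
  cases b
  · exact transport_inv_tmap f x y
  · exact transport_tmap f x y

@[simp]
theorem signedTransport_zero (b : Bool) : signedTransport b (0 : M →ₗ[A] A) = 1 := by
  cases b <;> simp [signedTransport]

/-- The product of transports along a path; the first edge of the path acts first. -/
def holonomy (n : ℕ) (b : Fin n → Bool) (x : Fin n → (M →ₗ[A] A)) :
    (Module.End A (TensorAlgebra A M))ˣ :=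
  match n with
  | 0 => 1
  | n + 1 => signedTransport (b (Fin.last n)) (x (Fin.last n)) *
      holonomy n (fun i => b i.castSucc) (fun i => x i.castSucc)

theorem holonomy_succ {n : ℕ} (b : Fin (n + 1) → Bool) (x : Fin (n + 1) → (M →ₗ[A] A)) :
    holonomy (n + 1) b x = signedTransport (b (Fin.last n)) (x (Fin.last n)) *
      holonomy n (fun i => b i.castSucc) (fun i => x i.castSucc) := rfl

/-- Induction along a path. -/
theorem holonomy_induction {n : ℕ} (b : Fin n → Bool) (x : Fin n → (M →ₗ[A] A))
    {C : Fin (n + 1) → Module.End A (TensorAlgebra A M) → Prop} (h0 : C 0 1)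
    (hs : ∀ (i : Fin n) g, C i.castSucc g → C i.succ ((signedTransport (b i) (x i)).1 * g)) :
    C (Fin.last n) (holonomy n b x).1 := by
  induction n with
  | zero => exact h0
  | succ n ih =>
    exact hs (Fin.last n) _ (ih (fun i => b i.castSucc) (fun i => x i.castSucc)
      (C := fun i => C i.castSucc) h0 fun i g => hs i.castSucc g)

/-- Naturality: holonomy along the image of a path is holonomy along the path of pulled-back
cochains. It moves computations between the circle, the wedge and the presentation complex, and down
to tensors on plain functions. -/
theorem holonomy_tmap {n : ℕ} (b : Fin n → Bool) (f : M →ₗ[A] N) (x : Fin n → (N →ₗ[A] A))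
    (y : TensorAlgebra A M) :
    (holonomy n b x).1 (tmap f y) = tmap f ((holonomy n b fun i => x i ∘ₗ f).1 y) := by
  induction n with
  | zero => rfl
  | succ n ih =>
    change (signedTransport _ _).1 ((holonomy _ _ _).1 _) = _
    rw [ih, signedTransport_tmap]
    rfl

/-- The recursion for `holonomy` splits off the last edge, whereas words and circles are built by
prepending. This lemma splits off the first edge, which acts first and so stands on the right. -/
theorem holonomy_cons {n : ℕ} (b : Fin n → Bool) (x : Fin n → (M →ₗ[A] A)) (b₀ : Bool)
    (x₀ : M →ₗ[A] A) : holonomy (n + 1) (Fin.cons b₀ b : Fin (n + 1) → Bool) (Fin.cons x₀ x) =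
      holonomy n b x * signedTransport b₀ x₀ := by
  induction n with
  | zero => simp [holonomy]
  | succ n ih =>
    rw [holonomy_succ, holonomy_succ b x, mul_assoc, ← ih]
    congr 2
    · funext i; refine Fin.cases ?_ (fun i => ?_) i <;> simp
    · funext i; refine Fin.cases ?_ (fun i => ?_) i <;> simp

/-- The Magnus representation of the free group by transports of tensors on `A^S`. -/
def magnus (A : Type v) [CommRing A] (S : Type u) :
    FreeGroup S →* (Module.End A (TensorAlgebra A (S → A)))ˣᵐᵒᵖ :=
  -- The first letter of a word acts first, so operators compose in the order opposite to
  -- concatenation.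
  FreeGroup.lift fun s => MulOpposite.op (transport (LinearMap.proj s))

/-- The holonomy of a word depends only on its class in the free group. -/
theorem holonomy_word (A : Type v) [CommRing A] {S : Type u} (w : List (S × Bool)) :
    holonomy w.length (fun i => (w.get i).2) (fun i => LinearMap.proj (R := A) (φ := fun _ => A) (w.get i).1) =
      (magnus A S (FreeGroup.mk w)).unop := by
  induction w with
  | nil => simp [holonomy, ← FreeGroup.one_eq_mk]
  | cons a w ih =>
    have h := holonomy_cons (fun i => (w.get i).2)
      (fun i => LinearMap.proj (R := A) (φ := fun _ => A) (w.get i).1) a.2 (LinearMap.proj a.1)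
    rw [ih] at h
    have hm : FreeGroup.mk (a :: w) = FreeGroup.mk [a] * FreeGroup.mk w := by
      simp [FreeGroup.mul_mk]
    rw [hm, map_mul, MulOpposite.unop_mul]
    have h1 : (magnus A S (FreeGroup.mk [a])).unop = signedTransport a.2 (LinearMap.proj a.1) := by
      rcases a with ⟨s, _ | _⟩ <;> simp [magnus, signedTransport, FreeGroup.lift_mk]
    rw [h1, ← h]
    congr 1
    · funext i; refine Fin.cases ?_ (fun i => ?_) i <;> rfl
    · funext i; refine Fin.cases ?_ (fun i => ?_) i <;> rfl

/-! ### Transport and the bar differential -/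

variable {d s : M →ₗ[A] M} {m : M →ₗ[A] M →ₗ[A] M}

/-- The weight zero part of a tensor is not affected by a map of letters. -/
theorem algebraMapInv_tmap (f : M →ₗ[A] N) (y : TensorAlgebra A M) :
    algebraMapInv (tmap f y) = algebraMapInv y := by
  have : (algebraMapInv (R := A) (M := N)).comp (tmap f) = algebraMapInv := by
    ext c; simp [algebraMapInv]
  exact DFunLike.congr_fun this y

theorem algebraMapInv_cons (c : M) (y : TensorAlgebra A M) : algebraMapInv (ι A c * y) = 0 := by
  simp [algebraMapInv]

/-- The bar differential has no component of weight zero. -/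
theorem algebraMapInv_barD (y : TensorAlgebra A M) : algebraMapInv (barD d s m y) = 0 := by
  have hm : ∀ a y, algebraMapInv (barMerge d s m y a) = 0 := fun a y => by
    have : algebraMapInv.toLinearMap ∘ₗ (barMerge d s m).flip a = 0 :=
      end_ext (by simp) fun c y _ => by
        simp [barMerge_cons, algebraMapInv_cons, -map_mul]
    exact LinearMap.congr_fun this y
  have : algebraMapInv.toLinearMap ∘ₗ barD d s m = 0 :=
    end_ext (by simp) fun c y _ => by
      simp [barD_cons, algebraMapInv_cons, hm, -map_mul]
  exact LinearMap.congr_fun this y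

/-- The hypothesis is the cup product formula on an edge `x` with endpoints `a` and `b`: one factor
is evaluated on the edge and the other at the adjacent vertex. -/
theorem contract_merge {x a b : M →ₗ[A] A} {u : M}
    (hm : ∀ c, x (m u c) = a u * x c + x u * b c) (y : TensorAlgebra A M) :
    contract x (barMerge d s m y u) = a u • contract x y + x u • contract b y := by
  have : contract x ∘ₗ (barMerge d s m).flip u = a u • contract x + x u • contract b :=
    end_ext (by simp) fun c y _ => by
      simp [barMerge_cons, hm, add_smul, mul_smul]
  exact LinearMap.congr_fun this y

/-- Transport along an edge from `a` to `b` intertwines the bar differentials augmented at the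
endpoints. -/
theorem transport_barD {x a b : M →ₗ[A] A} (hd : ∀ c, x (d c) = b c - a c)
    (hs : ∀ c, x (s c) = x c) (ha : ∀ c, a (s c) = -a c)
    (hm : ∀ c c', x (m c c') = a c * x c' + x c * b c') :
    (transport x).1 * (barD d s m - contract a) = (barD d s m - contract b) * (transport x).1 := by
  -- On `c|y` the letter `dc` contributes the difference of the endpoint values by `hd`, and the
  -- merge term splits by `hm`. Those contributions are matched by the two augmentation terms.
  refine end_ext (by simp [transport_val]) fun c y _ => ?_
  simp only [transport_val, Module.End.mul_apply, LinearMap.sub_apply, LinearMap.add_apply,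
    Module.End.one_apply, map_sub, map_add, barD_cons, contract_cons, map_neg, map_smul,
    contract_merge (hm _), hd, hs, ha, neg_smul, sub_smul, smul_sub, smul_add]
  abel

/-- The relation `transport_barD` multiplied by the inverse on both sides. It is needed for edges
traversed backwards. -/
theorem transport_inv_barD {x a b : M →ₗ[A] A} (hd : ∀ c, x (d c) = b c - a c)
    (hs : ∀ c, x (s c) = x c) (ha : ∀ c, a (s c) = -a c)
    (hm : ∀ c c', x (m c c') = a c * x c' + x c * b c') :
    (transport x)⁻¹.1 * (barD d s m - contract b) =
      (barD d s m - contract a) * (transport x)⁻¹.1 := by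
  have h := transport_barD (d := d) (s := s) (m := m) hd hs ha hm
  calc _ = (transport x)⁻¹.1 * (barD d s m - contract b) *
        ((transport x).1 * (transport x)⁻¹.1) := by rw [Units.mul_inv, mul_one]
    _ = (transport x)⁻¹.1 * ((barD d s m - contract b) * (transport x).1) * (transport x)⁻¹.1 := by
      simp only [mul_assoc]
    _ = _ := by
      rw [← h, ← mul_assoc, Units.inv_mul, one_mul]

/-- The two ways around a triangle differ by a homotopy. -/
theorem triangle_barD {z x₀₁ x₁₂ x₀₂ a b : M →ₗ[A] A}
    (hd : ∀ c, z (d c) = x₁₂ c - x₀₂ c + x₀₁ c) (hs : ∀ c, z (s c) = -z c)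
    (hx : ∀ c, x₀₁ (s c) = x₀₁ c) (ha : ∀ c, a (s c) = -a c)
    (hm : ∀ c c', z (m c c') = a c * z c' + x₀₁ c * x₁₂ c' + z c * b c') :
    contract z * (barD d s m - contract a) + (barD d s m - contract b) * contract z =
      (transport x₀₂).1 - (transport x₁₂).1 * (transport x₀₁).1 := by
  -- The middle term, front edge times back edge in the cup product on a triangle, is the source of
  -- the composite of two contractions, hence of the composite transport.
  have hmer : ∀ u y, contract z (barMerge d s m y u) =
      a u • contract z y + x₀₁ u • contract x₁₂ y + z u • contract b y := fun u y => by
    have : contract z ∘ₗ (barMerge d s m).flip u =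
        a u • contract z + x₀₁ u • contract x₁₂ + z u • contract b :=
      end_ext (by simp) fun c y _ => by
        simp [barMerge_cons, hm, add_smul, mul_smul]
    exact LinearMap.congr_fun this y
  refine end_ext (by simp [transport_val]) fun c y _ => ?_
  simp only [transport_val, Module.End.mul_apply, LinearMap.sub_apply, LinearMap.add_apply,
    Module.End.one_apply, map_sub, map_add, barD_cons, contract_cons, map_neg, map_smul,
    hmer, hd, hs, ha, hx, neg_smul, sub_smul, add_smul, smul_sub, smul_add]
  abel

end Holonomy

end

end LetterBraiding

namespace LetterBraiding

noncomputable section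

/-! ### Evaluation of cochains on simplices of dimension at most two. -/

section Evaluation

variable {A : Type v} [CommRing A] {X Y : PSSet.{u}}

/-- Evaluation of cochains on a simplex. -/
def ev (A : Type v) [CommRing A] {n : ℕ} (x : X.X _⦋n⦌) : Cbar X A →ₗ[A] A where
  toFun f := f.1 n x
  map_add' _ _ := rfl
  map_smul' _ _ := rfl

theorem ev_apply {n : ℕ} (x : X.X _⦋n⦌) (f : Cbar X A) : ev A x f = f.1 n x := rfl

theorem ev_pull {n : ℕ} (φ : PHom X Y) (x : X.X _⦋n⦌) :
    ev A x ∘ₗ pull A φ = ev A (φ.f.app _ x) := rfl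

theorem ev_pt : ev A X.pt = 0 := LinearMap.ext fun f => f.2.2.1

theorem ev_degenerate {n : ℕ} {x : X.X _⦋n⦌} (hx : x ∈ X.X.degenerate n) : ev A x = 0 :=
  LinearMap.ext fun f => f.2.1 n x hx

theorem ev_cS {n : ℕ} (x : X.X _⦋n⦌) (f : Cbar X A) :
    ev A x (cS X A f) = (-1) ^ (n + 1) * ev A x f := rfl

/-- The `i`-th vertex of a simplex. -/
def vertex {n : ℕ} (x : X.X _⦋n⦌) (i : Fin (n + 1)) : X.X _⦋0⦌ :=
  X.X.map (SimplexCategory.const ⦋0⦌ ⦋n⦌ i).op x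

theorem ev_cD_one (x : X.X _⦋1⦌) (f : Cbar X A) :
    ev A x (cD X A f) = ev A (vertex x 1) f - ev A (vertex x 0) f := by
  have h0 : dl 0 0 = SimplexCategory.const ⦋0⦌ ⦋1⦌ 1 := by
    apply hom_ext'; intro k; fin_cases k; rfl
  have h1 : dl 1 0 = SimplexCategory.const ⦋0⦌ ⦋1⦌ 0 := by
    apply hom_ext'; intro k; fin_cases k; rfl
  change rawD f.1 1 x = _
  rw [rawD_succ]
  simp only [Finset.sum_range_succ, Finset.sum_range_zero, h0, h1, vertex, ev_apply]
  ring

theorem ev_cD_two (x : X.X _⦋2⦌) (f : Cbar X A) :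
    ev A x (cD X A f) = ev A (X.X.map (dl 0 1).op x) f - ev A (X.X.map (dl 1 1).op x) f +
      ev A (X.X.map (dl 2 1).op x) f := by
  change rawD f.1 2 x = _
  rw [rawD_succ]
  simp only [Finset.sum_range_succ, Finset.sum_range_zero, ev_apply]
  ring

theorem ev_cM_one (x : X.X _⦋1⦌) (f g : Cbar X A) :
    ev A x (cM X A f g) =
      ev A (vertex x 0) f * ev A x g + ev A x f * ev A (vertex x 1) g := by
  have h00 : seg 0 0 1 = SimplexCategory.const ⦋0⦌ ⦋1⦌ 0 := by
    apply hom_ext'; intro k; fin_cases k; rfl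
  have h01 : seg 0 1 1 = 𝟙 _ := by apply hom_ext'; intro k; fin_cases k <;> rfl
  have h10 : seg 1 0 1 = SimplexCategory.const ⦋0⦌ ⦋1⦌ 1 := by
    apply hom_ext'; intro k; fin_cases k; rfl
  change rawCup f.1 g.1 1 x = _
  simp [rawCup, Finset.Nat.antidiagonal_succ, h00, h01, h10, vertex, ev_apply]

theorem ev_cM_two (x : X.X _⦋2⦌) (f g : Cbar X A) :
    ev A x (cM X A f g) =
      ev A (vertex x 0) f * ev A x g +
        ev A (X.X.map (dl 2 1).op x) f * ev A (X.X.map (dl 0 1).op x) g +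
        ev A x f * ev A (vertex x 2) g := by
  have h00 : seg 0 0 2 = SimplexCategory.const ⦋0⦌ ⦋2⦌ 0 := by
    apply hom_ext'; intro k; fin_cases k; rfl
  have h02 : seg 0 2 2 = 𝟙 _ := by apply hom_ext'; intro k; fin_cases k <;> rfl
  have h01 : seg 0 1 2 = dl 2 1 := by apply hom_ext'; intro k; fin_cases k <;> rfl
  have h11 : seg 1 1 2 = dl 0 1 := by apply hom_ext'; intro k; fin_cases k <;> rfl
  have h20 : seg 2 0 2 = SimplexCategory.const ⦋0⦌ ⦋2⦌ 2 := by
    apply hom_ext'; intro k; fin_cases k; rfl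
  change rawCup f.1 g.1 2 x = _
  simp [rawCup, Finset.Nat.antidiagonal_succ, h00, h01, h02, h11, h20, vertex, ev_apply, add_assoc]

/-- Transport along an edge intertwines the bar differentials augmented at its endpoints. -/
theorem transport_ev_barDiff (x : X.X _⦋1⦌) :
    (transport (ev A x)).1 * (barDiff X A - contract (ev A (vertex x 0))) =
      (barDiff X A - contract (ev A (vertex x 1))) * (transport (ev A x)).1 :=
  transport_barD (ev_cD_one x) (fun f => by rw [ev_cS]; ring) (fun f => by rw [ev_cS]; ring)
    (ev_cM_one x)

theorem transport_inv_ev_barDiff (x : X.X _⦋1⦌) :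
    (transport (ev A x))⁻¹.1 * (barDiff X A - contract (ev A (vertex x 1))) =
      (barDiff X A - contract (ev A (vertex x 0))) * (transport (ev A x))⁻¹.1 :=
  transport_inv_barD (ev_cD_one x) (fun f => by rw [ev_cS]; ring) (fun f => by rw [ev_cS]; ring)
    (ev_cM_one x)

/-- The homotopy between the two ways around a triangle. -/
theorem triangle_ev_barDiff (x : X.X _⦋2⦌) :
    contract (ev A x) * (barDiff X A - contract (ev A (vertex x 0))) +
        (barDiff X A - contract (ev A (vertex x 2))) * contract (ev A x) =
      (transport (ev A (X.X.map (dl 1 1).op x))).1 -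
        (transport (ev A (X.X.map (dl 0 1).op x))).1 *
          (transport (ev A (X.X.map (dl 2 1).op x))).1 :=
  triangle_barD (ev_cD_two x) (fun f => by rw [ev_cS]; ring) (fun f => by rw [ev_cS]; ring)
    (fun f => by rw [ev_cS]; ring) (ev_cM_two x)

end Evaluation

/-! ### Discrete primitives on a cycle. -/

section CyclicSums

theorem sum_lt_succ {A : Type*} [AddCommGroup A] {n : ℕ} (h : Fin n → A) (e : Fin n) :
    ∑ j : Fin n with j.1 < e.1 + 1, h j = h e + ∑ j : Fin n with j.1 < e.1, h j := by
  have : (Finset.univ.filter fun j : Fin n => j.1 < e.1 + 1) =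
      insert e (Finset.univ.filter fun j : Fin n => j.1 < e.1) := by
    ext j
    simp only [Finset.mem_filter, Finset.mem_univ, true_and, Finset.mem_insert, Fin.ext_iff]
    omega
  rw [this, Finset.sum_insert (by simp)]

/-- A function on a cycle with sum zero is a difference. -/
theorem exists_cyclic_difference {A : Type*} [AddCommGroup A] {n : ℕ} (h : Fin (n + 1) → A)
    (hs : ∑ e, h e = 0) : ∃ g : Fin (n + 1) → A, g 0 = 0 ∧ ∀ e, g (e + 1) - g e = h e := by
  -- The primitive is given by partial sums, indexed by natural numbers so that both 0 and `n + 1`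
  -- are allowed. Total sum zero makes the values there agree, which is the wrap-around case at the
  -- last index.
  let G : ℕ → A := fun k => ∑ j : Fin (n + 1) with j.1 < k, h j
  have hG : ∀ e : Fin (n + 1), G (e.1 + 1) - G e.1 = h e := by
    intro e
    simp only [G]
    rw [sum_lt_succ, add_sub_cancel_right]
  have h0 : G 0 = 0 := by simp [G]
  have hn : G (n + 1) = 0 := by
    simp only [G, Fin.is_lt, Finset.filter_true]
    exact hs
  refine ⟨fun e => G e.1, h0, fun e => ?_⟩
  rw [← hG e]
  congr 1
  rcases eq_or_ne e (Fin.last n) with rfl | he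
  · simp only [Fin.last_add_one, Fin.val_last, Fin.val_zero, h0, hn]
  · dsimp only
    rw [Fin.val_add_one_of_lt (lt_of_le_of_ne (Fin.le_last e) he)]

end CyclicSums

/-! ### Cochains of graphs and normal forms of bar classes on them. -/

section GraphCochains

variable {A : Type v} [CommRing A] {V E : Type u} {ends : E → Fin 2 → V} {v₀ : V}

/-- The `1`-simplex of an edge, in the pointed graph. -/
def pedge (ends : E → Fin 2 → V) (v₀ : V) (e : E) : (pgraph ends v₀).X _⦋1⦌ := edge ends e

theorem vertex_pedge (e : E) (i : Fin 2) :
    vertex (pedge ends v₀ e) i = gV ends _ (ends e i) :=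
  gE_const ends (op ⦋0⦌) e i

theorem hom_one_cases (φ : ⦋1⦌ ⟶ ⦋1⦌) : φ = 𝟙 _ ∨ ∃ i, φ = SimplexCategory.const ⦋1⦌ ⦋1⦌ i := by
  have hm : φ.toOrderHom 0 ≤ φ.toOrderHom 1 := φ.toOrderHom.monotone (by decide)
  have h2 : ∀ i j : Fin 2, i ≤ j → (i = 0 ∧ j = 1) ∨ i = j := by decide
  rcases h2 _ _ hm with ⟨h0, h1⟩ | h
  · refine Or.inl (hom_ext' fun k => ?_)
    have : k = 0 ∨ k = 1 := by change Fin 2 at k; fin_cases k <;> simp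
    rcases this with rfl | rfl
    · exact congrArg Fin.val h0
    · exact congrArg Fin.val h1
  · refine Or.inr ⟨φ.toOrderHom 0, hom_ext' fun k => ?_⟩
    have : k = 0 ∨ k = 1 := by change Fin 2 at k; fin_cases k <;> simp
    rcases this with rfl | rfl
    · rfl
    · exact congrArg Fin.val h.symm

theorem gV_degenerate {n : ℕ} (hn : 0 < n) (v : V) :
    gV ends (op ⦋n⦌) v ∈ (graph ends).degenerate n :=
  ⟨0, hn, SimplexCategory.const _ _ 0, gV ends _ v, rfl⟩

/-- A `1`-cochain of a graph is determined by its values on the edges. -/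
theorem cochain_one_ext {f g : Cbar (pgraph ends v₀) A} (hf : f ∈ Cdeg (pgraph ends v₀) A 1)
    (hg : g ∈ Cdeg (pgraph ends v₀) A 1)
    (h : ∀ e, ev A (pedge ends v₀ e) f =
      ev A (pedge ends v₀ e) g) : f = g := by
  apply Subtype.ext; funext k x
  by_cases hk : k = 1
  · subst hk
    induction x using Quot.ind with
    | mk x =>
      have hV : ∀ v, f.1 1 (gV ends _ v) = g.1 1 (gV ends _ v) := fun v => by
        rw [f.2.1 _ _ (gV_degenerate one_pos v), g.2.1 _ _ (gV_degenerate one_pos v)]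
      rcases x with v | ⟨e, φ⟩
      · exact hV v
      · rcases hom_one_cases φ with rfl | ⟨i, rfl⟩
        · exact h e
        · have := gE_const ends (op ⦋1⦌) e i
          change f.1 1 (gE ends (op ⦋1⦌) e (SimplexCategory.const ⦋1⦌ ⦋1⦌ i)) =
            g.1 1 (gE ends (op ⦋1⦌) e (SimplexCategory.const ⦋1⦌ ⦋1⦌ i))
          rw [this]
          exact hV _
  · rw [hf k hk, hg k hk]

/-- The `0`-cochain of a graph with prescribed values on the vertices. -/
def vertexCochain (g : V → A) (hg : g v₀ = 0) : Cbar (pgraph ends v₀) A :=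
  ⟨fun n => match n with
    | 0 => Quot.lift (Sum.elim g fun p => g (ends p.1 (p.2.toOrderHom 0)))
        (by rintro _ _ ⟨e, i⟩; rfl)
    | _ + 1 => 0, by
    refine ⟨?_, hg, 1, ?_⟩
    · intro n x hx
      match n with
      | 0 => simp at hx
      | n + 1 => rfl
    · intro n hn
      match n, hn with
      | n + 1, _ => rfl⟩

theorem vertexCochain_mem (g : V → A) (hg : g v₀ = 0) :
    vertexCochain (ends := ends) g hg ∈ Cdeg (pgraph ends v₀) A 0 := by
  intro k hk
  match k, hk with
  | k + 1, _ => rfl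

theorem ev_cD_vertexCochain (g : V → A) (hg : g v₀ = 0) (e : E) :
    ev A (pedge ends v₀ e) (cD _ A (vertexCochain (ends := ends) g hg)) =
      g (ends e 1) - g (ends e 0) := by
  rw [ev_cD_one, vertex_pedge, vertex_pedge]
  rfl

open TensorAlgebra

/-- The bar differential of `τ|…|τ|f|p`, for a `0`-cochain `f` and `1`-cochains `τ`, `p`. -/
theorem barDiff_pow_mul {τ f : Cbar (pgraph ends v₀) A} (hτ : τ ∈ Cdeg (pgraph ends v₀) A 1)
    (p : Bar (pgraph ends v₀) A) (k : ℕ) :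
    barDiff (pgraph ends v₀) A (ι A τ ^ (k + 1) * (ι A f * p)) =
      ι A τ ^ (k + 1) * barDiff (pgraph ends v₀) A (ι A f * p) -
        ι A τ ^ k * (ι A (cM _ A τ f) * p) := by
  have hd : cD _ A τ = 0 := graph_cochain_eq_zero v₀ le_rfl _ (cD_mem_Cdeg 1 _ hτ)
  have hs : cS _ A τ = τ := by
    apply Subtype.ext; funext n x
    by_cases hn : n = 1
    · subst hn; simp [cS, rawSign]
    · simp [cS, rawSign, hτ n hn]
  have hm : cM _ A τ τ = 0 := graph_cochain_eq_zero v₀ le_rfl _ (cM_mem_Cdeg 1 1 _ hτ _ hτ)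
  induction k with
  | zero => simp [barD_cons, barMerge_cons, hd, hs]
  | succ k ih =>
    rw [pow_succ' _ (k + 1), mul_assoc, barD_cons, ih, hd, hs]
    rw [pow_succ' _ k, mul_assoc (ι A τ) (ι A τ ^ k), barMerge_cons, hm]
    simp [mul_sub, mul_assoc]

theorem pow_mul_mem_tensorDeg {M : Type*} [AddCommGroup M] [Module A M] {deg : ℕ → Submodule A M}
    {τ : M} (hτ : τ ∈ deg 1) {n : ℤ} {x : TensorAlgebra A M} (hx : x ∈ tensorDeg deg n) (k : ℕ) :
    ι A τ ^ k * x ∈ tensorDeg deg n := by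
  induction k with
  | zero => simpa using hx
  | succ k ih =>
    rw [pow_succ', mul_assoc]
    simpa using cons_mem_tensorDeg hτ ih

/-- If every `1`-cochain of a graph is cohomologous to a multiple of `τ`, then every tensor of
`1`-cochains is cohomologous to a polynomial in `τ`. -/
theorem pow_mul_prod_mem {τ : Cbar (pgraph ends v₀) A} (hτ : τ ∈ Cdeg (pgraph ends v₀) A 1)
    (hc : ∀ c ∈ Cdeg (pgraph ends v₀) A 1, ∃ a : A, ∃ f ∈ Cdeg (pgraph ends v₀) A 0,
      c = a • τ + cD _ A f) (N : ℕ) :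
    ∀ (l : List (Cbar (pgraph ends v₀) A)) (k : ℕ), k + l.length = N →
      (∀ c ∈ l, c ∈ Cdeg (pgraph ends v₀) A 1) →
      ι A τ ^ k * (l.map (ι A)).prod ∈
        (BarDeg (pgraph ends v₀) A (0 - 1)).map (barDiff (pgraph ends v₀) A) ⊔
          LinearMap.range (Polynomial.aeval (R := A) (ι A τ)).toLinearMap := by
  -- Two nested inductions. Replacing the head letter by a multiple of `τ` moves a letter from the
  -- list to the prefix at constant total length `N`. The error terms, in which a 0-cochain is
  -- merged into a neighbour, have one letter less and are handled by the outer induction.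
  induction N using Nat.strong_induction_on with
  | _ N IH =>
    intro l
    induction l with
    | nil =>
      intro k _ _
      refine Submodule.mem_sup_right ⟨Polynomial.X ^ k, ?_⟩
      simp
    | cons c l ih =>
      intro k hk hl
      simp only [List.length_cons] at hk
      have hl' : ∀ c ∈ l, c ∈ Cdeg (pgraph ends v₀) A 1 := fun c h => hl c (List.mem_cons_of_mem _ h)
      obtain ⟨a, f, hf, hcf⟩ := hc c (hl c List.mem_cons_self)
      set p := (l.map (ι A)).prod with hp
      have hp0 : p ∈ BarDeg (pgraph ends v₀) A 0 :=
        Submodule.subset_span ⟨l.map fun c => (1, c), by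
            intro c h
            obtain ⟨c', h', rfl⟩ := List.mem_map.1 h
            exact hl' c' h', by simp [Function.comp_def],
          by simp [hp, Function.comp_def]⟩
      have hdp : barDiff (pgraph ends v₀) A p = 0 := by
        -- A 1-cochain of a graph is determined by its values on edges, so `p` comes from a tensor
        -- of edge functions. Such tensors are closed because a graph has no nondegenerate
        -- 2-simplices.
        have : ∃ q : TensorAlgebra A (E → A), tmap (edgeCochain A v₀) q = p := by
          rw [hp]
          clear_value p
          clear hp hp0 ih hk hl
          induction l with
          | nil => exact ⟨1, by simp⟩
          | cons c l ih =>
            obtain ⟨q, hq⟩ := ih fun c h => hl' c (List.mem_cons_of_mem _ h)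
            refine ⟨ι A (fun e => ev A (pedge ends v₀ e) c) * q, ?_⟩
            rw [map_mul, hq, tmap_ι, List.map_cons, List.prod_cons]
            congr 2
            exact cochain_one_ext (edgeCochain_mem v₀ _) (hl' c List.mem_cons_self)
              fun e =>
                edgeCochain_edge (ends := ends) A v₀ (fun e => ev A (pedge ends v₀ e) c) e
        obtain ⟨q, hq⟩ := this
        rw [← hq, barDiff_edgeCochain]
      have hsf : cS _ A f = -f := by
        apply Subtype.ext; funext n x
        by_cases hn : n = 0
        · subst hn; simp [cS, rawSign]
        · simp [cS, rawSign, hf n hn]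
      have hd1 : barDiff (pgraph ends v₀) A (ι A f * p) =
          barMerge (cD _ A) (cS _ A) (cM _ A) p f - ι A (cD _ A f) * p := by
        rw [barD_cons, hdp, hsf, map_neg]; simp; abel
      -- The 0-cochain `f` contributes degree -1 and all the other letters degree 0, so this is an
      -- admissible primitive.
      have hmem : ι A τ ^ k * (ι A f * p) ∈ BarDeg (pgraph ends v₀) A (0 - 1) := by
        have := cons_mem_tensorDeg hf hp0
        exact pow_mul_mem_tensorDeg hτ (by simpa using this) k
      have hmerge : ι A τ ^ k * barMerge (cD _ A) (cS _ A) (cM _ A) p f ∈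
          (BarDeg (pgraph ends v₀) A (0 - 1)).map (barDiff (pgraph ends v₀) A) ⊔
          LinearMap.range (Polynomial.aeval (R := A) (ι A τ)).toLinearMap := by
        rw [hp]
        rcases l with _ | ⟨c', l⟩
        · simp
        · rw [List.map_cons, List.prod_cons, barMerge_cons]
          refine IH (k + (l.length + 1)) (by simp only [List.length_cons] at hk; omega)
            (cM _ A f c' :: l) k rfl ?_
          intro c hc
          rcases List.mem_cons.1 hc with rfl | h
          · simpa using cM_mem_Cdeg 0 1 _ hf _ (hl' c' List.mem_cons_self)
          · exact hl' c (List.mem_cons_of_mem _ h)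
      -- Up to a coboundary, `df` is traded for the product of `f` with the letter after it and, if
      -- `k` is positive, for the product of the preceding `τ` with `f`.
      have key : ι A τ ^ k * (ι A (cD _ A f) * p) ∈
          (BarDeg (pgraph ends v₀) A (0 - 1)).map (barDiff (pgraph ends v₀) A) ⊔
          LinearMap.range (Polynomial.aeval (R := A) (ι A τ)).toLinearMap := by
        have hB := Submodule.mem_sup_left
          (T := LinearMap.range (Polynomial.aeval (R := A) (ι A τ)).toLinearMap)
          (Submodule.mem_map_of_mem (f := barDiff (pgraph ends v₀) A) hmem)
        rcases k with _ | k
        · rw [pow_zero, one_mul] at hmerge hB ⊢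
          rw [hd1] at hB
          simpa using Submodule.sub_mem _ hmerge hB
        · rw [barDiff_pow_mul hτ, hd1] at hB
          have h3 := IH (k + (l.length + 1)) (by omega) (cM _ A τ f :: l) k rfl (by
            intro c hc
            rcases List.mem_cons.1 hc with rfl | h
            · simpa using cM_mem_Cdeg 1 0 _ hτ _ hf
            · exact hl' c h)
          rw [List.map_cons, List.prod_cons] at h3
          have := Submodule.sub_mem _ (Submodule.sub_mem _ hmerge hB) h3
          convert this using 1
          rw [mul_sub]; abel
      rw [List.map_cons, List.prod_cons, hcf]
      have e : ι A τ ^ k * (ι A (a • τ + cD _ A f) * p) =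
          a • (ι A τ ^ (k + 1) * p) + ι A τ ^ k * (ι A (cD _ A f) * p) := by
        rw [map_add, map_smul, add_mul, mul_add, smul_mul_assoc, mul_smul_comm, pow_succ, mul_assoc]
      rw [e]
      exact Submodule.add_mem _ (Submodule.smul_mem _ _ (ih (k + 1) (by omega) hl')) key

/-- Words span the tensor algebra, so the reduction of a word with empty prefix extends to all
tensors by linearity. -/
theorem tmap_mem_sup_range {τ : Cbar (pgraph ends v₀) A} (hτ : τ ∈ Cdeg (pgraph ends v₀) A 1)
    (hc : ∀ c ∈ Cdeg (pgraph ends v₀) A 1, ∃ a : A, ∃ f ∈ Cdeg (pgraph ends v₀) A 0,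
      c = a • τ + cD _ A f) {N : Type*} [AddCommGroup N] [Module A N]
    (g : N →ₗ[A] Cbar (pgraph ends v₀) A) (hg : ∀ x, g x ∈ Cdeg (pgraph ends v₀) A 1)
    (x : TensorAlgebra A N) : tmap g x ∈
      (BarDeg (pgraph ends v₀) A (0 - 1)).map (barDiff (pgraph ends v₀) A) ⊔
        LinearMap.range (Polynomial.aeval (R := A) (ι A τ)).toLinearMap := by
  have hx : x ∈ Submodule.span A (Set.range fun l : List N => (l.map (ι A)).prod) := by
    refine cons_induction (Submodule.subset_span (Set.mem_range.2 ⟨[], by simp⟩)) (fun c y hy => ?_) x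
    induction hy using Submodule.span_induction with
    | mem y hy =>
      obtain ⟨l, rfl⟩ := hy
      exact Submodule.subset_span ⟨c :: l, by simp⟩
    | zero => simp
    | add y z _ _ hy hz => rw [mul_add]; exact Submodule.add_mem _ hy hz
    | smul r y _ hy => rw [mul_smul_comm]; exact Submodule.smul_mem _ _ hy
  induction hx using Submodule.span_induction with
  | mem y hy =>
    obtain ⟨l, rfl⟩ := hy
    have := pow_mul_prod_mem hτ hc _ (l.map g) 0 rfl (by simpa using fun a _ => hg a)
    simpa [map_list_prod, Function.comp_def] using this
  | zero => simp
  | add y z _ _ hy hz => rw [map_add]; exact Submodule.add_mem _ hy hz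
  | smul r y _ hy => rw [map_smul]; exact Submodule.smul_mem _ _ hy

end GraphCochains

end

end LetterBraiding

namespace LetterBraiding

noncomputable section

/-! ### Holonomy around the circle of a word, and the letter-braiding number. -/

section CircleHolonomy

open TensorAlgebra

variable {A : Type v} [CommRing A] {S : Type u} (w : List (S × Bool))

/-- The `1`-cochain of a wedge of circles with prescribed values on the edges. -/
def wedgeCochain (A : Type v) [CommRing A] (S : Type u) : (S → A) →ₗ[A] Cbar (wedge S) A :=
  edgeCochain A (ends := wedgeEnds S) PUnit.unit

theorem wedgeCochain_mem (c : S → A) : wedgeCochain A S c ∈ Cdeg (wedge S) A 1 :=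
  edgeCochain_mem _ _

/-- The `0`-cochain of the circle of a word with prescribed values on the vertices. -/
def circleVertexCochain (g : Fin (w.length + 1) → A) (hg : g 0 = 0) : Cbar (circle w) A :=
  vertexCochain (ends := circleEnds w) (fun v => g v.down) hg

theorem circleVertexCochain_mem (g : Fin (w.length + 1) → A) (hg : g 0 = 0) :
    circleVertexCochain w g hg ∈ Cdeg (circle w) A 0 := vertexCochain_mem _ _

theorem ev_cD_circleVertexCochain (g : Fin (w.length + 1) → A) (hg : g 0 = 0)
    (e : Fin (w.length + 1)) :
    ev A (circleEdge w e) (cD _ A (circleVertexCochain w g hg)) =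
      g (circleEnds w ⟨e⟩ 1).down - g (circleEnds w ⟨e⟩ 0).down :=
  ev_cD_vertexCochain (A := A) (ends := circleEnds w) (v₀ := ⟨0⟩) (fun v => g v.down) hg ⟨e⟩

theorem circle_cochain_ext {f g : Cbar (circle w) A} (hf : f ∈ Cdeg (circle w) A 1)
    (hg : g ∈ Cdeg (circle w) A 1)
    (h : ∀ e, ev A (circleEdge w e) f = ev A (circleEdge w e) g) : f = g :=
  cochain_one_ext (ends := circleEnds w) (v₀ := ULift.up 0) hf hg fun e => h e.down

/-- The holonomy around the circle of a word. -/
def circleHolonomy (A : Type v) [CommRing A] (w : List (S × Bool)) :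
    (Module.End A (Bar (circle w) A))ˣ :=
  holonomy (w.length + 1) (segSign w) fun e => ev A (circleEdge w e)

theorem vertex_circleEdge (e : Fin (w.length + 1)) (i : Fin 2) :
    vertex (circleEdge w e) i = gV (circleEnds w) _ (circleEnds w ⟨e⟩ i) :=
  vertex_pedge (v₀ := ⟨0⟩) (ULift.up e) i

theorem circleEnds_of_pos {e : Fin (w.length + 1)} (h : segSign w e = true) :
    circleEnds w ⟨e⟩ 0 = ⟨e⟩ ∧ circleEnds w ⟨e⟩ 1 = ⟨e + 1⟩ := by
  simp [circleEnds, h]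

theorem circleEnds_of_neg {e : Fin (w.length + 1)} (h : segSign w e = false) :
    circleEnds w ⟨e⟩ 0 = ⟨e + 1⟩ ∧ circleEnds w ⟨e⟩ 1 = ⟨e⟩ := by
  simp [circleEnds, h]

/-- The vertex of the circle of a word in a given position. -/
def circleVertex (v : Fin (w.length + 1)) : (circle w).X _⦋0⦌ := gV (circleEnds w) _ ⟨v⟩

/-- The holonomy around the circle of a word commutes with the bar differential. -/
theorem circleHolonomy_barDiff :
    (circleHolonomy A w).1 * barDiff (circle w) A = barDiff (circle w) A * (circleHolonomy A w).1 := by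
  have hpt : ev A (circleVertex w 0) = 0 := ev_pt (X := circle w)
  -- Invariant: after `k` segments the partial holonomy intertwines the bar differential at the
  -- basepoint with the one augmented at vertex `k`. `Fin.ofNat` reduces the final position modulo
  -- the length, back to the basepoint, where the augmentation term vanishes.
  have := holonomy_induction (segSign w) (fun e => ev A (circleEdge w e))
    (C := fun k g => g * barDiff (circle w) A =
      (barDiff (circle w) A - contract (ev A (circleVertex w (Fin.ofNat (w.length + 1) k)))) * g)
    (by
      simp [hpt]) (by
      intro e g hg
      have h0 : Fin.ofNat (w.length + 1) e.castSucc = e := Fin.ext (Nat.mod_eq_of_lt e.2)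
      have h1 : Fin.ofNat (w.length + 1) e.succ = e + 1 :=
        Fin.ext (by simp [Fin.val_add, Fin.ofNat])
      rw [h0] at hg
      rw [h1]
      rw [mul_assoc, hg, ← mul_assoc, ← mul_assoc]
      congr 1
      cases hs : segSign w e
      · have h := transport_inv_ev_barDiff (A := A) (circleEdge w e)
        rw [vertex_circleEdge, vertex_circleEdge, (circleEnds_of_neg w hs).1,
          (circleEnds_of_neg w hs).2] at h
        exact h
      · have h := transport_ev_barDiff (A := A) (circleEdge w e)
        rw [vertex_circleEdge, vertex_circleEdge, (circleEnds_of_pos w hs).1,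
          (circleEnds_of_pos w hs).2] at h
        exact h)
  have h0 : Fin.ofNat (w.length + 1) (Fin.last (w.length + 1)) = 0 := Fin.ext (Nat.mod_self _)
  rw [h0, hpt, contract_zero, sub_zero] at this
  exact this

/-- The pairing of a tensor of functions on the letters with the Magnus expansion of a word, without
its constant term. -/
def magnusCoeff (A : Type v) [CommRing A] (g : FreeGroup S) : TensorAlgebra A (S → A) →ₗ[A] A :=
  algebraMapInv.toLinearMap ∘ₗ ((magnus A S g).unop.1 - 1)

/-- The standard segment is collapsed to a degenerate edge, so its functional is zero. The segment
of a letter `s` evaluates a function at `s`. -/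
theorem pull_edgeCochain_wordEdge (e : Fin (w.length + 1)) :
    ev A (X := wedge S) (wordEdge w e) ∘ₗ wedgeCochain A S =
      (Fin.cons 0 fun i => LinearMap.proj (w.get i).1 : Fin (w.length + 1) → ((S → A) →ₗ[A] A)) e := by
  refine Fin.cases ?_ (fun i => ?_) e
  · ext c; rfl
  · refine LinearMap.ext fun c => ?_
    exact edgeCochain_edge (ends := wedgeEnds S) A PUnit.unit c (w.get i).1

theorem wordMap_circleEdge (e : Fin (w.length + 1)) :
    (wordMap w).f.app _ (circleEdge w e) = wordEdge w e := by
  change (wedge S).X.map (𝟙 _) (wordEdge w e) = _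
  simp

/-- The holonomy of a word, on tensors of cochains of a wedge of circles. -/
theorem algebraMapInv_wordHolonomy (T : TensorAlgebra A (S → A)) :
    algebraMapInv ((holonomy (w.length + 1) (segSign w) fun e =>
        ev A (X := wedge S) (wordEdge w e)).1 (tmap (wedgeCochain A S) T)) -
      algebraMapInv T = magnusCoeff A (FreeGroup.mk w) T := by
  rw [holonomy_tmap, algebraMapInv_tmap]
  have h : (fun e => ev A (X := wedge S) (wordEdge w e) ∘ₗ
      wedgeCochain A S) = Fin.cons 0 fun i =>
        LinearMap.proj (R := A) (φ := fun _ => A) (w.get i).1 :=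
    funext fun e => pull_edgeCochain_wordEdge w e
  -- The standard segment contributes the identity, and the remaining segments give the Magnus image
  -- of the word.
  rw [h, segSign, holonomy_cons, signedTransport_zero, mul_one, holonomy_word]
  simp [magnusCoeff]

/-- The holonomy of the circle on classes pulled back from the wedge of circles. -/
theorem algebraMapInv_circleHolonomy_word (T : TensorAlgebra A (S → A)) :
    algebraMapInv ((circleHolonomy A w).1
        (barPull A (wordMap w) (tmap (wedgeCochain A S) T))) -
      algebraMapInv T = magnusCoeff A (FreeGroup.mk w) T := by
  rw [← algebraMapInv_wordHolonomy]
  congr 1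
  change algebraMapInv ((circleHolonomy A w).1 (tmap (pull A (wordMap w)) _)) = _
  rw [circleHolonomy, holonomy_tmap, algebraMapInv_tmap]
  simp only [ev_pull, wordMap_circleEdge]

/-- The `1`-cochain of the standard circle with prescribed value on the edge. -/
def stdCochain (A : Type v) [CommRing A] : (PUnit.{u + 1} → A) →ₗ[A] Cbar stdCircle.{u} A :=
  wedgeCochain A PUnit

/-- The cochain of the standard circle with value `1` on the edge. -/
def circleCochain (A : Type v) [CommRing A] : Cbar stdCircle.{u} A :=
  stdCochain A fun _ => 1

/-- The pullback of the generating cochain under the standard collapse. -/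
def collapseCochain (A : Type v) [CommRing A] : Cbar (circle w) A :=
  pull A (stdMap w) (circleCochain A)

theorem collapseCochain_mem : collapseCochain w A ∈ Cdeg (circle w) A 1 :=
  pull_mem_Cdeg _ _ _ (wedgeCochain_mem _)

theorem ev_collapseCochain (e : Fin (w.length + 1)) :
    ev A (circleEdge w e) (collapseCochain w A) = if e = 0 then 1 else 0 := by
  -- The image simplex is generalized so that the `if` is decided before the dependent cochain is
  -- evaluated.
  have h : ∀ y : stdCircle.{u}.X _⦋1⦌,
      (if e = 0 then edge (wedgeEnds PUnit) PUnit.unit else gV (wedgeEnds PUnit) _ PUnit.unit) = y →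
      ev A (circleEdge w e) (collapseCochain w A) = (circleCochain A).1 1 y := by
    rintro y rfl
    exact congrArg ((circleCochain A).1 1)
      (ConcreteCategory.congr_hom (stdCircle.{u}.X.map_id (op ⦋1⦌)) _)
  by_cases he : e = 0
  · rw [h _ (if_pos he), if_pos he]
    exact edgeCochain_edge (ends := wedgeEnds PUnit) A PUnit.unit (fun _ => 1) PUnit.unit
  · rw [h _ (if_neg he), if_neg he]
    rfl

theorem barPull_stdMap_aeval (P : Polynomial A) :
    barPull A (stdMap w) (tmap (stdCochain A)
      (Polynomial.aeval (ι A (fun _ : PUnit.{u + 1} => (1 : A))) P)) =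
      Polynomial.aeval (ι A (collapseCochain w A)) P := by
  change tmap _ (tmap _ _) = _
  rw [← Polynomial.aeval_algHom_apply, ← Polynomial.aeval_algHom_apply, tmap_ι, tmap_ι]
  rfl

/-- The holonomy of the circle on powers of the generator reads off the first two coefficients. -/
theorem algebraMapInv_circleHolonomy_aeval (P : Polynomial A) :
    algebraMapInv ((circleHolonomy A w).1 (Polynomial.aeval (ι A (collapseCochain w A)) P)) -
      algebraMapInv (Polynomial.aeval (ι A (collapseCochain w A)) P) = P.coeff 1 := by
  -- Only multiples of the generator occur as letters, so by naturality the computation takes place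
  -- in the tensor algebra of `A`, where every segment except the standard one acts by zero.
  let g : A →ₗ[A] Cbar (circle w) A := LinearMap.toSpanSingleton A _ (collapseCochain w A)
  have hg : ∀ P : Polynomial A, Polynomial.aeval (ι A (collapseCochain w A)) P =
      tmap g (Polynomial.aeval (ι A (1 : A)) P) := fun P => by
    rw [← Polynomial.aeval_algHom_apply, tmap_ι]
    simp [g]
  have hx : (fun e => ev A (circleEdge w e) ∘ₗ g) =
      Fin.cons LinearMap.id (fun _ => 0) := by
    funext e
    refine LinearMap.ext_ring ?_
    simp only [LinearMap.comp_apply, g, LinearMap.toSpanSingleton_apply, one_smul,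
      ev_collapseCochain]
    refine Fin.cases ?_ (fun i => ?_) e
    · simp
    · simp
  have h0 : ∀ n (b : Fin n → Bool), holonomy n b (fun _ => (0 : A →ₗ[A] A)) = 1 := by
    intro n b
    induction n with
    | zero => rfl
    | succ n ih => rw [holonomy_succ, ih]; simp
  rw [hg, circleHolonomy, holonomy_tmap, algebraMapInv_tmap, algebraMapInv_tmap, hx, segSign,
    holonomy_cons, h0, one_mul]
  rw [signedTransport, cond_true, transport_val, LinearMap.add_apply, Module.End.one_apply, map_add, add_sub_cancel_left]
  -- A single contraction removes one letter, so among the monomials only that of exponent one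
  -- reaches weight zero.
  have : algebraMapInv.toLinearMap ∘ₗ contract LinearMap.id ∘ₗ
      (Polynomial.aeval (R := A) (ι A (1 : A))).toLinearMap = Polynomial.lcoeff A 1 := by
    refine Polynomial.lhom_ext' fun n => LinearMap.ext_ring ?_
    rcases n with _ | _ | n
    · simp [Polynomial.coeff_one]
    · simp [Polynomial.aeval_monomial]
    · simp [Polynomial.aeval_monomial, Polynomial.coeff_monomial, pow_succ', algebraMapInv]
  exact LinearMap.congr_fun this P

/-- Every `1`-cochain of the circle of a word is cohomologous to a multiple of the generator. -/
theorem exists_smul_collapseCochain_add (c : Cbar (circle w) A) (hc : c ∈ Cdeg (circle w) A 1) :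
    ∃ a : A, ∃ f ∈ Cdeg (circle w) A 0, c = a • collapseCochain w A + cD _ A f := by
  -- The signed values of `c` along the circle. Their total is the required multiple of the
  -- generator. Once it is subtracted at the standard segment, the rest sums to zero and is the
  -- coboundary of a function on the vertices, normalized at the basepoint.
  let h : Fin (w.length + 1) → A := fun e => sgn A (segSign w e) * ev A (circleEdge w e) c
  obtain ⟨g, hg0, hg⟩ := exists_cyclic_difference (fun e => h e - if e = 0 then ∑ j, h j else 0)
    (by simp)
  refine ⟨∑ j, h j, circleVertexCochain w g hg0, circleVertexCochain_mem w g hg0, ?_⟩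
  refine circle_cochain_ext w hc (Submodule.add_mem _
    (Submodule.smul_mem _ _ (collapseCochain_mem w))
    (cD_mem_Cdeg 0 _ (circleVertexCochain_mem w g hg0))) fun e => ?_
  rw [map_add, map_smul, ev_cD_circleVertexCochain, ev_collapseCochain, smul_eq_mul]
  have h3 := hg e
  have h0 : segSign w 0 = true := rfl
  cases hs : segSign w e
  · have he : e ≠ 0 := by rintro rfl; rw [h0] at hs; cases hs
    rw [(circleEnds_of_neg w hs).1, (circleEnds_of_neg w hs).2]
    simp only [h, hs, he, if_false, sgn] at h3 ⊢
    simp only [Bool.false_eq_true, if_false] at h3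
    linear_combination h3
  · rw [(circleEnds_of_pos w hs).1, (circleEnds_of_pos w hs).2]
    simp only [mul_ite, mul_one, mul_zero]
    have : h e = ev A (circleEdge w e) c := by simp [h, hs, sgn]
    rw [← this]
    linear_combination -h3

theorem coh_mk_eq_iff {M : Type*} [AddCommGroup M] [Module A M] {d : M →ₗ[A] M}
    {P Q : Submodule A M} (x y : ↥(P ⊓ LinearMap.ker d)) :
    (Coh.mk x : Coh d P Q) = Coh.mk y ↔ x.1 - y.1 ∈ Q.map d := by
  rw [Coh.mk, Submodule.mkQ_apply, Submodule.mkQ_apply, Submodule.Quotient.eq]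
  rfl

/-- This makes the `Function.invFun` in `braidingPoly` a genuine preimage. No uniqueness of the
preimage is needed later, since holonomy determines its linear coefficient. -/
theorem exists_collapseClass_eq (T : TensorAlgebra A (S → A)) :
    ∃ P, collapseClass A w P = HBar.pull A (wordMap w) 0 (wedgeClass A S T) := by
  have h : tmap (pull A (wordMap w) ∘ₗ wedgeCochain A S) T ∈
      (BarDeg (circle w) A (0 - 1)).map (barDiff (circle w) A) ⊔
        LinearMap.range (Polynomial.aeval (R := A) (ι A (collapseCochain w A))).toLinearMap :=
    tmap_mem_sup_range (collapseCochain_mem w)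
    (fun c hc => exists_smul_collapseCochain_add w c hc)
    (pull A (wordMap w) ∘ₗ wedgeCochain A S)
    (fun a => pull_mem_Cdeg _ _ _ (wedgeCochain_mem _)) T
  obtain ⟨b, hb, _, ⟨P, rfl⟩, hT⟩ := Submodule.mem_sup.1 h
  refine ⟨P, (coh_mk_eq_iff (d := barDiff (circle w) A) _ _).2 ?_⟩
  change barPull A (stdMap w) (tmap (stdCochain A)
      (Polynomial.aeval (ι A (fun _ : PUnit.{u + 1} => (1 : A))) P)) -
    tmap (pull A (wordMap w)) (tmap (wedgeCochain A S) T) ∈ _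
  have hcomp : tmap (pull A (wordMap w)) (tmap (wedgeCochain A S) T) =
      tmap (pull A (wordMap w) ∘ₗ wedgeCochain A S) T := by
    have : (tmap (pull A (wordMap w))).comp (tmap (wedgeCochain A S)) =
        tmap (pull A (wordMap w) ∘ₗ wedgeCochain A S) := by ext c; simp
    exact DFunLike.congr_fun this T
  rw [barPull_stdMap_aeval, hcomp, ← hT]
  simpa using Submodule.neg_mem _ hb

/-- The letter-braiding number of a word is a coefficient of its Magnus expansion. -/
theorem braidingNumber_eq_magnusCoeff (T : TensorAlgebra A (S → A)) :
    braidingNumber A T w = magnusCoeff A (FreeGroup.mk w) T := by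
  have hP : collapseClass A w (braidingPoly A T w) =
      HBar.pull A (wordMap w) 0 (wedgeClass A S T) :=
    Function.invFun_eq (exists_collapseClass_eq w T)
  generalize hQ : braidingPoly A T w = P at hP
  have h := (coh_mk_eq_iff (d := barDiff (circle w) A) _ _).1 hP
  change barPull A (stdMap w) (tmap (stdCochain A)
      (Polynomial.aeval (ι A (fun _ : PUnit.{u + 1} => (1 : A))) P)) -
    barPull A (wordMap w) (tmap (wedgeCochain A S) T) ∈ _ at h
  rw [barPull_stdMap_aeval] at h
  obtain ⟨b, -, hb⟩ := h
  -- The two representatives differ by a coboundary. Both the weight zero part of its holonomy and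
  -- its own weight zero part vanish, so the functional agrees on the polynomial and on the
  -- pulled-back tensor.
  have h1 : algebraMapInv ((circleHolonomy A w).1 (barDiff (circle w) A b)) = 0 := by
    have := LinearMap.congr_fun (circleHolonomy_barDiff (A := A) w) b
    simp only [Module.End.mul_apply] at this
    rw [this, algebraMapInv_barD]
  have h2 : algebraMapInv (barDiff (circle w) A b) = 0 := algebraMapInv_barD b
  rw [hb] at h1 h2
  rw [map_sub, map_sub] at h1
  rw [map_sub] at h2
  rw [braidingNumber, hQ, ← algebraMapInv_circleHolonomy_aeval w P,
    ← algebraMapInv_circleHolonomy_word]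
  have h3 : algebraMapInv (barPull A (wordMap w) (tmap (wedgeCochain A S) T)) =
      algebraMapInv T := by
    change algebraMapInv (tmap _ (tmap _ _)) = _
    rw [algebraMapInv_tmap, algebraMapInv_tmap]
  rw [h3] at h2
  linear_combination h1 - h2

end CircleHolonomy

end

end LetterBraiding

namespace LetterBraiding

noncomputable section

/-! ### Sweeping out a relation disc in the presentation complex. -/

section Disc

open TensorAlgebra

variable {A : Type v} [CommRing A] {S ρ : Type u} (word : ρ → List (S × Bool))

/-- The presentation complex has a single vertex. -/
theorem presentation_vertex (y : (presentation word).X _⦋0⦌) : y = (presentation word).pt := by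
  have hl : ∀ v : (wedge S).X _⦋0⦌,
      (Quot.mk _ (Sum.inl v) : (presentation word).X _⦋0⦌) = (presentation word).pt :=
    fun v => congrArg (fun v => Quot.mk _ (Sum.inl v)) (wedge_vertex v)
  induction y using Quot.ind with
  | mk y =>
    rcases y with v | ⟨r, x, t⟩
    · exact hl v
    · have ht : t = SimplexCategory.const ⦋0⦌ ⦋1⦌ (t.toOrderHom 0) := by
        apply hom_ext'; intro k
        change (t.toOrderHom k).1 = (t.toOrderHom 0).1
        rw [Subsingleton.elim (α := Fin 1) k 0]
      have h2 : ∀ i : Fin 2, i = 0 ∨ i = 1 := by decide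
      rw [ht]
      rcases h2 (t.toOrderHom 0) with h | h <;> rw [h]
      · exact Eq.trans (b := Quot.mk (ConeRel (fun r => wordMap (word r)) (op ⦋0⦌)) (Sum.inl _))
          (Quot.sound (Or.inl ⟨r, x, rfl, rfl⟩)) (hl _)
      · exact Eq.trans (b := Quot.mk (ConeRel (fun r => wordMap (word r)) (op ⦋0⦌)) (Sum.inl _))
          (Quot.sound (Or.inr (Or.inl ⟨r, x, rfl, rfl⟩))) (hl _)

/-- With a single vertex and reduced cochains all augmentation terms disappear, so transports
commute with the bar differential on the nose. -/
theorem ev_presentation_vertex (y : (presentation word).X _⦋0⦌) : ev A y = 0 := by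
  rw [presentation_vertex word y, ev_pt]

theorem transport_presentation (x : (presentation word).X _⦋1⦌) :
    (transport (ev A x)).1 * barDiff (presentation word) A =
      barDiff (presentation word) A * (transport (ev A x)).1 := by
  simpa only [ev_presentation_vertex, contract_zero, sub_zero] using
    transport_ev_barDiff (A := A) x

theorem signedTransport_presentation (b : Bool) (x : (presentation word).X _⦋1⦌) :
    (signedTransport b (ev A x)).1 * barDiff (presentation word) A =
      barDiff (presentation word) A * (signedTransport b (ev A x)).1 := by
  cases b
  · change (transport (ev A x))⁻¹.1 * _ = _ * (transport (ev A x))⁻¹.1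
    simpa only [ev_presentation_vertex, contract_zero, sub_zero] using
      transport_inv_ev_barDiff (A := A) x
  · exact transport_presentation word x

theorem triangle_presentation (x : (presentation word).X _⦋2⦌) :
    contract (ev A x) * barDiff (presentation word) A +
        barDiff (presentation word) A * contract (ev A x) =
      (transport (ev A ((presentation word).X.map (dl 1 1).op x))).1 -
        (transport (ev A ((presentation word).X.map (dl 0 1).op x))).1 *
          (transport (ev A ((presentation word).X.map (dl 2 1).op x))).1 := by
  simpa only [ev_presentation_vertex, contract_zero, sub_zero] using triangle_ev_barDiff (A := A) x

/-- Transport along a `1`-simplex does not affect a single letter of degree other than one. -/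
theorem signedTransport_ι {X : PSSet.{u}} (b : Bool) (x : X.X _⦋1⦌) {κ : Cbar X A}
    (hκ : ev A x κ = 0) : (signedTransport b (ev A x)).1 (ι A κ) = ι A κ := by
  have h : (transport (ev A x)).1 (ι A κ) = ι A κ := by simp [transport_val, hκ]
  cases b
  · have h' : (transport (ev A x))⁻¹.1 ((transport (ev A x)).1 (ι A κ)) = ι A κ :=
      LinearMap.congr_fun (transport (ev A x)).inv_mul (ι A κ)
    rwa [h] at h'
  · exact h

/-! ### Faces of the two triangles over a segment. -/

section Faces

variable (r : ρ) (e : Fin ((word r).length + 1))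

theorem discLower_face_zero : (presentation word).X.map (dl 0 1).op (discLower word r e) =
    discRadial word r (circleEnds (word r) ⟨e⟩ 1).down := by
  have e1 : dl 0 1 ≫ SimplexCategory.σ (0 : Fin 2) = 𝟙 _ := by
    apply hom_ext'; intro k; fin_cases k <;> rfl
  have e2 : dl 0 1 ≫ SimplexCategory.σ (1 : Fin 2) = SimplexCategory.const ⦋1⦌ ⦋1⦌ 1 := by
    apply hom_ext'; intro k; fin_cases k <;> rfl
  change discOne word r e (dl 0 1 ≫ SimplexCategory.σ 1 ≫ 𝟙 _) (dl 0 1 ≫ SimplexCategory.σ 0) = _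
  rw [Category.comp_id, e1, e2, discOne_const]

theorem discLower_face_one : (presentation word).X.map (dl 1 1).op (discLower word r e) =
    discOne word r e (𝟙 _) (𝟙 _) := by
  have e1 : dl 1 1 ≫ SimplexCategory.σ (0 : Fin 2) = 𝟙 _ := by
    apply hom_ext'; intro k; fin_cases k <;> rfl
  have e2 : dl 1 1 ≫ SimplexCategory.σ (1 : Fin 2) = 𝟙 _ := by
    apply hom_ext'; intro k; fin_cases k <;> rfl
  change discOne word r e (dl 1 1 ≫ SimplexCategory.σ 1 ≫ 𝟙 _) (dl 1 1 ≫ SimplexCategory.σ 0) = _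
  rw [Category.comp_id, e1, e2]

theorem discLower_face_two : (presentation word).X.map (dl 2 1).op (discLower word r e) =
    (presIncl word).f.app (op ⦋1⦌) (wordEdge (word r) e) := by
  have e1 : dl 2 1 ≫ SimplexCategory.σ (0 : Fin 2) = SimplexCategory.const ⦋1⦌ ⦋1⦌ 0 := by
    apply hom_ext'; intro k; fin_cases k <;> rfl
  have e2 : dl 2 1 ≫ SimplexCategory.σ (1 : Fin 2) = 𝟙 _ := by
    apply hom_ext'; intro k; fin_cases k <;> rfl
  change discOne word r e (dl 2 1 ≫ SimplexCategory.σ 1 ≫ 𝟙 _) (dl 2 1 ≫ SimplexCategory.σ 0) = _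
  rw [Category.comp_id, e1, e2, discOne_zero]

/-- This face lies in the end of the cylinder that is collapsed to the basepoint, so it is
degenerate. -/
theorem ev_discUpper_face_zero :
    ev A ((presentation word).X.map (dl 0 1).op (discUpper word r e)) = 0 := by
  have e1 : dl 0 1 ≫ SimplexCategory.σ (0 : Fin 2) = 𝟙 _ := by
    apply hom_ext'; intro k; fin_cases k <;> rfl
  have e2 : dl 0 1 ≫ SimplexCategory.σ (1 : Fin 2) = SimplexCategory.const ⦋1⦌ ⦋1⦌ 1 := by
    apply hom_ext'; intro k; fin_cases k <;> rfl
  change ev A (discOne word r e (dl 0 1 ≫ SimplexCategory.σ 0 ≫ 𝟙 _)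
    (dl 0 1 ≫ SimplexCategory.σ 1)) = _
  rw [Category.comp_id, e1, e2]
  exact LinearMap.ext fun f => discOne_one word A r e f

theorem discUpper_face_one : (presentation word).X.map (dl 1 1).op (discUpper word r e) =
    discOne word r e (𝟙 _) (𝟙 _) := by
  have e1 : dl 1 1 ≫ SimplexCategory.σ (0 : Fin 2) = 𝟙 _ := by
    apply hom_ext'; intro k; fin_cases k <;> rfl
  have e2 : dl 1 1 ≫ SimplexCategory.σ (1 : Fin 2) = 𝟙 _ := by
    apply hom_ext'; intro k; fin_cases k <;> rfl
  change discOne word r e (dl 1 1 ≫ SimplexCategory.σ 0 ≫ 𝟙 _) (dl 1 1 ≫ SimplexCategory.σ 1) = _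
  rw [Category.comp_id, e1, e2]

theorem discUpper_face_two : (presentation word).X.map (dl 2 1).op (discUpper word r e) =
    discRadial word r (circleEnds (word r) ⟨e⟩ 0).down := by
  have e1 : dl 2 1 ≫ SimplexCategory.σ (0 : Fin 2) = SimplexCategory.const ⦋1⦌ ⦋1⦌ 0 := by
    apply hom_ext'; intro k; fin_cases k <;> rfl
  have e2 : dl 2 1 ≫ SimplexCategory.σ (1 : Fin 2) = 𝟙 _ := by
    apply hom_ext'; intro k; fin_cases k <;> rfl
  change discOne word r e (dl 2 1 ≫ SimplexCategory.σ 0 ≫ 𝟙 _) (dl 2 1 ≫ SimplexCategory.σ 1) = _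
  rw [Category.comp_id, e1, e2, discOne_const]

/-- The homotopy across the sector of the disc over a segment. -/
theorem sector_homotopy :
    (contract (ev A (discLower word r e)) - contract (ev A (discUpper word r e))) *
        barDiff (presentation word) A +
      barDiff (presentation word) A *
        (contract (ev A (discLower word r e)) - contract (ev A (discUpper word r e))) =
      (transport (ev A (discRadial word r (circleEnds (word r) ⟨e⟩ 0).down))).1 -
        (transport (ev A (discRadial word r (circleEnds (word r) ⟨e⟩ 1).down))).1 *
          (transport (ev A ((presIncl word).f.app (op ⦋1⦌) (wordEdge (word r) e)))).1 := by
  have hl := triangle_presentation (A := A) word (discLower word r e)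
  have hu := triangle_presentation (A := A) word (discUpper word r e)
  rw [discLower_face_zero, discLower_face_one, discLower_face_two] at hl
  rw [ev_discUpper_face_zero, discUpper_face_one, discUpper_face_two, transport_zero,
    Units.val_one, one_mul] at hu
  rw [sub_mul, mul_sub]
  -- The two triangles share the diagonal of the prism, whose transport cancels in the difference.
  have := congrArg₂ (· - ·) hl hu
  simp only at this
  rw [sub_sub_sub_cancel_left] at this
  rw [← this]
  abel

/-- In the reduced cone the radial edge at the basepoint is collapsed. The sweep around the disc
therefore starts and ends with trivial radial transport. -/
theorem ev_discRadial_zero : ev A (discRadial word r 0) = 0 := by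
  have h : discRadial word r 0 =
      (presentation word).X.map (SimplexCategory.const ⦋1⦌ ⦋0⦌ 0).op (presentation word).pt :=
    Quot.sound (Or.inr (Or.inr ⟨r, 𝟙 _, rfl, rfl⟩))
  rw [h]
  exact ev_degenerate ⟨0, Nat.zero_lt_one, SimplexCategory.const ⦋1⦌ ⦋0⦌ 0, Set.mem_range_self _⟩

end Faces

/-- The holonomy of the boundary of a disc, for an element of the bar construction of the
presentation complex whose differential has weight one. -/
theorem algebraMapInv_disc_holonomy (r : ρ) {y : Bar (presentation word) A}
    {κ : Cbar (presentation word) A} (hκ : κ ∈ Cdeg (presentation word) A 2)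
    (hy : barDiff (presentation word) A y = -ι A κ) :
    algebraMapInv ((holonomy ((word r).length + 1) (segSign (word r)) fun e =>
        ev A ((presIncl word).f.app (op ⦋1⦌) (wordEdge (word r) e))).1 y) - algebraMapInv y =
      evalChain (discChain word A r) κ := by
  have hκ1 : ∀ x : (presentation word).X _⦋1⦌, ev A x κ = 0 := fun x => by
    rw [ev_apply, hκ 1 (by decide)]; rfl
  let h : Fin ((word r).length + 1) → A := fun e => sgn A (segSign (word r) e) *
    (ev A (discLower word r e) κ - ev A (discUpper word r e) κ)
  let n := (word r).length + 1
  -- The quantity followed is the weight zero part after travelling along the first `k` segments and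
  -- then radially to the cone point. Each segment changes it by the signed value of `κ` on its
  -- sector. The first two clauses of the invariant ensure that the partial holonomy of `y` still
  -- has differential `-κ`.
  have key := holonomy_induction (segSign (word r))
    (fun e => ev A ((presIncl word).f.app (op ⦋1⦌) (wordEdge (word r) e)))
    (C := fun k g => g * barDiff (presentation word) A = barDiff (presentation word) A * g ∧
      g (ι A κ) = ι A κ ∧
      algebraMapInv ((transport (ev A (discRadial word r (Fin.ofNat n k)))).1 (g y)) =
        algebraMapInv y + ∑ j : Fin n with j.1 < k.1, h j)
    ⟨by simp, by simp, by
      have h0 : Fin.ofNat n (0 : Fin (n + 1)) = 0 := rfl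
      rw [h0, ev_discRadial_zero]; simp⟩ (by
      rintro e g ⟨hd, hg, hF⟩
      have h0 : Fin.ofNat n e.castSucc = e := Fin.ext (Nat.mod_eq_of_lt e.2)
      have h1 : Fin.ofNat n e.succ = e + 1 :=
        Fin.ext (by simp [Fin.val_add, Fin.ofNat, n])
      set σ := signedTransport (segSign (word r) e)
        (ev A ((presIncl word).f.app (op ⦋1⦌) (wordEdge (word r) e))) with hσ
      have hσκ : σ.1 (ι A κ) = ι A κ := signedTransport_ι _ _ (hκ1 _)
      have hσd : σ.1 * barDiff (presentation word) A = barDiff (presentation word) A * σ.1 :=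
        signedTransport_presentation word _ _
      refine ⟨by rw [mul_assoc, hd, ← mul_assoc, hσd, mul_assoc],
        by rw [Module.End.mul_apply, hg, hσκ], ?_⟩
      rw [h0] at hF
      rw [h1, Fin.val_succ, sum_lt_succ, add_left_comm]
      rw [Fin.val_castSucc] at hF
      rw [← hF]
      -- The sector homotopy applied to `g y`: its term with the differential outside has no weight
      -- zero part, and the other term contracts `-κ` with the two triangles. The operator `g` is
      -- kept general because it is the partial holonomy before or after the segment, depending on
      -- the orientation.
      have hom : ∀ g : Module.End A (Bar (presentation word) A),
          g * barDiff (presentation word) A = barDiff (presentation word) A * g →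
          g (ι A κ) = ι A κ →
          algebraMapInv
              ((transport (ev A (discRadial word r (circleEnds (word r) ⟨e⟩ 0).down))).1 (g y)) -
            algebraMapInv ((transport (ev A (discRadial word r
              (circleEnds (word r) ⟨e⟩ 1).down))).1 ((transport
                (ev A ((presIncl word).f.app (op ⦋1⦌) (wordEdge (word r) e)))).1 (g y))) =
            -(ev A (discLower word r e) κ - ev A (discUpper word r e) κ) := by
        intro g hd hg
        have hdy : barDiff (presentation word) A (g y) = -ι A κ := by
          have := LinearMap.congr_fun hd y
          simp only [Module.End.mul_apply] at this
          rw [← this, hy, map_neg, hg]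
        have := congrArg algebraMapInv (LinearMap.congr_fun (sector_homotopy (A := A) word r e) (g y))
        simp only [LinearMap.add_apply, LinearMap.sub_apply, Module.End.mul_apply, hdy] at this
        rw [map_add, algebraMapInv_barD, add_zero] at this
        rw [← map_sub, ← this]
        simp only [map_neg, contract_ι, map_sub, AlgHom.commutes, Algebra.algebraMap_self,
          RingHom.id_apply]
        ring
      cases hs : segSign (word r) e
      -- A backward segment starts, as an edge, at the later vertex. The sector is therefore applied
      -- to the holonomy after the segment, and forward transport cancels `σ`.
      · have := hom (σ.1 * g) (by rw [mul_assoc, hd, ← mul_assoc, hσd, mul_assoc])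
          (by rw [Module.End.mul_apply, hg, hσκ])
        have hinv : (transport (ev A ((presIncl word).f.app (op ⦋1⦌) (wordEdge (word r) e)))).1
            ((σ.1 * g) y) = g y := by
          rw [hσ, hs]
          exact LinearMap.congr_fun (transport _).mul_inv (g y)
        rw [hinv, (circleEnds_of_neg _ hs).1, (circleEnds_of_neg _ hs).2] at this
        simp only [h, hs, sgn, Bool.false_eq_true, if_false]
        linear_combination this
      · have := hom g hd hg
        rw [(circleEnds_of_pos _ hs).1, (circleEnds_of_pos _ hs).2] at this
        have hinv : (transport (ev A ((presIncl word).f.app (op ⦋1⦌) (wordEdge (word r) e)))).1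
            (g y) = (σ.1 * g) y := by
          rw [hσ, hs]; rfl
        rw [hinv] at this
        simp only [h, hs, sgn, if_true]
        linear_combination -this)
  obtain ⟨-, -, key⟩ := key
  -- The last position is the basepoint again, where radial transport is trivial.
  have h0 : Fin.ofNat n (Fin.last n) = 0 := Fin.ext (Nat.mod_self _)
  have h1 : ∑ j : Fin n with j.1 < (Fin.last n).1, h j = ∑ j, h j := by
    simp only [Fin.val_last, Fin.is_lt, Finset.filter_true]
    rfl
  rw [h0, ev_discRadial_zero, transport_zero, h1] at key
  rw [evalChain_discChain]
  exact sub_eq_of_eq_add' key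

/-- The evaluation on a disc of the weight one differential of a lift of a tensor is a coefficient
of the Magnus expansion of the relation. -/
theorem evalChain_discChain_eq_magnusCoeff (r : ρ) {y : Bar (presentation word) A}
    {κ : Cbar (presentation word) A} (hκ : κ ∈ Cdeg (presentation word) A 2)
    (hy : barDiff (presentation word) A y = -ι A κ) (T : TensorAlgebra A (S → A))
    (hT : barPull A (presIncl word) y = tmap (wedgeCochain A S) T) :
    evalChain (discChain word A r) κ = magnusCoeff A (FreeGroup.mk (word r)) T := by
  rw [← algebraMapInv_disc_holonomy word r hκ hy, ← algebraMapInv_wordHolonomy, ← hT]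
  -- The boundary lies in `X_S`, so the holonomy of the lift depends only on its restriction `T`.
  change _ = algebraMapInv ((holonomy _ _ _).1 (tmap (pull A (presIncl word)) y)) - _
  rw [holonomy_tmap, algebraMapInv_tmap]
  congr 1
  rw [← algebraMapInv_tmap (wedgeCochain A S) T, ← hT]
  exact (algebraMapInv_tmap (pull A (presIncl word)) y).symm

end Disc

/-! ### Relative second cohomology of the presentation complex. -/

section RelativeCohomology

variable {A : Type v} [CommRing A] {S ρ : Type u} (word : ρ → List (S × Bool))

/-- A simplex of a disc that repeats a vertex is degenerate. -/
theorem coneSimplex_gE_degenerate (r : ρ) (e : ULift.{u} (Fin ((word r).length + 1))) {m : ℕ}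
    (φ t : ⦋m + 1⦌ ⟶ ⦋1⦌) (i : ℕ) (hi : i ≤ m)
    (hφ : φ.toOrderHom ⟨i, by simp; omega⟩ = φ.toOrderHom ⟨i + 1, by simp; omega⟩)
    (ht : t.toOrderHom ⟨i, by simp; omega⟩ = t.toOrderHom ⟨i + 1, by simp; omega⟩) :
    (coneSimplex (fun r => wordMap (word r)) r (gE (circleEnds (word r)) (op ⦋m + 1⦌) e φ) t :
      (presentation word).X _⦋m + 1⦌) ∈ (presentation word).X.degenerate (m + 1) := by
  -- The composite of `sg i` and `dl i` moves vertex `i` to `i + 1` and fixes the others, so it is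
  -- invisible to a map taking equal values there.
  have key : ∀ f : ⦋m + 1⦌ ⟶ ⦋1⦌,
      f.toOrderHom ⟨i, by simp; omega⟩ = f.toOrderHom ⟨i + 1, by simp; omega⟩ →
      sg i m ≫ dl i m ≫ f = f := by
    intro f hf
    apply hom_ext'; intro k
    have hk := k.2
    simp only [SimplexCategory.len_mk] at hk
    by_cases hki : k.1 = i
    · have e1 : k = ⟨i, by simp; omega⟩ := Fin.ext hki
      have e2 : (dl i m).toOrderHom ((sg i m).toOrderHom k) = ⟨i + 1, by simp; omega⟩ := by
        apply Fin.ext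
        change (if min (if k.1 ≤ i then k.1 else k.1 - 1) m < i then
          min (if k.1 ≤ i then k.1 else k.1 - 1) m else
          min (if k.1 ≤ i then k.1 else k.1 - 1) m + 1) = i + 1
        split_ifs <;> omega
      change (f.toOrderHom ((dl i m).toOrderHom ((sg i m).toOrderHom k))).1 = _
      rw [e2, ← hf, ← e1]
    · have e2 : (dl i m).toOrderHom ((sg i m).toOrderHom k) = k := by
        apply Fin.ext
        change (if min (if k.1 ≤ i then k.1 else k.1 - 1) m < i then
          min (if k.1 ≤ i then k.1 else k.1 - 1) m else
          min (if k.1 ≤ i then k.1 else k.1 - 1) m + 1) = k.1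
        split_ifs <;> omega
      change (f.toOrderHom ((dl i m).toOrderHom ((sg i m).toOrderHom k))).1 = _
      rw [e2]
  have h : (coneSimplex (fun r => wordMap (word r)) r
      (gE (circleEnds (word r)) (op ⦋m + 1⦌) e φ) t : (presentation word).X _⦋m + 1⦌) =
      (presentation word).X.map (sg i m).op (coneSimplex (fun r => wordMap (word r)) r
        (gE (circleEnds (word r)) (op ⦋m⦌) e (dl i m ≫ φ)) (dl i m ≫ t)) := by
    conv_lhs => rw [← key φ hφ, ← key t ht]
    rfl
  rw [h]
  exact sg_degenerate _ _ _

/-- Over a vertex of the circle the cylinder is a copy of `Δ[1]`, so its higher simplices are pulled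
back from the radial edge. -/
theorem coneSimplex_gV_degenerate (r : ρ) (v : ULift.{u} (Fin ((word r).length + 1))) {n : ℕ}
    (hn : 2 ≤ n) (t : ⦋n⦌ ⟶ ⦋1⦌) :
    (coneSimplex (fun r => wordMap (word r)) r (gV (circleEnds (word r)) (op ⦋n⦌) v) t :
      (presentation word).X _⦋n⦌) ∈ (presentation word).X.degenerate n := by
  refine ⟨1, by omega, t, coneSimplex (fun r => wordMap (word r)) r
    (gV (circleEnds (word r)) (op ⦋1⦌) v) (𝟙 _), ?_⟩
  change coneSimplex (fun r => wordMap (word r)) r (gV (circleEnds (word r)) (op ⦋n⦌) v)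
    (t ≫ 𝟙 _) = _
  rw [Category.comp_id]

/-- The presentation complex is two-dimensional. -/
theorem presentation_degenerate (x : (presentation word).X _⦋3⦌) :
    x ∈ (presentation word).X.degenerate 3 := by
  induction x using Quot.ind with
  | mk x =>
    rcases x with y | ⟨r, x, t⟩
    · exact SSet.degenerate_app_apply (graph_degenerate (by decide) y) (presIncl word).f
    · induction x using Quot.ind with
      | mk x =>
        rcases x with v | ⟨e, φ⟩
        · exact coneSimplex_gV_degenerate word r v (by decide) t
        · have hφ := fun i j (h : i ≤ j) => φ.toOrderHom.monotone h
          have ht := fun i j (h : i ≤ j) => t.toOrderHom.monotone h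
          have hφ' : (φ.toOrderHom (3 : Fin 4)).1 < 2 := (φ.toOrderHom (3 : Fin 4)).2
          have ht' : (t.toOrderHom (3 : Fin 4)).1 < 2 := (t.toOrderHom (3 : Fin 4)).2
          have a1 : (φ.toOrderHom (0 : Fin 4)).1 ≤ (φ.toOrderHom (1 : Fin 4)).1 :=
            hφ (0 : Fin 4) (1 : Fin 4) (by decide)
          have a2 : (φ.toOrderHom (1 : Fin 4)).1 ≤ (φ.toOrderHom (2 : Fin 4)).1 :=
            hφ (1 : Fin 4) (2 : Fin 4) (by decide)
          have a3 : (φ.toOrderHom (2 : Fin 4)).1 ≤ (φ.toOrderHom (3 : Fin 4)).1 :=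
            hφ (2 : Fin 4) (3 : Fin 4) (by decide)
          have b1 : (t.toOrderHom (0 : Fin 4)).1 ≤ (t.toOrderHom (1 : Fin 4)).1 :=
            ht (0 : Fin 4) (1 : Fin 4) (by decide)
          have b2 : (t.toOrderHom (1 : Fin 4)).1 ≤ (t.toOrderHom (2 : Fin 4)).1 :=
            ht (1 : Fin 4) (2 : Fin 4) (by decide)
          have b3 : (t.toOrderHom (2 : Fin 4)).1 ≤ (t.toOrderHom (3 : Fin 4)).1 :=
            ht (2 : Fin 4) (3 : Fin 4) (by decide)
          -- Each of the two coordinates can increase at most once, so among the three consecutive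
          -- steps one is constant in both.
          by_cases c1 : (φ.toOrderHom (0 : Fin 4)).1 = (φ.toOrderHom (1 : Fin 4)).1 ∧
              (t.toOrderHom (0 : Fin 4)).1 = (t.toOrderHom (1 : Fin 4)).1
          · exact coneSimplex_gE_degenerate word r e φ t 0 (by decide) (Fin.ext c1.1) (Fin.ext c1.2)
          by_cases c2 : (φ.toOrderHom (1 : Fin 4)).1 = (φ.toOrderHom (2 : Fin 4)).1 ∧
              (t.toOrderHom (1 : Fin 4)).1 = (t.toOrderHom (2 : Fin 4)).1
          · exact coneSimplex_gE_degenerate word r e φ t 1 (by decide) (Fin.ext c2.1) (Fin.ext c2.2)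
          · exact coneSimplex_gE_degenerate word r e φ t 2 (by decide) (Fin.ext (by omega :
              (φ.toOrderHom (2 : Fin 4)).1 = (φ.toOrderHom (3 : Fin 4)).1)) (Fin.ext (by omega :
              (t.toOrderHom (2 : Fin 4)).1 = (t.toOrderHom (3 : Fin 4)).1))

/-- Normalized cochains vanish in degree three, where all simplices are degenerate, so a 2-cochain
is automatically closed. -/
theorem cD_eq_zero_of_mem_two {κ : Cbar (presentation word) A}
    (hκ : κ ∈ Cdeg (presentation word) A 2) : cD _ A κ = 0 := by
  apply Subtype.ext; funext k x
  by_cases hk : k = 3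
  · subst hk
    exact (cD _ A κ).2.1 3 x (presentation_degenerate word x)
  · rw [cD_mem_Cdeg 2 κ hκ k hk]; rfl

/-- Relative `2`-cochains are determined by their values on the triangles of the discs. -/
theorem relative_cochain_two_ext {f g : Cbar (presentation word) A}
    (hf : f ∈ Cdeg (presentation word) A 2 ⊓ CRel A (presIncl word))
    (hg : g ∈ Cdeg (presentation word) A 2 ⊓ CRel A (presIncl word))
    (hl : ∀ r e, ev A (discLower word r e) f = ev A (discLower word r e) g)
    (hu : ∀ r e, ev A (discUpper word r e) f = ev A (discUpper word r e) g) : f = g := by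
  apply Subtype.ext; funext k x
  by_cases hk : k = 2
  swap
  · rw [hf.1 k hk, hg.1 k hk]
  subst hk
  by_cases hdeg : x ∈ (presentation word).X.degenerate 2
  · rw [f.2.1 _ _ hdeg, g.2.1 _ _ hdeg]
  induction x using Quot.ind with
  | mk x =>
    rcases x with y | ⟨r, x, t⟩
    · have hf' : pull A (presIncl word) f = 0 := hf.2
      have hg' : pull A (presIncl word) g = 0 := hg.2
      exact congrFun (congrFun (congrArg Subtype.val (hf'.trans hg'.symm)) 2) y
    · induction x using Quot.ind with
      | mk x =>
        rcases x with v | ⟨e, φ⟩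
        · exact absurd (coneSimplex_gV_degenerate word r v le_rfl t) hdeg
        · have a1 : (φ.toOrderHom (0 : Fin 3)).1 ≤ (φ.toOrderHom (1 : Fin 3)).1 :=
            φ.toOrderHom.monotone (by decide : (0 : Fin 3) ≤ 1)
          have a2 : (φ.toOrderHom (1 : Fin 3)).1 ≤ (φ.toOrderHom (2 : Fin 3)).1 :=
            φ.toOrderHom.monotone (by decide : (1 : Fin 3) ≤ 2)
          have a3 : (φ.toOrderHom (2 : Fin 3)).1 < 2 := (φ.toOrderHom (2 : Fin 3)).2
          have b1 : (t.toOrderHom (0 : Fin 3)).1 ≤ (t.toOrderHom (1 : Fin 3)).1 :=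
            t.toOrderHom.monotone (by decide : (0 : Fin 3) ≤ 1)
          have b2 : (t.toOrderHom (1 : Fin 3)).1 ≤ (t.toOrderHom (2 : Fin 3)).1 :=
            t.toOrderHom.monotone (by decide : (1 : Fin 3) ≤ 2)
          have b3 : (t.toOrderHom (2 : Fin 3)).1 < 2 := (t.toOrderHom (2 : Fin 3)).2
          have c1 : ¬((φ.toOrderHom (0 : Fin 3)).1 = (φ.toOrderHom (1 : Fin 3)).1 ∧
              (t.toOrderHom (0 : Fin 3)).1 = (t.toOrderHom (1 : Fin 3)).1) := fun c1 =>
            hdeg (coneSimplex_gE_degenerate word r e φ t 0 (by decide) (Fin.ext c1.1) (Fin.ext c1.2))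
          have c2 : ¬((φ.toOrderHom (1 : Fin 3)).1 = (φ.toOrderHom (2 : Fin 3)).1 ∧
              (t.toOrderHom (1 : Fin 3)).1 = (t.toOrderHom (2 : Fin 3)).1) := fun c2 =>
            hdeg (coneSimplex_gE_degenerate word r e φ t 1 (by decide) (Fin.ext c2.1) (Fin.ext c2.2))
          -- A nondegenerate chain of three vertices in the square increases exactly one coordinate
          -- at each step. The coordinate along the segment increases first for the lower triangle
          -- and second for the upper one.
          by_cases hm : (φ.toOrderHom (1 : Fin 3)).1 = 1
          · have h1 : φ = SimplexCategory.σ (1 : Fin 2) := by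
              apply hom_ext'; intro k; fin_cases k
              · exact (by omega : (φ.toOrderHom (0 : Fin 3)).1 = 0)
              · exact hm
              · exact (by omega : (φ.toOrderHom (2 : Fin 3)).1 = 1)
            have h2 : t = SimplexCategory.σ (0 : Fin 2) := by
              apply hom_ext'; intro k; fin_cases k
              · exact (by omega : (t.toOrderHom (0 : Fin 3)).1 = 0)
              · exact (by omega : (t.toOrderHom (1 : Fin 3)).1 = 0)
              · exact (by omega : (t.toOrderHom (2 : Fin 3)).1 = 1)
            subst h1 h2
            exact hl r e.down
          · have h1 : φ = SimplexCategory.σ (0 : Fin 2) := by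
              apply hom_ext'; intro k; fin_cases k
              · exact (by omega : (φ.toOrderHom (0 : Fin 3)).1 = 0)
              · exact (by omega : (φ.toOrderHom (1 : Fin 3)).1 = 0)
              · exact (by omega : (φ.toOrderHom (2 : Fin 3)).1 = 1)
            have h2 : t = SimplexCategory.σ (1 : Fin 2) := by
              apply hom_ext'; intro k; fin_cases k
              · exact (by omega : (t.toOrderHom (0 : Fin 3)).1 = 0)
              · exact (by omega : (t.toOrderHom (1 : Fin 3)).1 = 1)
              · exact (by omega : (t.toOrderHom (2 : Fin 3)).1 = 1)
            subst h1 h2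
            exact hu r e.down

/-- The cochain concentrated in one positive degree given by a function on simplices. -/
def singleCochain {X : PSSet.{u}} (n : ℕ) (F : X.X _⦋n + 1⦌ → A)
    (hF : ∀ x ∈ X.X.degenerate (n + 1), F x = 0) : Cbar X A :=
  ⟨Pi.single (n + 1) F, by
    refine ⟨fun k x hx => ?_, ?_, n + 2, fun k hk => ?_⟩
    · by_cases hk : k = n + 1
      · subst hk; rw [Pi.single_eq_same]; exact hF x hx
      · rw [Pi.single_eq_of_ne hk]; rfl
    · rw [Pi.single_eq_of_ne (by omega)]; rfl
    · rw [Pi.single_eq_of_ne (by omega)]⟩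

theorem singleCochain_mem {X : PSSet.{u}} (n : ℕ) (F : X.X _⦋n + 1⦌ → A)
    (hF : ∀ x ∈ X.X.degenerate (n + 1), F x = 0) : singleCochain n F hF ∈ Cdeg X A (n + 1) :=
  fun _ hk => Pi.single_eq_of_ne hk _

theorem ev_singleCochain {X : PSSet.{u}} (n : ℕ) (F : X.X _⦋n + 1⦌ → A)
    (hF : ∀ x ∈ X.X.degenerate (n + 1), F x = 0) (x : X.X _⦋n + 1⦌) :
    ev A x (singleCochain n F hF) = F x :=
  congrFun (Pi.single_eq_same (M := fun n : ℕ => X.X _⦋n⦌ → A) (n + 1) F) x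

theorem singleCochain_mem_CRel {X Y : PSSet.{u}} (φ : PHom X Y) (n : ℕ) (F : Y.X _⦋n + 1⦌ → A)
    (hF : ∀ x ∈ Y.X.degenerate (n + 1), F x = 0) (h : ∀ x, F (φ.f.app _ x) = 0) :
    singleCochain n F hF ∈ CRel A φ := by
  refine Subtype.ext (funext fun k => funext fun x => ?_)
  by_cases hk : k = n + 1
  · subst hk
    exact (ev_singleCochain n F hF (φ.f.app _ x)).trans (h x)
  · exact congrFun (Pi.single_eq_of_ne (M := fun n : ℕ => Y.X _⦋n⦌ → A) hk F) _

/-- The values of `discEdgeFun` on the `1`-simplices over the diagonal of `Δ[1]`. -/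
def discEdgeInner (p q : ∀ r : ρ, Fin ((word r).length + 1) → A) (r : ρ) :
    (circle (word r)).X _⦋1⦌ → A :=
  Quot.lift (Sum.elim (fun v => p r v.down) fun s => if s.2 = 𝟙 ⦋1⦌ then q r s.1.down else
    p r (circleEnds (word r) s.1 (s.2.toOrderHom 0)).down) (by
      rintro _ _ ⟨e, i⟩
      exact if_neg (id_ne_const i).symm)

/-- The function on the `1`-simplices of the presentation complex with prescribed values on the
radial and on the diagonal edges of the discs. -/
def discEdgeFun (p q : ∀ r : ρ, Fin ((word r).length + 1) → A) (hp : ∀ r, p r 0 = 0) :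
    (presentation word).X _⦋1⦌ → A :=
  Quot.lift (Sum.elim (fun _ => 0) fun z =>
      if z.2.2 = 𝟙 ⦋1⦌ then discEdgeInner word p q z.1 z.2.1 else 0) (by
    rintro _ _ (⟨r, x, rfl, rfl⟩ | ⟨r, x, rfl, rfl⟩ | ⟨r, t, rfl, rfl⟩)
    · exact if_neg (t := discEdgeInner word p q r x) (id_ne_const 0).symm
    · exact if_neg (t := discEdgeInner word p q r x) (id_ne_const 1).symm
    -- The radial edge over the basepoint is collapsed, which forces `p r 0 = 0`.
    · change (if t = 𝟙 ⦋1⦌ then p r 0 else 0) = 0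
      rw [hp, ite_self])

theorem discEdgeFun_coneSimplex (p q : ∀ r : ρ, Fin ((word r).length + 1) → A)
    (hp : ∀ r, p r 0 = 0) (r : ρ) (x : (circle (word r)).X _⦋1⦌) (t : ⦋1⦌ ⟶ ⦋1⦌) :
    discEdgeFun word p q hp (coneSimplex (fun r => wordMap (word r)) r x t) =
      if t = 𝟙 ⦋1⦌ then discEdgeInner word p q r x else 0 := rfl

/-- There is a single vertex, so a degenerate 1-simplex is the one on the basepoint. It lies in
`X_S`, where the function is zero. -/
theorem discEdgeFun_degenerate (p q : ∀ r : ρ, Fin ((word r).length + 1) → A)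
    (hp : ∀ r, p r 0 = 0) (x : (presentation word).X _⦋1⦌)
    (hx : x ∈ (presentation word).X.degenerate 1) : discEdgeFun word p q hp x = 0 := by
  obtain ⟨j, -, y, rfl⟩ := degenerate_exists hx
  rw [presentation_vertex word y]
  rfl

theorem discEdgeFun_radial (p q : ∀ r : ρ, Fin ((word r).length + 1) → A) (hp : ∀ r, p r 0 = 0)
    (r : ρ) (v : Fin ((word r).length + 1)) :
    discEdgeFun word p q hp (discRadial word r v) = p r v :=
  (discEdgeFun_coneSimplex word p q hp r _ _).trans (if_pos rfl)

theorem discEdgeFun_diagonal (p q : ∀ r : ρ, Fin ((word r).length + 1) → A) (hp : ∀ r, p r 0 = 0)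
    (r : ρ) (e : Fin ((word r).length + 1)) :
    discEdgeFun word p q hp (discOne word r e (𝟙 _) (𝟙 _)) = q r e :=
  ((discEdgeFun_coneSimplex word p q hp r _ _).trans (if_pos rfl)).trans
    (if_pos rfl : (if 𝟙 ⦋1⦌ = 𝟙 ⦋1⦌ then q r e else
      p r (circleEnds (word r) ⟨e⟩ ((𝟙 ⦋1⦌ : ⦋1⦌ ⟶ ⦋1⦌).toOrderHom 0)).down) = q r e)

/-- A relative `2`-cochain that vanishes on all the discs is a relative coboundary. -/
theorem exists_cD_eq {κ : Cbar (presentation word) A}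
    (hκ : κ ∈ Cdeg (presentation word) A 2 ⊓ CRel A (presIncl word))
    (h : ∀ r, evalChain (discChain word A r) κ = 0) :
    ∃ η ∈ Cdeg (presentation word) A 1 ⊓ CRel A (presIncl word), cD _ A η = κ := by
  -- The vanishing evaluation on the disc is exactly the condition for the sector values to be
  -- differences of a function `p` of the vertices. These are the values for the radial edges.
  have hp : ∀ r, ∃ p : Fin ((word r).length + 1) → A, p 0 = 0 ∧
      ∀ e, p (e + 1) - p e = sgn A (segSign (word r) e) *
        (ev A (discLower word r e) κ - ev A (discUpper word r e) κ) := fun r =>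
    exists_cyclic_difference _ ((evalChain_discChain word A r κ).symm.trans (h r))
  choose p hp0 hp using hp
  -- The diagonal values are forced by the equation on the upper triangle. The equation on the lower
  -- triangle is then the difference equation for `p`.
  let q : ∀ r : ρ, Fin ((word r).length + 1) → A := fun r e =>
    p r (circleEnds (word r) ⟨e⟩ 0).down - ev A (discUpper word r e) κ
  let η := singleCochain (X := presentation word) 0 (discEdgeFun word p q hp0)
    (discEdgeFun_degenerate word p q hp0)
  have hη : η ∈ Cdeg (presentation word) A 1 ⊓ CRel A (presIncl word) :=
    ⟨singleCochain_mem _ _ _, singleCochain_mem_CRel _ _ _ _ fun _ => rfl⟩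
  have hdη : pull A (presIncl word) (cD _ A η) = 0 := by
    have : pull A (presIncl word) η = 0 := hη.2
    rw [pull_cD, this, map_zero]
  have hrad : ∀ r v, ev A (discRadial word r v) η = p r v := fun r v =>
    (ev_singleCochain 0 _ _ _).trans (discEdgeFun_radial word p q hp0 r v)
  have hdiag : ∀ r e, ev A (discOne word r e (𝟙 _) (𝟙 _)) η = q r e := fun r e =>
    (ev_singleCochain 0 _ _ _).trans (discEdgeFun_diagonal word p q hp0 r e)
  refine ⟨η, hη, relative_cochain_two_ext word ⟨cD_mem_Cdeg 1 η hη.1, hdη⟩ hκ ?_ ?_⟩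
  · intro r e
    have hx : ev A ((presIncl word).f.app (op ⦋1⦌) (wordEdge (word r) e)) η = 0 :=
      ev_singleCochain (X := presentation word) 0 _ _ _
    rw [ev_cD_two, discLower_face_zero, discLower_face_one, discLower_face_two, hrad, hdiag, hx]
    have := hp r e
    cases hs : segSign (word r) e
    · simp only [q, (circleEnds_of_neg _ hs).1, (circleEnds_of_neg _ hs).2]
      simp only [hs, sgn, Bool.false_eq_true, if_false] at this
      linear_combination -this
    · simp only [q, (circleEnds_of_pos _ hs).1, (circleEnds_of_pos _ hs).2]
      simp only [hs, sgn, if_true] at this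
      linear_combination this
  · intro r e
    rw [ev_cD_two, ev_discUpper_face_zero, discUpper_face_one, discUpper_face_two, hrad, hdiag]
    simp [q]

/-- The gluings identify simplices with a constant coordinate. Functions supported where the
coordinates are degeneracies are therefore compatible with them. -/
theorem const_ne_σ (i : Fin 2) (j : Fin 2) :
    SimplexCategory.const ⦋2⦌ ⦋1⦌ i ≠ SimplexCategory.σ j := by
  intro h
  have h0 : i = (SimplexCategory.σ j).toOrderHom (0 : Fin 3) :=
    congrArg (fun f : ⦋2⦌ ⟶ ⦋1⦌ => f.toOrderHom (0 : Fin 3)) h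
  have h1 : i = (SimplexCategory.σ j).toOrderHom (2 : Fin 3) :=
    congrArg (fun f : ⦋2⦌ ⟶ ⦋1⦌ => f.toOrderHom (2 : Fin 3)) h
  have h2 : (0 : Fin 2) = 1 := by
    fin_cases j
    · exact h0.symm.trans h1
    · exact h0.symm.trans h1
  exact absurd h2 (by decide)

/-- The values of `discTriangleFun` on the `2`-simplices over the first degeneracy of `Δ[1]`. -/
def discTriangleInner (a : ρ → A) (r : ρ) : (circle (word r)).X _⦋2⦌ → A :=
  Quot.lift (Sum.elim (fun _ => 0) fun s =>
    if s.2 = SimplexCategory.σ (1 : Fin 2) ∧ s.1.down = 0 then a r else 0) (by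
      rintro _ _ ⟨e, i⟩
      exact if_neg fun h => const_ne_σ i 1 h.1)

/-- The function on the `2`-simplices of the presentation complex with prescribed values on the
lower triangles of the standard sectors, and zero elsewhere. -/
def discTriangleFun (a : ρ → A) : (presentation word).X _⦋2⦌ → A :=
  Quot.lift (Sum.elim (fun _ => 0) fun z =>
      if z.2.2 = SimplexCategory.σ (0 : Fin 2) then discTriangleInner word a z.1 z.2.1 else 0) (by
    rintro _ _ (⟨r, x, rfl, rfl⟩ | ⟨r, x, rfl, rfl⟩ | ⟨r, t, rfl, rfl⟩)
    · exact if_neg (t := discTriangleInner word a r x) (const_ne_σ 0 0)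
    · exact if_neg (t := discTriangleInner word a r x) (const_ne_σ 1 0)
    · change (if t = SimplexCategory.σ (0 : Fin 2) then 0 else 0) = 0
      rw [ite_self])

theorem discTriangleFun_coneSimplex (a : ρ → A) (r : ρ) (x : (circle (word r)).X _⦋2⦌)
    (t : ⦋2⦌ ⟶ ⦋1⦌) :
    discTriangleFun word a (coneSimplex (fun r => wordMap (word r)) r x t) =
      if t = SimplexCategory.σ (0 : Fin 2) then discTriangleInner word a r x else 0 := rfl

theorem discTriangleInner_gE (a : ρ → A) (r : ρ) (e : ULift.{u} (Fin ((word r).length + 1)))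
    (φ : ⦋2⦌ ⟶ ⦋1⦌) :
    discTriangleInner word a r (gE (circleEnds (word r)) (op ⦋2⦌) e φ) =
      if φ = SimplexCategory.σ (1 : Fin 2) ∧ e.down = 0 then a r else 0 := rfl

/-- A degenerate triangle repeats a vertex in both coordinates at the same place, whereas on the
lower triangle `σ 1` separates the first two vertices and `σ 0` the last two. -/
theorem discTriangleFun_degenerate (a : ρ → A) (x : (presentation word).X _⦋2⦌)
    (hx : x ∈ (presentation word).X.degenerate 2) : discTriangleFun word a x = 0 := by
  obtain ⟨j, hj, y, rfl⟩ := degenerate_exists hx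
  induction y using Quot.ind with
  | mk y =>
    rcases y with y | ⟨r, y, t⟩
    · rfl
    · by_cases ht : sg j 1 ≫ t = SimplexCategory.σ (0 : Fin 2)
      swap
      · exact if_neg ht
      · refine (if_pos ht).trans ?_
        induction y using Quot.ind with
        | mk y =>
          rcases y with v | ⟨e, φ⟩
          · rfl
          · refine if_neg fun h => ?_
            obtain rfl | rfl : j = 0 ∨ j = 1 := by omega
            · have h0 : φ.toOrderHom (0 : Fin 2) = 0 :=
                congrArg (fun f : ⦋2⦌ ⟶ ⦋1⦌ => f.toOrderHom (0 : Fin 3)) h.1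
              have h1 : φ.toOrderHom (0 : Fin 2) = 1 :=
                congrArg (fun f : ⦋2⦌ ⟶ ⦋1⦌ => f.toOrderHom (1 : Fin 3)) h.1
              rw [h0] at h1
              exact absurd h1 (by decide)
            · have h0 : t.toOrderHom (1 : Fin 2) = 0 :=
                congrArg (fun f : ⦋2⦌ ⟶ ⦋1⦌ => f.toOrderHom (1 : Fin 3)) ht
              have h1 : t.toOrderHom (1 : Fin 2) = 1 :=
                congrArg (fun f : ⦋2⦌ ⟶ ⦋1⦌ => f.toOrderHom (2 : Fin 3)) ht
              rw [h0] at h1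
              exact absurd h1 (by decide)

theorem discTriangleFun_lower (a : ρ → A) (r : ρ) (e : Fin ((word r).length + 1)) :
    discTriangleFun word a (discLower word r e) = if e = 0 then a r else 0 := by
  have h : discTriangleInner word a r ((circle (word r)).X.σ 1 (circleEdge (word r) e)) =
      if (SimplexCategory.σ (1 : Fin 2) ≫ 𝟙 _ : ⦋2⦌ ⟶ ⦋1⦌) = SimplexCategory.σ (1 : Fin 2) ∧ e = 0
      then a r else 0 := discTriangleInner_gE word a r ⟨e⟩ _
  rw [discLower, discTriangleFun_coneSimplex, if_pos rfl, h]
  simp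

theorem discTriangleFun_upper (a : ρ → A) (r : ρ) (e : Fin ((word r).length + 1)) :
    discTriangleFun word a (discUpper word r e) = 0 := by
  rw [discUpper, discTriangleFun_coneSimplex]
  refine if_neg fun h => ?_
  have h1 : (0 : Fin 2) = 1 :=
    (congrArg (fun f : ⦋2⦌ ⟶ ⦋1⦌ => f.toOrderHom (1 : Fin 3)) h).symm
  exact absurd h1 (by decide)

/-- There are relative `2`-cocycles with prescribed values on the discs. -/
theorem exists_evalChain_eq (a : ρ → A) :
    ∃ κ ∈ Cdeg (presentation word) A 2 ⊓ CRel A (presIncl word),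
      ∀ r, evalChain (discChain word A r) κ = a r := by
  -- The cochain is supported on the lower triangles of the standard sectors. The standard segment
  -- is present even for the empty word and has positive sign, so each disc sees its prescribed
  -- value exactly once.
  refine ⟨singleCochain (X := presentation word) 1 (discTriangleFun word a)
    (discTriangleFun_degenerate word a),
    ⟨singleCochain_mem _ _ _, singleCochain_mem_CRel _ _ _ _ fun _ => rfl⟩, fun r => ?_⟩
  rw [evalChain_discChain]
  have h : ∀ e, sgn A (segSign (word r) e) *
      (ev A (discLower word r e) (singleCochain (X := presentation word) 1 (discTriangleFun word a)
        (discTriangleFun_degenerate word a)) -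
      ev A (discUpper word r e) (singleCochain (X := presentation word) 1 (discTriangleFun word a)
        (discTriangleFun_degenerate word a))) = if e = 0 then a r else 0 := by
    intro e
    rw [ev_singleCochain, ev_singleCochain, discTriangleFun_lower, discTriangleFun_upper]
    split_ifs with he
    · subst he
      have : segSign (word r) 0 = true := rfl
      simp [this, sgn]
    · simp
  exact (Finset.sum_congr rfl fun e _ => h e).trans (by simp)

end RelativeCohomology

end

end LetterBraiding

namespace LetterBraiding

/-! ### Comparison of the Massey product with Magnus coefficients. -/

section Comparison

open TensorAlgebra

variable {A : Type v} [CommRing A] {S ρ : Type u} (word : ρ → List (S × Bool))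

theorem eq_zero_of_discEval_eq_zero (c : H2Rel A (presIncl word))
    (hc : ∀ r, discEval word A r c = 0) : c = 0 := by
  obtain ⟨κ, rfl⟩ := Submodule.mkQ_surjective _ c
  obtain ⟨η, hη, hκ⟩ := exists_cD_eq word κ.2.1 hc
  exact (Submodule.Quotient.mk_eq_zero _).2 ⟨η, hη, hκ⟩

theorem discEval_bijective :
    Function.Bijective fun (c : H2Rel A (presIncl word)) (r : ρ) => discEval word A r c := by
  refine ⟨fun c c' h => sub_eq_zero.1 (eq_zero_of_discEval_eq_zero word _ fun r => ?_), fun a => ?_⟩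
  · rw [map_sub, sub_eq_zero]
    exact congrFun h r
  · obtain ⟨κ, hκ, h⟩ := exists_evalChain_eq word a
    exact ⟨Coh.mk ⟨κ, hκ, cD_eq_zero_of_mem_two word hκ.1⟩, funext h⟩

/-- A relative bar primitive of `-κ` restricts to zero on `X_S`, so it lifts the tensor 0. The disc
computation then gives value zero on every disc, and such a class vanishes. -/
theorem weightOne_injective : Function.Injective (weightOne A (presIncl word)) := by
  rw [injective_iff_map_eq_zero]
  intro c hc
  obtain ⟨κ, rfl⟩ := Submodule.mkQ_surjective _ c
  obtain ⟨ξ, ⟨-, hξ⟩, h⟩ := (Submodule.Quotient.mk_eq_zero _).1 hc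
  refine eq_zero_of_discEval_eq_zero word _ fun r => ?_
  have hξ' : barPull A (presIncl word) ξ = tmap (wedgeCochain A S) 0 := by
    rw [map_zero]; exact hξ
  exact (evalChain_discChain_eq_magnusCoeff word r κ.2.1.1 h 0 hξ').trans (map_zero _)

/-- If a relative Massey product has weight one, its values on the discs are coefficients of the
Magnus expansions of the relations. -/
theorem discEval_eq_magnusCoeff (T : TensorAlgebra A (S → A)) (c : H2Rel A (presIncl word))
    (h : relMassey A (presIncl word) (presIncl_injective word) (wedgeClass A S T) =
      weightOne A (presIncl word) c) (r : ρ) :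
    discEval word A r c = magnusCoeff A (FreeGroup.mk (word r)) T := by
  obtain ⟨κ, rfl⟩ := Submodule.mkQ_surjective _ c
  obtain ⟨ξ, ⟨-, hξ⟩, h⟩ := (coh_mk_eq_iff (d := barDiff (presentation word) A) _ _).1 h
  have hξ' : barPull A (presIncl word) ξ = 0 := hξ
  -- The lift by zero has differential cohomologous to `-κ` through a relative `ξ`. Subtracting `ξ`
  -- leaves a lift of `T` whose differential is exactly `-κ`.
  let y := tmap (extend A (presIncl word) (presIncl_injective word)) (tmap (wedgeCochain A S) T)
  have h' : barDiff (presentation word) A ξ =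
      barDiff (presentation word) A y - -ι A κ.1 := h
  refine evalChain_discChain_eq_magnusCoeff word r (y := y - ξ) κ.2.1.1 ?_ T ?_
  · rw [map_sub, h', sub_sub_cancel]
  · rw [map_sub, hξ', sub_zero]
    exact barPull_extend (presIncl word) (presIncl_injective word) _

end Comparison

end LetterBraiding

theorem proposition5p12 {A : Type v} [CommRing A] [IsDomain A] [IsPrincipalIdealRing A]
    {S : Type u} (R : Set (FreeGroup S)) (word : R → List (S × Bool))
    (hword : ∀ r : R, FreeGroup.mk (word r) = r.1) :
    (Function.Bijective fun (c : H2Rel A (presIncl word)) (r : R) => discEval word A r c) ∧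
    Function.Injective (weightOne A (presIncl word)) ∧
    ∀ (T : TensorAlgebra A (S → A)) (c : H2Rel A (presIncl word)),
      relMassey A (presIncl word) (presIncl_injective word) (wedgeClass A S T) =
          weightOne A (presIncl word) c →
        ∀ (r : R) (w : List (S × Bool)), FreeGroup.mk w = r.1 →
          braidingNumber A T w = discEval word A r c := by
  refine ⟨discEval_bijective word, weightOne_injective word, fun T c h r w hw => ?_⟩
  -- Both sides are the Magnus coefficient of one group element, spelled by `w` on one side and by
  -- the attaching word on the other.
  rw [discEval_eq_magnusCoeff word T c h r, braidingNumber_eq_magnusCoeff, hw, hword]
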